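/- **Conventions.** All groups are countable. A probability measure preserving (pmp) action $\Gamma\curvearrowright(X,\mu)$ is called *free* if $\mu(\{x : gx=x\})=0$ for every $g\neq e$. A *quotient* of $\Gamma\curvearrowright(X,\mu)$ is a pmp action $\Gamma\curvearrowright(Y,\nu)$ together with a measure preserving map $p:X\to Y$ satisfying $p(gx)=g\,p(x)$ for all $g \in \Gamma$ and a.e. $x$. The action $\Gamma\curvearrowright(X,\mu)$ is called *rigid* if the inclusion $A=L^\infty(X)\subset M=L^\infty(X)\rtimes\Gamma$ has the relative property (T), where $M$ carries the trace $\tau$ with $\tau(au_e)=\int a\,d\mu$ and $\tau(au_g)=0$ for $g\ne e$. That is: whenever $\mathcal H$ is a Hilbert $M$-$M$-bimodule and $\xi_n\in\mathcal H$ are vectors with $\langle x\xi_n,\xi_n\rangle=\tau(x)=\langle\xi_n x,\xi_n\rangle$ for all $n$ and all $x\in M$ and with $\|x\xi_n-\xi_nx\|\to0$ for all $x\in M$, then $\|\xi_n-P_A(\xi_n)\|\to0$, where $P_A$ is the orthogonal projection of $\mathcal H$ onto the subspace of $A$-central vectors. Let $k\ge0$ and $n\ge2$ be integers and let $\Lambda\subset\mathrm{SL}(k,\mathbb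 Z)$ be a subgroup. Put $$\Gamma=\begin{pmatrix}\Lambda&\mathrm M_{k,n}(\mathbb Z)\\0&\mathrm{SL}(n,\mathbb Z)\end{pmatrix}\subset\mathrm{SL}(k+n,\mathbb Z),\qquad H=\mathbb Z^{k}\oplus\mathbb Z^n,$$ and let $\pi:\Gamma\to\Lambda$ be the natural quotient homomorphism. The groups $\Gamma$ and $\Lambda$ act on the dual groups $\widehat H\cong\mathbb T^{k+n}$ and $\widehat{\mathbb Z^k}=\mathbb T^k$ by $(g\cdot\omega)(x)=\omega(g^{-1}x)$, preserving Lebesgue measure; $\Gamma$ also acts on $\mathbb T^k$ through $\pi$. Products carry the product measure and the diagonal $\Gamma$-action. 1. Suppose that $\Lambda x$ is infinite for every $x\in\mathbb Z^k\setminus\{0\}$ and that $\Lambda\curvearrowright\mathbb T^k$ is not rigid. Then: - The action $\Gamma\curvearrowright\widehat H$ is rigid. The action $\Gamma\curvearrowright\mathbb T^k$ is a quotient of it, through the restriction of characters to $\mathbb Z^k$, and is neither rigid nor free. - The diagonal action $\Gamma\curvearrowright\widehat H\times\widehat H$ is free, ergodic and rigid. - The diagonal action $\Gamma\curvearrowright\mathbb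 T^k\times\widehat H$ is a quotient of $\Gamma\curvearrowright\widehat H\times\widehat H$, through restriction in the first coordinate; it is free and ergodic, but not rigid. 2. If $k\ge1$ and $\Lambda \subset \mathrm{SL}(k,\mathbb Z)$ is amenable, then $\Lambda\curvearrowright\mathbb T^k$ is not rigid. 3. Consequently, quotients of rigid actions need not be rigid: there exist a countable group $G$, a free, ergodic, rigid pmp action of $G$ on a standard probability space, and a quotient of this action on a standard probability space that is free and ergodic, but not rigid. -/

import Mathlib

open MeasureTheory Filter Topology
open scoped ENNReal InnerProductSpace

/-! ### Von Neumann algebras, bimodules and rigid inclusions -/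

noncomputable section

universe u

section VonNeumann

variable {H : Type u} [NormedAddCommGroup H] [InnerProductSpace ℂ H] [CompleteSpace H]

/-- The von Neumann algebra generated by a set `S` of bounded operators: the double commutant of
`S ∪ star S`. -/
def vonNeumannGenerated (S : Set (H →L[ℂ] H)) : VonNeumannAlgebra H where
  toStarSubalgebra :=
    StarSubalgebra.centralizer ℂ (StarSubalgebra.centralizer ℂ S : Set (H →L[ℂ] H))
  centralizer_centralizer' := by
    change Set.centralizer (Set.centralizer ((StarSubalgebra.centralizer ℂ
      (StarSubalgebra.centralizer ℂ S : Set (H →L[ℂ] H)) : StarSubalgebra ℂ (H →L[ℂ] H)) :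
        Set (H →L[ℂ] H))) = _
    rw [StarSubalgebra.coe_centralizer_centralizer, Set.centralizer_centralizer_centralizer]
    exact (StarSubalgebra.coe_centralizer_centralizer ℂ S).symm

theorem subset_vonNeumannGenerated (S : Set (H →L[ℂ] H)) :
    S ⊆ (vonNeumannGenerated S : Set (H →L[ℂ] H)) := by
  have h : ((StarSubalgebra.centralizer ℂ (StarSubalgebra.centralizer ℂ S : Set (H →L[ℂ] H)) :
      StarSubalgebra ℂ (H →L[ℂ] H)) : Set (H →L[ℂ] H)) = _ :=
    StarSubalgebra.coe_centralizer_centralizer ℂ S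
  intro x hx
  change x ∈ ((StarSubalgebra.centralizer ℂ (StarSubalgebra.centralizer ℂ S :
    Set (H →L[ℂ] H)) : StarSubalgebra ℂ (H →L[ℂ] H)) : Set (H →L[ℂ] H))
  rw [h]
  exact Set.subset_centralizer_centralizer (Or.inl hx)

/-- A functional on a von Neumann algebra `M ⊆ B(H)` is normal (ultraweakly continuous) if it has
the form `x ↦ ∑ ⟪eₙ, x fₙ⟫` with `∑ ‖eₙ‖² < ∞` and `∑ ‖fₙ‖² < ∞`. -/
def IsNormalFunctional (M : VonNeumannAlgebra H) (φ : M.toStarSubalgebra → ℂ) : Prop :=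
  ∃ e f : ℕ → H, Summable (fun n => ‖e n‖ ^ 2) ∧ Summable (fun n => ‖f n‖ ^ 2) ∧
    ∀ x : M.toStarSubalgebra, HasSum (fun n => ⟪e n, (x : H →L[ℂ] H) (f n)⟫_ℂ) (φ x)

/-- A Hilbert `M`-`M`-bimodule structure on the Hilbert space `K`: commuting normal unital
`*`-representations of `M` (written `x ξ = left x ξ`) and of the opposite algebra of `M`
(written `ξ x = right (op x) ξ`). -/
structure HilbertBimodule (M : VonNeumannAlgebra H) (K : Type u) [NormedAddCommGroup K]
    [InnerProductSpace ℂ K] [CompleteSpace K] where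
  left : M.toStarSubalgebra →⋆ₐ[ℂ] (K →L[ℂ] K)
  right : (M.toStarSubalgebra)ᵐᵒᵖ →⋆ₐ[ℂ] (K →L[ℂ] K)
  commute : ∀ x y, Commute (left x) (right y)
  left_normal : ∀ ξ η : K, IsNormalFunctional M (fun x => ⟪η, left x ξ⟫_ℂ)
  right_normal : ∀ ξ η : K, IsNormalFunctional M (fun x => ⟪η, right (MulOpposite.op x) ξ⟫_ℂ)

namespace HilbertBimodule

variable {M : VonNeumannAlgebra H} {K : Type u} [NormedAddCommGroup K]
  [InnerProductSpace ℂ K] [CompleteSpace K] (B : HilbertBimodule M K)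

/-- The commutator map `ξ ↦ x ξ - ξ x`. -/
def commutator (x : M.toStarSubalgebra) : K →L[ℂ] K :=
  B.left x - B.right (MulOpposite.op x)

/-- `ξ` is tracial: `⟨x ξ, ξ⟩ = τ(x) = ⟨ξ x, ξ⟩` for all `x ∈ M`. -/
def IsTracial (τ : M.toStarSubalgebra → ℂ) (ξ : K) : Prop :=
  ∀ x : M.toStarSubalgebra,
    ⟪ξ, B.left x ξ⟫_ℂ = τ x ∧ ⟪ξ, B.right (MulOpposite.op x) ξ⟫_ℂ = τ x

/-- `ξₙ` is almost `M`-central: `‖x ξₙ - ξₙ x‖ → 0` for all `x ∈ M`. -/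
def IsAlmostCentral (ξ : ℕ → K) : Prop :=
  ∀ x : M.toStarSubalgebra, Tendsto (fun n => ‖B.commutator x (ξ n)‖) atTop (𝓝 0)

/-- The closed subspace of `A`-central vectors, for `A ⊆ M`. -/
def central (A : Set M.toStarSubalgebra) : Submodule ℂ K where
  carrier := {ξ | ∀ a ∈ A, B.left a ξ = B.right (MulOpposite.op a) ξ}
  add_mem' := by
    intro ξ η hξ hη a ha
    rw [map_add, map_add, hξ a ha, hη a ha]
  zero_mem' := by
    intro a _
    rw [map_zero, map_zero]
  smul_mem' := by
    intro c ξ hξ a ha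
    rw [map_smul, map_smul, hξ a ha]

theorem isClosed_central (A : Set M.toStarSubalgebra) : IsClosed (B.central A : Set K) := by
  have h : (B.central A : Set K) =
      ⋂ a ∈ A, {ξ | B.left a ξ = B.right (MulOpposite.op a) ξ} := by
    ext ξ
    simp [central]
  rw [h]
  exact isClosed_biInter fun a _ =>
    isClosed_eq (B.left a).continuous (B.right (MulOpposite.op a)).continuous

instance (A : Set M.toStarSubalgebra) : CompleteSpace (B.central A) :=
  (B.isClosed_central A).completeSpace_coe

end HilbertBimodule

/-- Rigidity (relative property (T)) of the inclusion `A ⊆ M`, where `M` carries the faithful normal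
tracial state `τ`: for every Hilbert `M`-`M`-bimodule and every sequence `ξₙ` of tracial, almost
`M`-central vectors, `‖ξₙ - P_A ξₙ‖ → 0`, with `P_A` the orthogonal projection onto the `A`-central
vectors. (A tracial vector is automatically a unit vector.) -/
def IsRigidInclusion (M : VonNeumannAlgebra H) (τ : M.toStarSubalgebra → ℂ)
    (A : Set M.toStarSubalgebra) : Prop :=
  ∀ (K : Type u) [NormedAddCommGroup K] [InnerProductSpace ℂ K] [CompleteSpace K]
    (B : HilbertBimodule M K) (ξ : ℕ → K),
    (∀ n, B.IsTracial τ (ξ n)) → B.IsAlmostCentral ξ →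
      Tendsto (fun n => ‖ξ n - (B.central A).starProjection (ξ n)‖) atTop (𝓝 0)

end VonNeumann

/-! ### The crossed product of a probability measure preserving action -/

section CrossedProduct

variable (Γ X : Type u) [MeasurableSpace Γ] [MeasurableSpace X] (μ : Measure X)

/-- The Hilbert space `L²(X) ⊗ ℓ²(Γ) = L²(X × Γ)`. -/
abbrev CrossedSpace : Type u := Lp ℂ 2 (μ.prod (Measure.count : Measure Γ))

variable {X μ}

/-- The function `(x, g) ↦ a x` in `L^∞(X × Γ)`, for `a ∈ L^∞(X)`. -/
def pullbackFst (a : Lp ℂ ∞ μ) : Lp ℂ ∞ (μ.prod (Measure.count : Measure Γ)) :=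
  MemLp.toLp (fun p : X × Γ => a p.1) <| by
    have hq : Measure.QuasiMeasurePreserving (Prod.fst : X × Γ → X)
        (μ.prod (Measure.count : Measure Γ)) μ := Measure.quasiMeasurePreserving_fst
    refine ⟨(Lp.aestronglyMeasurable a).comp_quasiMeasurePreserving hq, ?_⟩
    refine lt_of_le_of_lt ?_ (Lp.memLp a).2
    simp only [eLpNorm_exponent_top, eLpNormEssSup]
    exact essSup_le_of_ae_le _ (hq.ae (ENNReal.ae_le_essSup (fun x => ‖a x‖ₑ)))

/-- The element `a ∈ L^∞(X)` of the crossed product: `(a ξ)(x, g) = a(x) ξ(x, g)`. -/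
def multiplicationOp (a : Lp ℂ ∞ μ) : CrossedSpace Γ X μ →L[ℂ] CrossedSpace Γ X μ :=
  (ContinuousLinearMap.mul ℂ ℂ).holderL (μ.prod (Measure.count : Measure Γ)) ∞ 2 2
    (pullbackFst Γ a)

theorem multiplicationOp_apply (a : Lp ℂ ∞ μ) (ξ : CrossedSpace Γ X μ) :
    multiplicationOp Γ a ξ =ᵐ[μ.prod Measure.count] fun p => a p.1 * ξ p := by
  have h1 := (ContinuousLinearMap.mul ℂ ℂ).coeFn_holder (r := 2) (pullbackFst Γ a) ξ
  have h2 : pullbackFst Γ a =ᵐ[μ.prod Measure.count] fun p => a p.1 := MemLp.coeFn_toLp _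
  filter_upwards [h1, h2] with p h1 h2
  change (ContinuousLinearMap.holder 2 (ContinuousLinearMap.mul ℂ ℂ) (pullbackFst Γ a) ξ) p = _
  rw [h1, h2]
  rfl

variable {Γ} (X μ) [Group Γ] [Countable Γ] [MeasurableSingletonClass Γ] [IsProbabilityMeasure μ]
  [MulAction Γ X] [MeasurableConstSMul Γ X] [SMulInvariantMeasure Γ X μ]

theorem measurePreserving_diag (h : Γ) :
    MeasurePreserving (fun p : X × Γ => (h⁻¹ • p.1, h⁻¹ * p.2))
      (μ.prod Measure.count) (μ.prod Measure.count) := by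
  have : DiscreteMeasurableSpace Γ := inferInstance
  exact (measurePreserving_smul h⁻¹ μ).prod (measurePreserving_mul_left Measure.count h⁻¹)

/-- The canonical unitary `u_h` of the crossed product: `(u_h ξ)(x, g) = ξ(h⁻¹ x, h⁻¹ g)`. -/
def translationOp (h : Γ) : CrossedSpace Γ X μ →L[ℂ] CrossedSpace Γ X μ :=
  (Lp.compMeasurePreservingₗᵢ ℂ _ (measurePreserving_diag X μ h)).toContinuousLinearMap

theorem translationOp_apply (h : Γ) (ξ : CrossedSpace Γ X μ) :
    translationOp X μ h ξ =ᵐ[μ.prod Measure.count] fun p => ξ (h⁻¹ • p.1, h⁻¹ * p.2) :=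
  Lp.coeFn_compMeasurePreserving ξ (measurePreserving_diag X μ h)

variable (Γ)

/-- The crossed product `L^∞(X) ⋊ Γ`, represented on `L²(X × Γ)`. -/
def crossedProduct : VonNeumannAlgebra (CrossedSpace Γ X μ) :=
  vonNeumannGenerated
    (Set.range (multiplicationOp Γ (μ := μ)) ∪ Set.range (translationOp X μ (Γ := Γ)))

/-- The vector `1 ⊗ δ_e` in `L²(X × Γ)`. -/
def vacuum (Γ X : Type u) [MeasurableSpace Γ] [MeasurableSpace X] (μ : Measure X) [Group Γ]
    [Countable Γ] [MeasurableSingletonClass Γ] [IsProbabilityMeasure μ] : CrossedSpace Γ X μ :=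
  indicatorConstLp 2 (s := Set.univ ×ˢ {(1 : Γ)}) (MeasurableSet.univ.prod (.singleton 1))
    (by simp [Measure.prod_prod]) (1 : ℂ)

/-- The canonical trace of the crossed product, `τ(x) = ⟨x (1 ⊗ δ_e), 1 ⊗ δ_e⟩`; thus
`τ(a u_g) = ∫ a dμ` if `g = e`, and `0` otherwise. -/
def crossedTrace (x : (crossedProduct Γ X μ).toStarSubalgebra) : ℂ :=
  ⟪vacuum Γ X μ, (x : CrossedSpace Γ X μ →L[ℂ] CrossedSpace Γ X μ) (vacuum Γ X μ)⟫_ℂ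

/-- `L^∞(X)` as a subset of the crossed product. -/
def crossedBase : Set (crossedProduct Γ X μ).toStarSubalgebra :=
  {x | (x : CrossedSpace Γ X μ →L[ℂ] CrossedSpace Γ X μ) ∈
    Set.range (multiplicationOp Γ (μ := μ))}

/-- A probability measure preserving action is rigid if `L^∞(X) ⊆ L^∞(X) ⋊ Γ` is rigid. -/
def IsRigidAction : Prop :=
  IsRigidInclusion (crossedProduct Γ X μ) (crossedTrace Γ X μ) (crossedBase Γ X μ)

end CrossedProduct

/-! ### Notions for probability measure preserving actions -/

/-- (Essential) freeness: each `g ≠ e` fixes only a null set of points. -/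
def IsEssentiallyFree (Γ X : Type*) [Group Γ] [MulAction Γ X] [MeasurableSpace X]
    (μ : Measure X) : Prop :=
  ∀ g : Γ, g ≠ 1 → μ {x | g • x = x} = 0

/-- `p : X → Y` exhibits `Γ ↷ (Y, ν)` as a quotient of `Γ ↷ (X, μ)`. -/
def IsQuotientMapOfActions (Γ : Type*) {X Y : Type*} [Group Γ] [MulAction Γ X] [MulAction Γ Y]
    [MeasurableSpace X] [MeasurableSpace Y] (p : X → Y) (μ : Measure X) (ν : Measure Y) : Prop :=
  MeasurePreserving p μ ν ∧ ∀ g : Γ, ∀ᵐ x ∂μ, p (g • x) = g • p x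

/-- Amenability of a discrete group: there is a left invariant mean on `ℓ^∞(G)`. -/
def IsAmenableGroup (G : Type*) [Group G] : Prop :=
  ∃ m : lp (fun _ : G => ℝ) ∞ →ₗ[ℝ] ℝ,
    (∀ f, (∀ x, f x = 1) → m f = 1) ∧ (∀ f, (∀ x, 0 ≤ f x) → 0 ≤ m f) ∧
    ∀ (g : G) (f f' : lp (fun _ : G => ℝ) ∞), (∀ x, f' x = f (g * x)) → m f' = m f

/-! ### Actions on tori -/

/-- The torus `(ℝ/ℤ)^ι`, identified with the dual of `ℤ^ι`: the point `θ` is the character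
`x ↦ exp (2 π i ∑ xᵢ θᵢ)`. -/
abbrev Torus (ι : Type) : Type := ι → UnitAddCircle

/-- Lebesgue measure on the torus is the Haar probability measure. -/
instance (ι : Type) [Fintype ι] : IsProbabilityMeasure (volume : Measure (Torus ι)) :=
  haveI : IsProbabilityMeasure (volume : Measure UnitAddCircle) := ⟨UnitAddCircle.measure_univ⟩
  inferInstanceAs (IsProbabilityMeasure (Measure.pi fun _ : ι => volume))

section TorusAction

/-- The group `SL(ι, ℤ)`. -/
abbrev SLZ (ι : Type) [Fintype ι] [DecidableEq ι] : Type := Matrix.SpecialLinearGroup ι ℤ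

variable {ι : Type} [Fintype ι] [DecidableEq ι]

/-- The integer special linear groups are discrete. -/
instance : MeasurableSpace (SLZ ι) := ⊤
instance : DiscreteMeasurableSpace (SLZ ι) := ⟨fun _ => trivial⟩
instance : Countable (SLZ ι) :=
  haveI : Countable (Matrix ι ι ℤ) := inferInstanceAs (Countable (ι → ι → ℤ))
  Subtype.countable

/-- The character of `ℤ^ι` given by a point of the torus, written additively. -/
def Torus.pairing (θ : Torus ι) (x : ι → ℤ) : UnitAddCircle := ∑ i, x i • θ i

/-- The action of `SL(ι, ℤ)` on the dual of `ℤ^ι`, `(g • ω)(x) = ω(g⁻¹ x)`; in coordinates, `g`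
acts by the inverse transpose matrix. -/
instance : MulAction (SLZ ι) (Torus ι) where
  smul g θ := fun j => ∑ i, (g⁻¹ : SLZ ι).1 i j • θ i
  one_smul θ := by
    funext j
    change ∑ i, (1⁻¹ : SLZ ι).1 i j • θ i = θ j
    rw [inv_one]
    change ∑ i, (1 : Matrix ι ι ℤ) i j • θ i = θ j
    simp [Matrix.one_apply]
  mul_smul g h θ := by
    funext j
    change ∑ i, ((g * h)⁻¹ : SLZ ι).1 i j • θ i =
      ∑ l, (g⁻¹ : SLZ ι).1 l j • ∑ i, (h⁻¹ : SLZ ι).1 i l • θ i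
    rw [mul_inv_rev]
    change ∑ i, ((h⁻¹ : SLZ ι).1 * (g⁻¹ : SLZ ι).1) i j • θ i = _
    simp only [Matrix.mul_apply, Finset.sum_smul, Finset.smul_sum, smul_smul]
    rw [Finset.sum_comm]
    simp only [mul_comm]

theorem Torus.smul_apply (g : SLZ ι) (θ : Torus ι) (j : ι) :
    (g • θ) j = ∑ i, (g⁻¹ : SLZ ι).1 i j • θ i := rfl

theorem Torus.pairing_smul (g : SLZ ι) (θ : Torus ι) (x : ι → ℤ) :
    Torus.pairing (g • θ) x = Torus.pairing θ ((g⁻¹ : SLZ ι).1.mulVec x) := by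
  simp only [Torus.pairing, Torus.smul_apply, Matrix.mulVec, dotProduct, Finset.sum_smul,
    Finset.smul_sum, smul_smul]
  rw [Finset.sum_comm]
  simp only [mul_comm]

theorem Torus.continuous_smul (g : SLZ ι) :
    Continuous (fun θ : Torus ι => g • θ) :=
  continuous_pi fun _ => continuous_finsetSum _ fun i _ => (continuous_apply i).zsmul _

instance : MeasurableConstSMul (SLZ ι) (Torus ι) :=
  ⟨fun g => (Torus.continuous_smul g).measurable⟩

instance : SMulInvariantMeasure (SLZ ι) (Torus ι) volume where
  measure_preimage_smul g s hs := by
    let f : Torus ι →+ Torus ι :=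
      { toFun := fun θ => g • θ
        map_zero' := by
          funext j
          simp only [Torus.smul_apply]
          exact Finset.sum_eq_zero fun i _ => smul_zero _
        map_add' := by
          intro θ θ'
          funext j
          change _ = (g • θ) j + (g • θ') j
          simp only [Torus.smul_apply, ← Finset.sum_add_distrib]
          exact Finset.sum_congr rfl fun i _ => smul_add _ _ _ }
    have hf : MeasurePreserving f (volume : Measure (Torus ι)) volume :=
      AddMonoidHom.measurePreserving (f := f) (Torus.continuous_smul g) (MulAction.surjective g)
        (by simp)
    exact hf.measure_preimage hs.nullMeasurableSet

end TorusAction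

section Products

instance {Γ X Y : Type*} [Group Γ] [MulAction Γ X] [MulAction Γ Y]
    [MeasurableSpace X] [MeasurableSpace Y] [MeasurableConstSMul Γ X] [MeasurableConstSMul Γ Y] :
    MeasurableConstSMul Γ (X × Y) :=
  ⟨fun g => (measurable_fst.const_smul g).prodMk (measurable_snd.const_smul g)⟩

instance {Γ X Y : Type*} [Group Γ] [MulAction Γ X] [MulAction Γ Y]
    [MeasurableSpace X] [MeasurableSpace Y] [MeasurableConstSMul Γ X] [MeasurableConstSMul Γ Y]
    (μ : Measure X) (ν : Measure Y) [SFinite μ] [SFinite ν]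
    [SMulInvariantMeasure Γ X μ] [SMulInvariantMeasure Γ Y ν] :
    SMulInvariantMeasure Γ (X × Y) (μ.prod ν) where
  measure_preimage_smul g _ hs :=
    ((measurePreserving_smul g μ).prod (measurePreserving_smul g ν)).measure_preimage
      hs.nullMeasurableSet

end Products

/-! ### The group `Γ` and its actions -/

section BlockGroup

open Matrix (fromBlocks)

variable {k : ℕ} (n : ℕ) (Λ : Subgroup (SLZ (Fin k)))

/-- The group `Γ` of all block matrices `(A, B; 0, D)` in `SL(k + n, ℤ)` with `A ∈ Λ`,
`B ∈ M_{k,n}(ℤ)` and `D ∈ SL(n, ℤ)`. -/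
def blockGroup : Subgroup (SLZ (Fin k ⊕ Fin n)) where
  carrier := {g | ∃ A ∈ Λ, ∃ (B : Matrix (Fin k) (Fin n) ℤ) (D : SLZ (Fin n)),
    g.1 = fromBlocks A.1 B 0 D.1}
  one_mem' := ⟨1, Λ.one_mem, 0, 1, Matrix.fromBlocks_one.symm⟩
  mul_mem' := by
    rintro g g' ⟨A, hA, B, D, h⟩ ⟨A', hA', B', D', h'⟩
    refine ⟨A * A', Λ.mul_mem hA hA', A.1 * B' + B * D'.1, D * D', ?_⟩
    change g.1 * g'.1 = fromBlocks (A.1 * A'.1) _ 0 (D.1 * D'.1)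
    rw [h, h', Matrix.fromBlocks_multiply]
    simp only [Matrix.mul_zero, Matrix.zero_mul, add_zero, zero_add]
  inv_mem' := by
    rintro g ⟨A, hA, B, D, h⟩
    refine ⟨A⁻¹, Λ.inv_mem hA, -((A⁻¹).1 * B * (D⁻¹).1), D⁻¹, ?_⟩
    have hA' : A.1 * (A⁻¹).1 = 1 := congrArg Subtype.val (mul_inv_cancel A)
    have hD' : D.1 * (D⁻¹).1 = 1 := congrArg Subtype.val (mul_inv_cancel D)
    have hg : (g⁻¹).1 * g.1 = 1 := congrArg Subtype.val (inv_mul_cancel g)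
    refine left_inv_eq_right_inv hg ?_
    rw [h, Matrix.fromBlocks_multiply]
    simp only [Matrix.mul_neg, ← Matrix.mul_assoc, hA', hD', Matrix.mul_zero, Matrix.zero_mul,
      Matrix.one_mul, add_zero, zero_add, neg_add_cancel, neg_zero, Matrix.fromBlocks_one]

/-- The quotient homomorphism `π : Γ → Λ`, `(A, B; 0, D) ↦ A`. -/
def blockProjection : blockGroup n Λ →* Λ where
  toFun g := ⟨⟨g.1.1.toBlocks₁₁, by
      obtain ⟨A, -, B, D, h⟩ := g.2
      rw [h, Matrix.toBlocks_fromBlocks₁₁]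
      exact A.2⟩, by
      obtain ⟨A, hA, B, D, h⟩ := g.2
      have : g.1.1.toBlocks₁₁ = A.1 := by rw [h, Matrix.toBlocks_fromBlocks₁₁]
      simp only [this]
      exact hA⟩
  map_one' := by
    apply Subtype.ext
    apply Subtype.ext
    change (1 : Matrix (Fin k ⊕ Fin n) (Fin k ⊕ Fin n) ℤ).toBlocks₁₁ = 1
    rw [← Matrix.fromBlocks_one, Matrix.toBlocks_fromBlocks₁₁]
  map_mul' := by
    intro g g'
    apply Subtype.ext
    apply Subtype.ext
    obtain ⟨A, -, B, D, h⟩ := g.2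
    obtain ⟨A', -, B', D', h'⟩ := g'.2
    change (g.1.1 * g'.1.1).toBlocks₁₁ = g.1.1.toBlocks₁₁ * g'.1.1.toBlocks₁₁
    rw [h, h', Matrix.fromBlocks_multiply]
    simp only [Matrix.toBlocks_fromBlocks₁₁, Matrix.mul_zero, add_zero]

/-- The action of `Γ` on the dual of `ℤ^k` through `π : Γ → Λ`, `g • ω = π(g) • ω`. -/
instance : MulAction (blockGroup n Λ) (Torus (Fin k)) :=
  MulAction.compHom (Torus (Fin k)) (blockProjection n Λ)

instance : MeasurableConstSMul (blockGroup n Λ) (Torus (Fin k)) :=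
  ⟨fun g => measurable_const_smul (blockProjection n Λ g)⟩

instance : SMulInvariantMeasure (blockGroup n Λ) (Torus (Fin k)) volume :=
  ⟨fun g _ hs => measure_preimage_smul_of_nullMeasurableSet hs.nullMeasurableSet
    (blockProjection n Λ g)⟩

/-- The map from the dual of `H = ℤ^k ⊕ ℤ^n` to the dual of `ℤ^k` restricting characters. -/
def restrictTorus (k n : ℕ) (θ : Torus (Fin k ⊕ Fin n)) : Torus (Fin k) :=
  fun i => θ (Sum.inl i)

end BlockGroup

end

/-!
All actions considered are dual to an action `φ : Γ → Aut(D)` on a discrete abelian group `D`: the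
characters `χ_d` of the space `X` satisfy `χ_{φ(g) d}(x) = χ_d(g⁻¹ x)`, they are orthonormal, and
they separate points (`CharacterSystem`). For such actions, questions about `X` become questions
about `D`.

*Rigidity.* The action is rigid if and only if the pair `D ⊆ D ⋊ Γ` has relative property (T), in
the form that almost invariant unit vectors of a unitary representation of `D ⋊ Γ` are almost
invariant uniformly on `D` (`HasRelativeT`). The vectors `χ_d ⊗ δ_g` form a Hilbert basis of
`L²(X) ⊗ ℓ²(Γ)` on which the unitaries `χ_d u_g` of the crossed product act as the left regular
representation of `D ⋊ Γ`. In one direction (`CharacterSystem.isRigidAction_of_hasRelativeT`),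
conjugation by these unitaries turns a bimodule into a representation; a `D`-invariant vector near
an almost central one is the vector of least norm in the closed convex hull of a `D`-orbit, and it
is central for all of `L^∞(X)` by normality of the two actions, because an `L¹` function is
determined by its Fourier coefficients. In the other direction
(`CharacterSystem.hasRelativeT_of_isRigidAction`), a representation `σ` on `L` gives a bimodule on
the tensor product of the space of the crossed product with `L`, the left action being `x ⊗ 1` and
the right action that of the standard bimodule twisted by `e_s ⊗ ζ ↦ e_s ⊗ σ(s) ζ`
(`representationBimodule`); the commutator of `χ_d` with `e_1 ⊗ ξ` then has norm `‖σ(d) ξ - ξ‖`.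

*The block group.* The pair `H ⊆ H ⋊ Γ` has relative property (T) (`hasRelativeT_blockAut`). For a
basis vector of `ℤ^n` this follows from two elementary matrices. They act on the spectral measure
on `𝕋²` of two commuting unitaries as shears; an almost invariant measure that is almost
concentrated near `1` is almost concentrated at `1`, as each of two double cones that cover the
punctured plane is mapped by shears into two disjoint parts of itself (`measureReal_compl_one_le`,
`norm_pow_apply_sub_sq_le`). A basis vector `a` of `ℤ^k` is a commutator of a basis vector of
`ℤ^n` with an element of `M_{k,n}(ℤ)`, and the estimate for the powers of `a` follows from
`AlmostFixedOn.zpowers_of_shear`. Relative property (T) passes to `H × H`, and from a group to its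
equivariant quotients (`HasRelativeT.of_surjective`). So rigidity of the action on `𝕋^k`, or on
`𝕋^k × Ĥ`, would imply that of `Λ` on `𝕋^k`, which is why the two quotients are not rigid.

*Freeness and ergodicity.* By Bessel's inequality, a Fourier coefficient of a set that is repeated
infinitely often is zero (`CharacterSystem.eq_zero_of_setIntegral_charC_eq`). Applied to the
kernel of a character this gives freeness; applied to an invariant set, whose coefficients are
constant on the orbits in `D`, it gives ergodicity as soon as all nontrivial orbits are infinite.

*Amenable groups.* If `Λ` is amenable, the Hahn–Banach theorem in `ℓ¹(Λ)` gives finitely supported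
almost invariant probability vectors (`IsAmenableGroup.exists_almost_invariant`). Their square
roots, placed in the representations of `ℤ^k ⋊ Λ` induced from nontrivial characters that converge
to the trivial one, are almost invariant, but these representations have no nonzero
`ℤ^k`-invariant vectors (`not_hasRelativeT_of_isAmenableGroup`). The cyclic group generated by the
matrix `(2, 1; 1, 1)` is amenable and has infinite orbits on `ℤ² \ {0}`, so the construction
applies to it.
-/

open MeasureTheory Filter Topology
open scoped ENNReal InnerProductSpace

noncomputable section

set_option linter.unusedSectionVars false

/-! ### Almost invariant vectors and relative property (T) for semidirect products -/

section RelativeT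

open scoped Pointwise

/-- The vectors `ξₙ` are asymptotically fixed by the elements of `E`, uniformly on `E`. -/
def AlmostFixedOn {G L : Type*} [Group G] [NormedAddCommGroup L] [InnerProductSpace ℂ L]
    (σ : G →* (L ≃ₗᵢ[ℂ] L)) (ξ : ℕ → L) (E : Set G) : Prop :=
  ∀ ε > 0, ∀ᶠ n in atTop, ∀ g ∈ E, ‖σ g (ξ n) - ξ n‖ ≤ ε

/-- Relative property (T) of the pair `D ⊆ D ⋊ Γ`: almost invariant unit vectors of `D ⋊ Γ` are
almost invariant uniformly on `D`. -/
def HasRelativeT {D Γ : Type} [Group D] [Group Γ] (φ : Γ →* MulAut D) : Prop :=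
  ∀ (L : Type) [NormedAddCommGroup L] [InnerProductSpace ℂ L] [CompleteSpace L]
    (σ : D ⋊[φ] Γ →* (L ≃ₗᵢ[ℂ] L)) (ξ : ℕ → L), (∀ n, ‖ξ n‖ = 1) →
    (∀ s, AlmostFixedOn σ ξ {s}) → AlmostFixedOn σ ξ (Set.range SemidirectProduct.inl)

variable {G L : Type*} [Group G] [NormedAddCommGroup L] [InnerProductSpace ℂ L]
  {σ : G →* (L ≃ₗᵢ[ℂ] L)} {ξ : ℕ → L}

theorem norm_mul_apply_sub_le (σ : G →* (L ≃ₗᵢ[ℂ] L)) (g h : G) (ζ : L) :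
    ‖σ (g * h) ζ - ζ‖ ≤ ‖σ g ζ - ζ‖ + ‖σ h ζ - ζ‖ := by
  have : σ (g * h) ζ - ζ = (σ g ζ - ζ) + σ g (σ h ζ - ζ) := by
    rw [map_mul, map_sub]
    simp
  rw [this]
  exact (norm_add_le _ _).trans_eq (by rw [LinearIsometryEquiv.norm_map])

theorem norm_inv_apply_sub (σ : G →* (L ≃ₗᵢ[ℂ] L)) (g : G) (ζ : L) :
    ‖σ g⁻¹ ζ - ζ‖ = ‖σ g ζ - ζ‖ := by
  have : σ g (σ g⁻¹ ζ - ζ) = -(σ g ζ - ζ) := by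
    have h : σ g (σ g⁻¹ ζ) = ζ := by
      rw [map_inv]
      exact (σ g).apply_symm_apply ζ
    rw [map_sub, h, neg_sub]
  rw [← LinearIsometryEquiv.norm_map (σ g), this, norm_neg]

theorem almostFixedOn_singleton_iff {g : G} :
    AlmostFixedOn σ ξ {g} ↔ Tendsto (fun n => ‖σ g (ξ n) - ξ n‖) atTop (𝓝 0) := by
  simp only [AlmostFixedOn, Set.mem_singleton_iff, forall_eq]
  rw [Metric.nhds_basis_closedBall.tendsto_right_iff]
  simp

theorem AlmostFixedOn.mono {E F : Set G} (h : AlmostFixedOn σ ξ F) (hEF : E ⊆ F) :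
    AlmostFixedOn σ ξ E :=
  fun ε hε => (h ε hε).mono fun _ hn g hg => hn g (hEF hg)

theorem AlmostFixedOn.mul {E F : Set G} (hE : AlmostFixedOn σ ξ E) (hF : AlmostFixedOn σ ξ F) :
    AlmostFixedOn σ ξ (E * F) := by
  intro ε hε
  filter_upwards [hE (ε / 2) (half_pos hε), hF (ε / 2) (half_pos hε)] with n h1 h2 g hg
  obtain ⟨a, ha, b, hb, rfl⟩ := Set.mem_mul.1 hg
  linarith [norm_mul_apply_sub_le σ a b (ξ n), h1 a ha, h2 b hb]

theorem AlmostFixedOn.inv {E : Set G} (hE : AlmostFixedOn σ ξ E) : AlmostFixedOn σ ξ E⁻¹ := by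
  intro ε hε
  filter_upwards [hE ε hε] with n h g hg
  rw [← norm_inv_apply_sub]
  exact h _ hg

theorem AlmostFixedOn.comp {G' : Type*} [Group G'] {f : G' →* G} {E : Set G'}
    (h : AlmostFixedOn (σ.comp f) ξ E) : AlmostFixedOn σ ξ (f '' E) := by
  intro ε hε
  filter_upwards [h ε hε] with n hn g hg
  obtain ⟨a, ha, rfl⟩ := hg
  exact hn a ha

theorem AlmostFixedOn.comp_singleton {G' : Type*} [Group G'] {f : G' →* G} {g : G'}
    (h : AlmostFixedOn σ ξ {f g}) : AlmostFixedOn (σ.comp f) ξ {g} := by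
  rw [almostFixedOn_singleton_iff] at h ⊢
  exact h

/-- Uniform almost invariance on each of finitely many subsets of a commutative group passes to
the set of all products with one factor from each of them. -/
theorem AlmostFixedOn.finset_prod {D ι : Type*} [CommGroup D] {f : D →* G} (s : Finset ι)
    {E : ι → Set D} (h : ∀ i ∈ s, AlmostFixedOn σ ξ (f '' E i)) :
    AlmostFixedOn σ ξ (f '' {d | ∃ c : ι → D, (∀ i ∈ s, c i ∈ E i) ∧ d = ∏ i ∈ s, c i}) := by
  classical
  induction s using Finset.induction_on with
  | empty =>
    intro ε hε
    refine Eventually.of_forall fun n g hg => ?_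
    obtain ⟨d, ⟨c, -, rfl⟩, rfl⟩ := hg
    simpa using hε.le
  | insert a s ha ih =>
    have h1 := (h a (Finset.mem_insert_self _ _)).mul
      (ih fun i hi => h i (Finset.mem_insert_of_mem hi))
    refine h1.mono ?_
    rintro _ ⟨d, ⟨c, hc, rfl⟩, rfl⟩
    rw [Finset.prod_insert ha, map_mul]
    exact Set.mul_mem_mul ⟨_, hc a (Finset.mem_insert_self _ _), rfl⟩
      ⟨_, ⟨c, fun i hi => hc i (Finset.mem_insert_of_mem hi), rfl⟩, rfl⟩

/-- A vector that is moved by at most `ε` is within `ε` of an invariant vector: the element of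
least norm in the closed convex hull of its orbit. -/
theorem exists_fixed_of_norm_sub_le [CompleteSpace L] (σ : G →* (L ≃ₗᵢ[ℂ] L)) (ζ : L) {ε : ℝ}
    (h : ∀ g, ‖σ g ζ - ζ‖ ≤ ε) : ∃ η, (∀ g, σ g η = η) ∧ ‖ζ - η‖ ≤ ε := by
  let : InnerProductSpace ℝ L := InnerProductSpace.rclikeToReal ℂ L
  set C : Set L := closure (convexHull ℝ (Set.range fun g => σ g ζ)) with hC
  have hconv : Convex ℝ C := (convex_convexHull ℝ _).closure
  have hne : C.Nonempty := ⟨σ 1 ζ, subset_closure (subset_convexHull ℝ _ ⟨1, rfl⟩)⟩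
  obtain ⟨v, hv, hmin⟩ := exists_norm_eq_iInf_of_complete_convex hne
    (isClosed_closure.isComplete) hconv 0
  have hle : ∀ w ∈ C, ‖v‖ ≤ ‖w‖ := by
    intro w hw
    have : ‖(0 : L) - v‖ ≤ ‖(0 : L) - w‖ := by
      rw [hmin]
      exact ciInf_le ⟨0, by rintro _ ⟨w, rfl⟩; exact norm_nonneg _⟩ (⟨w, hw⟩ : C)
    simpa using this
  refine ⟨v, fun g => ?_, ?_⟩
  · have hgC : σ g v ∈ C := by
      have h1 : Set.MapsTo (σ g) (convexHull ℝ (Set.range fun g => σ g ζ))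
          (convexHull ℝ (Set.range fun g => σ g ζ)) := by
        intro x hx
        have h2 := Set.mem_image_of_mem
          (((σ g).toLinearEquiv.toLinearMap.restrictScalars ℝ : L →ₗ[ℝ] L)) hx
        rw [LinearMap.image_convexHull] at h2
        refine convexHull_mono ?_ h2
        rintro _ ⟨_, ⟨k, rfl⟩, rfl⟩
        exact ⟨g * k, by simp [map_mul]⟩
      exact h1.closure (σ g).continuous hv
    -- the midpoint of `v` and `σ g v` would have smaller norm if these were different
    have hmid : (1 / 2 : ℝ) • v + (1 / 2 : ℝ) • σ g v ∈ C :=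
      hconv hv hgC (by norm_num) (by norm_num) (by norm_num)
    have h3 := hle _ hmid
    rw [← smul_add, norm_smul] at h3
    have h4 := parallelogram_law_with_norm ℝ v (σ g v)
    rw [LinearIsometryEquiv.norm_map] at h4
    have h5 : ‖v - σ g v‖ * ‖v - σ g v‖ ≤ 0 := by
      norm_num at h3
      nlinarith [norm_nonneg v, norm_nonneg (v + σ g v)]
    have h6 : ‖v - σ g v‖ = 0 := by nlinarith [norm_nonneg (v - σ g v)]
    exact (sub_eq_zero.1 (norm_eq_zero.1 h6)).symm
  · have : C ⊆ Metric.closedBall ζ ε := by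
      refine closure_minimal (convexHull_min ?_ (convex_closedBall ζ ε)) Metric.isClosed_closedBall
      rintro _ ⟨g, rfl⟩
      simpa [dist_eq_norm] using h g
    simpa [dist_eq_norm, norm_sub_rev] using this hv

/-- Relative property (T) passes from `D' ⊆ D' ⋊ Γ'` to `D ⊆ D ⋊ Γ` along a homomorphism that maps
`D'` onto `D`; the homomorphism `Γ' → Γ` need not be surjective. -/
theorem HasRelativeT.of_surjective {D D' Γ Γ' : Type} [Group D] [Group D'] [Group Γ] [Group Γ']
    {φ : Γ →* MulAut D} {φ' : Γ' →* MulAut D'} (hT : HasRelativeT φ') (f : D' →* D) (g : Γ' →* Γ)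
    (hfg : ∀ c, f.comp (φ' c).toMonoidHom = (φ (g c)).toMonoidHom.comp f)
    (hf : Function.Surjective f) : HasRelativeT φ := by
  intro L _ _ _ σ ξ hξ hfix
  have h := hT L (σ.comp (SemidirectProduct.map f g hfg)) ξ hξ fun s => (hfix _).comp_singleton
  refine h.comp.mono ?_
  rintro _ ⟨d, rfl⟩
  obtain ⟨d', rfl⟩ := hf d
  exact ⟨_, ⟨d', rfl⟩, by simp⟩

/-- The diagonal action on a product of groups. -/
def MulAut.prodDiag {Γ D E : Type*} [Group Γ] [Group D] [Group E] (φ : Γ →* MulAut D)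
    (ψ : Γ →* MulAut E) : Γ →* MulAut (D × E) where
  toFun g := (φ g).prodCongr (ψ g)
  map_one' := by
    refine MulEquiv.ext fun x => ?_
    rw [map_one, map_one]
    rfl
  map_mul' g h := by
    refine MulEquiv.ext fun x => ?_
    rw [map_mul, map_mul]
    rfl

theorem MulAut.prodDiag_apply {Γ D E : Type*} [Group Γ] [Group D] [Group E] (φ : Γ →* MulAut D)
    (ψ : Γ →* MulAut E) (g : Γ) (x : D × E) : MulAut.prodDiag φ ψ g x = (φ g x.1, ψ g x.2) := rfl

/-- The group `D × E` is the product of two subgroups whose elements are almost fixed uniformly, by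
relative property (T) of `D ⋊ Γ` and of `E ⋊ Γ`. -/
theorem HasRelativeT.prodDiag {D E Γ : Type} [Group D] [Group E] [Group Γ]
    {φ : Γ →* MulAut D} {ψ : Γ →* MulAut E} (hφ : HasRelativeT φ) (hψ : HasRelativeT ψ) :
    HasRelativeT (MulAut.prodDiag φ ψ) := by
  intro L _ _ _ σ ξ hξ hfix
  have h1 := hφ L (σ.comp (SemidirectProduct.map (φ₂ := MulAut.prodDiag φ ψ) (MonoidHom.inl D E)
    (MonoidHom.id Γ) (fun c => MonoidHom.ext fun x => by simp [MulAut.prodDiag_apply]))) ξ hξ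
      fun s => (hfix _).comp_singleton
  have h2 := hψ L (σ.comp (SemidirectProduct.map (φ₂ := MulAut.prodDiag φ ψ) (MonoidHom.inr D E)
    (MonoidHom.id Γ) (fun c => MonoidHom.ext fun x => by simp [MulAut.prodDiag_apply]))) ξ hξ
      fun s => (hfix _).comp_singleton
  refine (h1.comp.mul h2.comp).mono ?_
  rintro _ ⟨⟨d, e⟩, rfl⟩
  refine Set.mem_mul.2 ⟨_, ⟨_, ⟨d, rfl⟩, rfl⟩, _, ⟨_, ⟨e, rfl⟩, rfl⟩, ?_⟩
  simp [← map_mul]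

end RelativeT

/-! ### Joint functional calculus and spectral measures for two commuting unitaries -/

section SpectralMeasure

open scoped CStarAlgebra

/-- The first coordinate function on the two-torus. -/
def circleFst : C(Circle × Circle, ℂ) := ⟨fun p => p.1, by fun_prop⟩

/-- The second coordinate function on the two-torus. -/
def circleSnd : C(Circle × Circle, ℂ) := ⟨fun p => p.2, by fun_prop⟩

theorem circleSubalgebra_dense :
    (StarAlgebra.adjoin ℂ {circleFst, circleSnd}).topologicalClosure = ⊤ := by
  refine ContinuousMap.starSubalgebra_topologicalClosure_eq_top_of_separatesPoints _ ?_
  intro x y hxy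
  by_cases h1 : x.1 = y.1
  · refine ⟨circleSnd, ⟨circleSnd, StarAlgebra.subset_adjoin ℂ _ (by simp), rfl⟩, fun h => hxy ?_⟩
    exact Prod.ext h1 (Circle.ext h)
  · exact ⟨circleFst, ⟨circleFst, StarAlgebra.subset_adjoin ℂ _ (by simp), rfl⟩,
      fun h => h1 (Circle.ext h)⟩

variable {A : Type*} [CStarAlgebra A]

theorem circle_starAlgHom_ext {Φ Ψ : C(Circle × Circle, ℂ) →⋆ₐ[ℂ] A}
    (h1 : Φ circleFst = Ψ circleFst) (h2 : Φ circleSnd = Ψ circleSnd) : Φ = Ψ := by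
  have hle : StarAlgebra.adjoin ℂ {circleFst, circleSnd} ≤ StarAlgHom.equalizer Φ Ψ := by
    refine StarAlgebra.adjoin_le ?_
    rintro x (rfl | rfl)
    exacts [h1, h2]
  have hcl : IsClosed (StarAlgHom.equalizer Φ Ψ : Set C(Circle × Circle, ℂ)) :=
    isClosed_eq (map_continuous Φ) (map_continuous Ψ)
  have := StarSubalgebra.topologicalClosure_minimal hle hcl
  rw [circleSubalgebra_dense] at this
  exact StarAlgHom.ext fun x => this (StarSubalgebra.mem_top)

/-- Continuous functional calculus for a pair of commuting unitaries: Gelfand duality for the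
commutative C⋆-algebra that they generate. -/
theorem exists_circle_starAlgHom {u v : A} (hu : u ∈ unitary A) (hv : v ∈ unitary A)
    (huv : Commute u v) :
    ∃ Ψ : C(Circle × Circle, ℂ) →⋆ₐ[ℂ] A, Ψ circleFst = u ∧ Ψ circleSnd = v := by
  have hstar : ∀ a b : A, b ∈ unitary A → a * b = b * a → a * star b = star b * a := by
    intro a b hb hab
    calc a * star b = (star b * b) * a * star b := by rw [Unitary.star_mul_self_of_mem hb, one_mul]
      _ = star b * (a * b) * star b := by rw [hab]; simp only [mul_assoc]
      _ = star b * a * (b * star b) := by simp only [mul_assoc]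
      _ = star b * a := by rw [Unitary.mul_star_self_of_mem hb, mul_one]
  have hc1 : ∀ a ∈ ({u, v} : Set A), ∀ b ∈ ({u, v} : Set A), a * b = b * a := by
    rintro a (rfl | rfl) b (rfl | rfl)
    exacts [rfl, huv, huv.symm, rfl]
  have hmem : ∀ b ∈ ({u, v} : Set A), b ∈ unitary A := by
    rintro b (rfl | rfl)
    exacts [hu, hv]
  have hcomm : ∀ x y : StarAlgebra.adjoin ℂ ({u, v} : Set A), x * y = y * x :=
    (StarAlgebra.isMulCommutative_adjoin ℂ hc1
      fun a ha b hb => hstar a b (hmem b hb) (hc1 a ha b hb)).is_comm.comm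
  let T := (StarAlgebra.adjoin ℂ ({u, v} : Set A)).topologicalClosure
  have hT : IsClosed (T : Set A) := StarSubalgebra.isClosed_topologicalClosure _
  let : CommCStarAlgebra T :=
    { StarSubalgebra.cstarAlgebra T with
      mul_comm := (StarSubalgebra.commRingTopologicalClosure _ hcomm).mul_comm }
  have hsub : ∀ b ∈ ({u, v} : Set A), b ∈ T := fun b hb =>
    StarSubalgebra.le_topologicalClosure _ (StarAlgebra.subset_adjoin ℂ _ hb)
  let u' : T := ⟨u, hsub u (by simp)⟩
  let v' : T := ⟨v, hsub v (by simp)⟩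
  have hcirc : ∀ (w : T), star w * w = 1 → ∀ φ : WeakDual.characterSpace ℂ T,
      φ w ∈ Submonoid.unitSphere ℂ := by
    intro w hw φ
    have h1 : star (φ w) * φ w = 1 := by
      rw [← map_star, ← map_mul, hw, map_one]
    have h2 : ‖φ w‖ * ‖φ w‖ = 1 := by
      rw [← CStarRing.norm_star_mul_self, h1, norm_one]
    refine mem_sphere_zero_iff_norm.2 ?_
    nlinarith [norm_nonneg (φ w)]
  have hu' : star u' * u' = 1 := Subtype.ext (Unitary.star_mul_self_of_mem hu)
  have hv' : star v' * v' = 1 := Subtype.ext (Unitary.star_mul_self_of_mem hv)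
  let q : C(WeakDual.characterSpace ℂ T, Circle × Circle) :=
    ⟨fun φ => (⟨φ u', hcirc u' hu' φ⟩, ⟨φ v', hcirc v' hv' φ⟩), by
      refine Continuous.prodMk ?_ ?_
      · exact Continuous.subtype_mk ((gelfandStarTransform T u').continuous) _
      · exact Continuous.subtype_mk ((gelfandStarTransform T v').continuous) _⟩
  let Ψ : C(Circle × Circle, ℂ) →⋆ₐ[ℂ] A :=
    (T.subtype.comp
      ((gelfandStarTransform T).symm : C(WeakDual.characterSpace ℂ T, ℂ) →⋆ₐ[ℂ] T)).comp
      (ContinuousMap.compStarAlgHom' ℂ ℂ q)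
  refine ⟨Ψ, ?_, ?_⟩
  · have : circleFst.comp q = gelfandStarTransform T u' := rfl
    change (((gelfandStarTransform T).symm (circleFst.comp q) : T) : A) = u
    rw [this, StarAlgEquiv.symm_apply_apply]
  · have : circleSnd.comp q = gelfandStarTransform T v' := rfl
    change (((gelfandStarTransform T).symm (circleSnd.comp q) : T) : A) = v
    rw [this, StarAlgEquiv.symm_apply_apply]

variable {L : Type*} [NormedAddCommGroup L] [InnerProductSpace ℂ L] [CompleteSpace L]
  {X : Type*} [TopologicalSpace X]

theorem norm_starAlgHom_apply_sq (Ψ : C(X, ℂ) →⋆ₐ[ℂ] (L →L[ℂ] L)) (g : C(X, ℂ)) (ζ : L) :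
    ‖Ψ g ζ‖ ^ 2 = (⟪ζ, Ψ (star g * g) ζ⟫_ℂ).re := by
  rw [map_mul, map_star, ContinuousLinearMap.star_eq_adjoint, mul_apply_eq_comp,
    ContinuousLinearMap.adjoint_inner_right, inner_self_eq_norm_sq_to_K]
  norm_cast

/-- The spectral measure of a vector for a representation `Ψ` of `C(X)`: the measure given by the
Riesz–Markov–Kakutani theorem for the functional `f ↦ ⟪ζ, Ψ f ζ⟫`, which is positive because
`f = |√f|²` for `f ≥ 0`. -/
theorem exists_spectralMeasure [T2Space X] [CompactSpace X] [MeasurableSpace X] [BorelSpace X]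
    (Ψ : C(X, ℂ) →⋆ₐ[ℂ] (L →L[ℂ] L)) (ζ : L) :
    ∃ μ : Measure X, IsFiniteMeasure μ ∧
      ∀ g : C(X, ℂ), ‖Ψ g ζ‖ ^ 2 = ∫ x, ‖g x‖ ^ 2 ∂μ := by
  let I : C(X, ℝ) → C(X, ℂ) := fun f => ⟨fun x => (f x : ℂ), by fun_prop⟩
  have hpos : ∀ f : C(X, ℝ), (∀ x, 0 ≤ f x) → 0 ≤ (⟪ζ, Ψ (I f) ζ⟫_ℂ).re := by
    intro f hf
    have : I f = star (I ⟨fun x => √(f x), by fun_prop⟩) * I ⟨fun x => √(f x), by fun_prop⟩ := by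
      ext x
      simp only [I, ContinuousMap.coe_mk, ContinuousMap.mul_apply, ContinuousMap.star_apply,
        RCLike.star_def, Complex.conj_ofReal]
      rw [← Complex.ofReal_mul, Real.mul_self_sqrt (hf x)]
    rw [this, ← norm_starAlgHom_apply_sq]
    positivity
  let Λ₀ : CompactlySupportedContinuousMap X ℝ →ₗ[ℝ] ℝ :=
    { toFun := fun f => (⟪ζ, Ψ (I f.toContinuousMap) ζ⟫_ℂ).re
      map_add' := by
        intro f g
        have : I (f + g).toContinuousMap = I f.toContinuousMap + I g.toContinuousMap := by
          ext x
          simp [I]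
        rw [this, map_add, add_apply, inner_add_right, Complex.add_re]
      map_smul' := by
        intro c f
        have : I (c • f).toContinuousMap = (c : ℂ) • I f.toContinuousMap := by
          ext x
          simp [I]
        rw [this, map_smul, smul_apply, inner_smul_right, Complex.re_ofReal_mul]
        rfl }
  let Λ : CompactlySupportedContinuousMap X ℝ →ₚ[ℝ] ℝ := PositiveLinearMap.mk₀ Λ₀
    fun f hf => hpos f.toContinuousMap hf
  refine ⟨RealRMK.rieszMeasure Λ, inferInstance, fun g => ?_⟩
  let f : CompactlySupportedContinuousMap X ℝ :=
    ⟨⟨fun x => ‖g x‖ ^ 2, by fun_prop⟩, HasCompactSupport.of_compactSpace _⟩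
  have h := RealRMK.integral_rieszMeasure Λ f
  have hf : I f.toContinuousMap = star g * g := by
    ext x
    simp only [I, f, ContinuousMap.coe_mk, ContinuousMap.mul_apply, ContinuousMap.star_apply,
        RCLike.star_def]
    rw [mul_comm, Complex.mul_conj, Complex.normSq_eq_norm_sq]
  rw [norm_starAlgHom_apply_sq, ← hf]
  exact h.symm

/-- An almost invariance estimate for integrals of continuous functions passes to measurable
sets, by regularity. -/
theorem measureReal_preimage_le {X : Type*} [MetricSpace X] [CompactSpace X] [MeasurableSpace X]
    [BorelSpace X] (μ : Measure X) [IsFiniteMeasure μ] (s : C(X, X)) {δ : ℝ}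
    (h : ∀ f : C(X, ℝ), (∀ x, 0 ≤ f x) → (∀ x, f x ≤ 1) →
      ∫ x, f (s x) ∂μ ≤ ∫ x, f x ∂μ + δ) {E : Set X} (hE : MeasurableSet E) :
    μ.real (s ⁻¹' E) ≤ μ.real E + δ := by
  have hclosed : ∀ F : Set X, IsClosed F → μ.real (s ⁻¹' F) ≤ μ.real F + δ := by
    intro F hF
    have hpos : ∀ n : ℕ, (0 : ℝ) < 1 / ((n : ℝ) + 1) := fun n => by positivity
    have hlim := tendsto_integral_thickenedIndicator_of_isClosed μ hF hpos
      tendsto_one_div_add_atTop_nhds_zero_nat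
    refine ge_of_tendsto (hlim.add_const δ) (Eventually.of_forall fun n => ?_)
    let f : C(X, ℝ) := ⟨fun x => (thickenedIndicator (hpos n) F x : ℝ), by fun_prop⟩
    refine le_trans ?_ (h f (fun x => NNReal.coe_nonneg _) fun x =>
      NNReal.coe_le_one.2 (thickenedIndicator_le_one (hpos n) F x))
    rw [← integral_indicator_one (hF.preimage s.continuous).measurableSet]
    have hf : Continuous fun x => f (s x) := by fun_prop
    refine integral_mono ?_ (hf.integrable_of_hasCompactSupport
      (HasCompactSupport.of_compactSpace _)) fun x => ?_
    · exact (integrable_const (1 : ℝ)).indicator (hF.preimage s.continuous).measurableSet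
    · by_cases hx : x ∈ s ⁻¹' F
      · have : f (s x) = 1 := NNReal.coe_eq_one.2 (thickenedIndicator_one (hpos n) F hx)
        simp only [Set.indicator_of_mem hx, this]
        exact le_rfl
      · simp only [Set.indicator_of_notMem hx]
        exact NNReal.coe_nonneg _
  refine le_of_forall_pos_le_add fun ε hε => ?_
  obtain ⟨K, hK, hKc, hμ⟩ := (s.continuous.measurable hE).exists_isCompact_lt_add
    (measure_ne_top μ _) (ENNReal.ofReal_pos.2 hε).ne'
  have h1 : μ.real (s ⁻¹' E) ≤ μ.real K + ε := by
    have := ENNReal.toReal_mono (by finiteness) hμ.le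
    rwa [ENNReal.toReal_add (measure_ne_top _ _) (by finiteness), ENNReal.toReal_ofReal hε.le]
      at this
  have h2 : μ.real K ≤ μ.real (s ⁻¹' (s '' K)) := measureReal_mono (Set.subset_preimage_image _ _)
  have h3 := hclosed _ (hKc.image s.continuous).isClosed
  have h4 : μ.real (s '' K) ≤ μ.real E := measureReal_mono (Set.image_subset_iff.2 hK)
  linarith

end SpectralMeasure

/-! ### Relative property (T) from a pair of elementary matrices -/

section Cones

variable {L : Type*} [NormedAddCommGroup L] [InnerProductSpace ℂ L] [CompleteSpace L]

/-- If a unitary that implements the homeomorphism `s` almost fixes a unit vector, then the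
spectral measure of this vector is almost invariant under `s`. -/
theorem spectralMeasure_preimage_le {X : Type*} [MetricSpace X] [CompactSpace X]
    [MeasurableSpace X] [BorelSpace X] {Ψ : C(X, ℂ) →⋆ₐ[ℂ] (L →L[ℂ] L)} {S : L ≃ₗᵢ[ℂ] L}
    {s : C(X, X)} (hS : ∀ g x, S (Ψ g x) = Ψ (g.comp s) (S x)) {ζ : L} (hζ : ‖ζ‖ = 1)
    {μ : Measure X} [IsFiniteMeasure μ] (hμ : ∀ g : C(X, ℂ), ‖Ψ g ζ‖ ^ 2 = ∫ x, ‖g x‖ ^ 2 ∂μ)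
    {δ : ℝ} (hδ : ‖S ζ - ζ‖ ≤ δ) {E : Set X} (hE : MeasurableSet E) :
    μ.real (s ⁻¹' E) ≤ μ.real E + 2 * δ := by
  refine measureReal_preimage_le μ s (fun f hf0 hf1 => ?_) hE
  let g : C(X, ℂ) := ⟨fun x => ((√(f x) : ℝ) : ℂ), by fun_prop⟩
  have hg : ∀ x, ‖g x‖ ^ 2 = f x := fun x => by
    simp [g, Complex.norm_real, Real.sq_sqrt (hf0 x)]
  have hgs : ∀ x, ‖g.comp s x‖ ^ 2 = f (s x) := fun x => hg (s x)
  have h1 := hμ g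
  have h2 := hμ (g.comp s)
  simp only [hg] at h1
  simp only [hgs] at h2
  rw [← h1, ← h2]
  have hle : ∀ k : C(X, ℂ), (∀ x, ‖k x‖ ≤ 1) → ∀ y, ‖Ψ k y‖ ≤ ‖y‖ := by
    intro k hk y
    refine ((Ψ k).le_opNorm y).trans ?_
    have := (NonUnitalStarAlgHom.norm_apply_le Ψ k).trans
      ((ContinuousMap.norm_le _ zero_le_one).2 hk)
    nlinarith [norm_nonneg y]
  have hg1 : ∀ x, ‖g x‖ ≤ 1 := fun x => by
    have := hg x
    have := hf1 x
    nlinarith [norm_nonneg (g x)]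
  have ha : ‖Ψ (g.comp s) ζ‖ ≤ 1 := (hle _ (fun x => hg1 (s x)) ζ).trans_eq hζ
  have hb : ‖Ψ g ζ‖ ≤ 1 := (hle _ hg1 ζ).trans_eq hζ
  have hab : ‖Ψ (g.comp s) ζ‖ ≤ ‖Ψ g ζ‖ + δ := by
    have h3 : Ψ (g.comp s) ζ = S (Ψ g ζ) - Ψ (g.comp s) (S ζ - ζ) := by
      rw [map_sub, hS]
      abel
    rw [h3]
    refine (norm_sub_le _ _).trans ?_
    rw [LinearIsometryEquiv.norm_map]
    linarith [hle (g.comp s) (fun x => hg1 (s x)) (S ζ - ζ)]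
  have hδ0 : 0 ≤ δ := (norm_nonneg _).trans hδ
  nlinarith [norm_nonneg (Ψ (g.comp s) ζ), norm_nonneg (Ψ g ζ)]

/-- Two almost measure preserving maps that send most of `P` into disjoint subsets of `P` force
`P` to be small. -/
theorem measureReal_inter_le_of_disjoint {X : Type*} [MeasurableSpace X] (μ : Measure X)
    [IsFiniteMeasure μ] {s t : X → X} {P P₁ P₂ B : Set X} {δ : ℝ}
    (hs : μ.real (s ⁻¹' P₁) ≤ μ.real P₁ + δ) (ht : μ.real (t ⁻¹' P₂) ≤ μ.real P₂ + δ)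
    (h₁ : P ∩ B ⊆ s ⁻¹' P₁) (h₂ : P ∩ B ⊆ t ⁻¹' P₂) (hP₁ : P₁ ⊆ P) (hP₂ : P₂ ⊆ P)
    (hd : Disjoint P₁ P₂) (hm : MeasurableSet P₂) :
    μ.real (P ∩ B) ≤ μ.real Bᶜ + 2 * δ := by
  have e1 := measureReal_mono (μ := μ) h₁
  have e2 := measureReal_mono (μ := μ) h₂
  have e3 : μ.real P₁ + μ.real P₂ ≤ μ.real P := by
    rw [← measureReal_union hd hm]
    exact measureReal_mono (Set.union_subset hP₁ hP₂)
  have e4 : μ.real P ≤ μ.real (P ∩ B) + μ.real Bᶜ := by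
    refine (measureReal_mono fun x hx => ?_).trans (measureReal_union_le _ _)
    by_cases h : x ∈ B
    exacts [Or.inl ⟨hx, h⟩, Or.inr h]
  linarith

/-- The shear `(z, w) ↦ (z, z w)` of the two-torus. -/
def circleShear₁ : (Circle × Circle) ≃ₜ (Circle × Circle) where
  toFun p := (p.1, p.1 * p.2)
  invFun p := (p.1, p.1⁻¹ * p.2)
  left_inv p := by simp
  right_inv p := by simp

/-- The shear `(z, w) ↦ (z w, w)` of the two-torus. -/
def circleShear₂ : (Circle × Circle) ≃ₜ (Circle × Circle) where
  toFun p := (p.1 * p.2, p.2)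
  invFun p := (p.1 * p.2⁻¹, p.2)
  left_inv p := by simp
  right_inv p := by simp

theorem Circle.arg_mul_of_re_pos {z w : Circle} (hz : 0 < (z : ℂ).re) (hw : 0 < (w : ℂ).re) :
    Complex.arg ((z * w : Circle) : ℂ) = Complex.arg z + Complex.arg w := by
  have h1 := abs_lt.1 (Complex.abs_arg_lt_pi_div_two_iff.2 (Or.inl hz))
  have h2 := abs_lt.1 (Complex.abs_arg_lt_pi_div_two_iff.2 (Or.inl hw))
  rw [Circle.coe_mul, Complex.arg_mul_eq_add_arg_iff z.coe_ne_zero w.coe_ne_zero]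
  constructor <;> linarith

theorem Circle.arg_inv_of_re_pos {z : Circle} (hz : 0 < (z : ℂ).re) :
    Complex.arg ((z⁻¹ : Circle) : ℂ) = -Complex.arg z := by
  have h1 := abs_lt.1 (Complex.abs_arg_lt_pi_div_two_iff.2 (Or.inl hz))
  rw [Circle.coe_inv, Complex.arg_inv, if_neg]
  intro h
  linarith [Real.pi_pos]

theorem Circle.inv_re_pos {z : Circle} (hz : 0 < (z : ℂ).re) : 0 < ((z⁻¹ : Circle) : ℂ).re := by
  rw [Circle.coe_inv_eq_conj, Complex.conj_re]
  exact hz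

/-- A finite measure on the two-torus that is almost invariant under the two shears and their
inverses is almost concentrated at the identity, up to the mass of the complement of a box on
which the shears are linear in the coordinates `(arg z, arg w)`. The punctured plane is the union
of two double cones, and each of them is mapped into two disjoint parts of itself by a pair of
shears. -/
theorem measureReal_compl_one_le [MeasurableSpace Circle] [BorelSpace Circle]
    (μ : Measure (Circle × Circle)) [IsFiniteMeasure μ] {δ : ℝ}
    (h₁ : ∀ E, MeasurableSet E → μ.real (circleShear₁ ⁻¹' E) ≤ μ.real E + δ)
    (h₂ : ∀ E, MeasurableSet E → μ.real (circleShear₂ ⁻¹' E) ≤ μ.real E + δ)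
    (h₁' : ∀ E, MeasurableSet E → μ.real (circleShear₁.symm ⁻¹' E) ≤ μ.real E + δ)
    (h₂' : ∀ E, MeasurableSet E → μ.real (circleShear₂.symm ⁻¹' E) ≤ μ.real E + δ) :
    μ.real {1}ᶜ ≤ 3 * μ.real {p | 0 < (p.1 : ℂ).re ∧ 0 < (p.2 : ℂ).re}ᶜ + 4 * δ := by
  set B : Set (Circle × Circle) := {p | 0 < (p.1 : ℂ).re ∧ 0 < (p.2 : ℂ).re} with hB
  let x : Circle × Circle → ℝ := fun p => Complex.arg p.1
  let y : Circle × Circle → ℝ := fun p => Complex.arg p.2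
  have hcoe : Measurable fun z : Circle => (z : ℂ) :=
    (by fun_prop : Continuous fun z : Circle => (z : ℂ)).measurable
  have hx : Measurable x := Complex.measurable_arg.comp (hcoe.comp measurable_fst)
  have hy : Measurable y := Complex.measurable_arg.comp (hcoe.comp measurable_snd)
  have c0 : Measurable fun _ : Circle × Circle => (0 : ℝ) := measurable_const
  -- the two double cones, with their boundary lines shared out so that they are disjoint
  let P : Set (Circle × Circle) := {p | (0 < x p ∧ 0 ≤ y p) ∨ (x p < 0 ∧ y p ≤ 0)}
  let N : Set (Circle × Circle) := {p | (x p ≤ 0 ∧ 0 < y p) ∨ (0 ≤ x p ∧ y p < 0)}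
  -- the shears map `P` into the parts `|x| ≤ |y|` and `|y| < |x|` of itself
  have hP := measureReal_inter_le_of_disjoint (P := P) (B := B) μ
    (P₁ := {p | (0 < x p ∧ x p ≤ y p) ∨ (x p < 0 ∧ y p ≤ x p)})
    (P₂ := {p | (0 ≤ y p ∧ y p < x p) ∨ (y p ≤ 0 ∧ x p < y p)})
    (h₁ _ (((measurableSet_lt c0 hx).inter (measurableSet_le hx hy)).union
      ((measurableSet_lt hx c0).inter (measurableSet_le hy hx))))
    (h₂ _ (((measurableSet_le c0 hy).inter (measurableSet_lt hy hx)).union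
      ((measurableSet_le hy c0).inter (measurableSet_lt hx hy))))
    (by
      rintro p ⟨hp, hb⟩
      have e := Circle.arg_mul_of_re_pos hb.1 hb.2
      change (0 < x p ∧ x p ≤ Complex.arg ((p.1 * p.2 : Circle) : ℂ)) ∨
        (x p < 0 ∧ Complex.arg ((p.1 * p.2 : Circle) : ℂ) ≤ x p)
      rw [e]
      change (0 < x p ∧ x p ≤ x p + y p) ∨ (x p < 0 ∧ x p + y p ≤ x p)
      rcases hp with ⟨h, h'⟩ | ⟨h, h'⟩
      · exact Or.inl ⟨h, by linarith⟩
      · exact Or.inr ⟨h, by linarith⟩)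
    (by
      rintro p ⟨hp, hb⟩
      have e := Circle.arg_mul_of_re_pos hb.1 hb.2
      change (0 ≤ y p ∧ y p < Complex.arg ((p.1 * p.2 : Circle) : ℂ)) ∨
        (y p ≤ 0 ∧ Complex.arg ((p.1 * p.2 : Circle) : ℂ) < y p)
      rw [e]
      change (0 ≤ y p ∧ y p < x p + y p) ∨ (y p ≤ 0 ∧ x p + y p < y p)
      rcases hp with ⟨h, h'⟩ | ⟨h, h'⟩
      · exact Or.inl ⟨h', by linarith⟩
      · exact Or.inr ⟨h', by linarith⟩)
    (by
      rintro p (⟨h, h'⟩ | ⟨h, h'⟩)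
      · exact Or.inl ⟨h, by linarith⟩
      · exact Or.inr ⟨h, by linarith⟩)
    (by
      rintro p (⟨h, h'⟩ | ⟨h, h'⟩)
      · exact Or.inl ⟨by linarith, h⟩
      · exact Or.inr ⟨by linarith, h⟩)
    (by
      rw [Set.disjoint_left]
      rintro p (⟨h, h'⟩ | ⟨h, h'⟩) (⟨k, k'⟩ | ⟨k, k'⟩) <;> linarith)
    (((measurableSet_le c0 hy).inter (measurableSet_lt hy hx)).union
      ((measurableSet_le hy c0).inter (measurableSet_lt hx hy)))
  -- on `N` the coordinates have opposite signs, and the inverse shears play this role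
  have hN := measureReal_inter_le_of_disjoint (P := N) (B := B) μ
    (P₁ := {p | (x p ≤ 0 ∧ -x p < y p) ∨ (0 ≤ x p ∧ y p < -x p)})
    (P₂ := {p | (0 < y p ∧ x p ≤ -y p) ∨ (y p < 0 ∧ -y p ≤ x p)})
    (h₁' _ (((measurableSet_le hx c0).inter (measurableSet_lt hx.neg hy)).union
      ((measurableSet_le c0 hx).inter (measurableSet_lt hy hx.neg))))
    (h₂' _ (((measurableSet_lt c0 hy).inter (measurableSet_le hx hy.neg)).union
      ((measurableSet_lt hy c0).inter (measurableSet_le hy.neg hx))))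
    (by
      rintro p ⟨hp, hb⟩
      have e := Circle.arg_mul_of_re_pos (Circle.inv_re_pos hb.1) hb.2
      change (x p ≤ 0 ∧ -x p < Complex.arg ((p.1⁻¹ * p.2 : Circle) : ℂ)) ∨
        (0 ≤ x p ∧ Complex.arg ((p.1⁻¹ * p.2 : Circle) : ℂ) < -x p)
      rw [e, Circle.arg_inv_of_re_pos hb.1]
      change (x p ≤ 0 ∧ -x p < -x p + y p) ∨ (0 ≤ x p ∧ -x p + y p < -x p)
      rcases hp with ⟨h, h'⟩ | ⟨h, h'⟩
      · exact Or.inl ⟨h, by linarith⟩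
      · exact Or.inr ⟨h, by linarith⟩)
    (by
      rintro p ⟨hp, hb⟩
      have e := Circle.arg_mul_of_re_pos hb.1 (Circle.inv_re_pos hb.2)
      change (0 < y p ∧ Complex.arg ((p.1 * p.2⁻¹ : Circle) : ℂ) ≤ -y p) ∨
        (y p < 0 ∧ -y p ≤ Complex.arg ((p.1 * p.2⁻¹ : Circle) : ℂ))
      rw [e, Circle.arg_inv_of_re_pos hb.2]
      change (0 < y p ∧ x p + -y p ≤ -y p) ∨ (y p < 0 ∧ -y p ≤ x p + -y p)
      rcases hp with ⟨h, h'⟩ | ⟨h, h'⟩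
      · exact Or.inl ⟨h', by linarith⟩
      · exact Or.inr ⟨h', by linarith⟩)
    (by
      rintro p (⟨h, h'⟩ | ⟨h, h'⟩)
      · exact Or.inl ⟨h, by linarith⟩
      · exact Or.inr ⟨h, by linarith⟩)
    (by
      rintro p (⟨h, h'⟩ | ⟨h, h'⟩)
      · exact Or.inl ⟨by linarith, h⟩
      · exact Or.inr ⟨by linarith, h⟩)
    (by
      rw [Set.disjoint_left]
      rintro p (⟨h, h'⟩ | ⟨h, h'⟩) (⟨k, k'⟩ | ⟨k, k'⟩) <;> linarith)
    (((measurableSet_lt c0 hy).inter (measurableSet_le hx hy.neg)).union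
      ((measurableSet_lt hy c0).inter (measurableSet_le hy.neg hx)))
  have hcover : ({1}ᶜ : Set (Circle × Circle)) ⊆ ((P ∩ B) ∪ (N ∩ B)) ∪ Bᶜ := by
    intro p hp
    by_cases hb : p ∈ B
    · refine Or.inl ?_
      by_contra hcon
      refine hp ?_
      have hx0 : x p = 0 ∧ y p = 0 := by
        rw [Set.mem_union, not_or] at hcon
        have c1 : p ∉ P := fun h => hcon.1 ⟨h, hb⟩
        have c2 : p ∉ N := fun h => hcon.2 ⟨h, hb⟩
        simp only [P, N, Set.mem_ofPred_eq, not_or, not_and, not_le, not_lt] at c1 c2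
        rcases lt_trichotomy (x p) 0 with h | h | h
        · exact absurd (c1.2 h) (by linarith [c2.1 h.le])
        · exact ⟨h, le_antisymm (c2.1 h.le) (c2.2 h.ge)⟩
        · exact absurd (c1.1 h) (by linarith [c2.2 h.le])
      refine Prod.ext (Circle.injective_arg ?_) (Circle.injective_arg ?_)
      · change x p = Complex.arg ((1 : Circle) : ℂ)
        rw [hx0.1, Circle.coe_one, Complex.arg_one]
      · change y p = Complex.arg ((1 : Circle) : ℂ)
        rw [hx0.2, Circle.coe_one, Complex.arg_one]
    · exact Or.inr hb
  have := (measureReal_mono (μ := μ) hcover).trans ((measureReal_union_le _ _).trans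
    (add_le_add_left (measureReal_union_le _ _) _))
  linarith

theorem linearIsometryEquiv_mem_unitary (u : L ≃ₗᵢ[ℂ] L) :
    (u : L →L[ℂ] L) ∈ unitary (L →L[ℂ] L) := by
  rw [← Unitary.coe_symm_linearIsometryEquiv_apply]
  exact Subtype.property _

/-- Quantitative relative property (T) for a pair of commuting unitaries that is normalized by two
unitaries acting on it as the elementary matrices of `SL(2, ℤ)`: unit vectors that are almost
fixed by the four unitaries are almost fixed by all the powers of the first one. -/
theorem norm_pow_apply_sub_sq_le {u v S T : L ≃ₗᵢ[ℂ] L} (huv : u * v = v * u) (hSu : S * u = u * S)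
    (hSv : S * v = u * v * S) (hTu : T * u = u * v * T) (hTv : T * v = v * T) {ζ : L}
    (hζ : ‖ζ‖ = 1) {δ : ℝ} (h1 : ‖u ζ - ζ‖ ≤ δ) (h2 : ‖v ζ - ζ‖ ≤ δ) (h3 : ‖S ζ - ζ‖ ≤ δ)
    (h4 : ‖T ζ - ζ‖ ≤ δ) (m : ℕ) : ‖(u ^ m) ζ - ζ‖ ^ 2 ≤ 4 * (3 * δ ^ 2 + 8 * δ) := by
  let : MeasurableSpace Circle := borel Circle
  have : BorelSpace Circle := ⟨rfl⟩
  obtain ⟨Ψ, hΨ1, hΨ2⟩ := exists_circle_starAlgHom (linearIsometryEquiv_mem_unitary u)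
    (linearIsometryEquiv_mem_unitary v)
    (ContinuousLinearMap.ext fun x => DFunLike.congr_fun huv x)
  obtain ⟨μ, hfin, hμ⟩ := exists_spectralMeasure Ψ ζ
  -- an identity for the two generators extends to all continuous functions on the torus
  have intertwine : ∀ (R : L ≃ₗᵢ[ℂ] L) (s : (Circle × Circle) ≃ₜ (Circle × Circle)),
      (∀ x, R (u x) = Ψ (circleFst.comp s) (R x)) →
      (∀ x, R (v x) = Ψ (circleSnd.comp s) (R x)) →
      ∀ g x, R (Ψ g x) = Ψ (g.comp s) (R x) := by
    intro R s hu hv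
    have key : (R.conjStarAlgEquiv : (L →L[ℂ] L) →⋆ₐ[ℂ] (L →L[ℂ] L)).comp Ψ =
        Ψ.comp (ContinuousMap.compStarAlgHom' ℂ ℂ (s : C(Circle × Circle, Circle × Circle))) := by
      refine circle_starAlgHom_ext ?_ ?_
      · ext x
        change R (Ψ circleFst (R.symm x)) = Ψ (circleFst.comp s) x
        rw [hΨ1]
        change R (u (R.symm x)) = _
        rw [hu, R.apply_symm_apply]
      · ext x
        change R (Ψ circleSnd (R.symm x)) = Ψ (circleSnd.comp s) x
        rw [hΨ2]
        change R (v (R.symm x)) = _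
        rw [hv, R.apply_symm_apply]
    intro g x
    have := DFunLike.congr_fun (DFunLike.congr_fun key g) (R x)
    change R (Ψ g (R.symm (R x))) = Ψ (g.comp s) (R x) at this
    rwa [R.symm_apply_apply] at this
  have intertwine' : ∀ (R : L ≃ₗᵢ[ℂ] L) (s : (Circle × Circle) ≃ₜ (Circle × Circle)),
      (∀ g x, R (Ψ g x) = Ψ (g.comp s) (R x)) →
      ∀ g x, R⁻¹ (Ψ g x) = Ψ (g.comp s.symm) (R⁻¹ x) := by
    intro R s h g x
    apply R.injective
    rw [h]
    have e1 : (g.comp (s.symm : C(_, _))).comp (s : C(Circle × Circle, Circle × Circle)) = g := by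
      ext p
      change g (s.symm (s p)) = g p
      rw [s.symm_apply_apply]
    have e2 : ∀ y, R (R⁻¹ y) = y := R.apply_symm_apply
    rw [e1, e2, e2]
  have hmul : Ψ (circleFst * circleSnd) = (u : L →L[ℂ] L) * (v : L →L[ℂ] L) := by
    rw [map_mul, hΨ1, hΨ2]
  have hSi := intertwine S circleShear₁
    (fun x => by
      change (S * u) x = Ψ circleFst (S x)
      rw [hSu, hΨ1]
      rfl)
    (fun x => by
      change (S * v) x = Ψ (circleFst * circleSnd) (S x)
      rw [hSv, hmul]
      rfl)
  have hTi := intertwine T circleShear₂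
    (fun x => by
      change (T * u) x = Ψ (circleFst * circleSnd) (T x)
      rw [hTu, hmul]
      rfl)
    (fun x => by
      change (T * v) x = Ψ circleSnd (T x)
      rw [hTv, hΨ2]
      rfl)
  have hinv : ∀ R : L ≃ₗᵢ[ℂ] L, ‖R ζ - ζ‖ ≤ δ → ‖R⁻¹ ζ - ζ‖ ≤ δ := fun R hR =>
    (norm_inv_apply_sub (MonoidHom.id (L ≃ₗᵢ[ℂ] L)) R ζ).trans_le hR
  have hcone := measureReal_compl_one_le μ
    (fun E hE => spectralMeasure_preimage_le hSi hζ hμ h3 hE)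
    (fun E hE => spectralMeasure_preimage_le hTi hζ hμ h4 hE)
    (fun E hE => spectralMeasure_preimage_le (intertwine' _ _ hSi) hζ hμ (hinv S h3) hE)
    (fun E hE => spectralMeasure_preimage_le (intertwine' _ _ hTi) hζ hμ (hinv T h4) hE)
  have hint : ∀ g : C(Circle × Circle, ℂ), Integrable (fun x => ‖g x‖ ^ 2) μ := fun g =>
    (by fun_prop : Continuous fun x => ‖g x‖ ^ 2).integrable_of_hasCompactSupport
      (HasCompactSupport.of_compactSpace _)
  -- Chebyshev: `|z - 1| ^ 2 ≥ 2` if `z` has nonpositive real part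
  have hcheb : ∀ g : C(Circle × Circle, ℂ), (∀ p, ‖g p‖ = 1) → ‖Ψ g ζ - ζ‖ ≤ δ →
      2 * μ.real {p | (g p).re ≤ 0} ≤ δ ^ 2 := by
    intro g hg hgδ
    have e1 : ‖Ψ g ζ - ζ‖ ^ 2 = ∫ x, ‖g x - 1‖ ^ 2 ∂μ := by
      have := hμ (g - 1)
      rw [map_sub, map_one] at this
      exact this
    have hm : MeasurableSet {p | (g p).re ≤ 0} :=
      (isClosed_le (by fun_prop) continuous_const).measurableSet
    have e2 : 2 * μ.real {p | (g p).re ≤ 0} ≤ ∫ x, ‖g x - 1‖ ^ 2 ∂μ := by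
      rw [mul_comm, ← smul_eq_mul, ← integral_indicator_const (2 : ℝ) hm]
      refine integral_mono ((integrable_const (2 : ℝ)).indicator hm) (hint (g - 1)) fun p => ?_
      by_cases hp : (g p).re ≤ 0
      · have e3 : ‖g p - 1‖ ^ 2 = 2 - 2 * (g p).re := by
          have e4 : ‖g p‖ ^ 2 = 1 := by rw [hg, one_pow]
          rw [← Complex.normSq_eq_norm_sq, Complex.normSq_apply] at e4 ⊢
          simp only [Complex.sub_re, Complex.sub_im, Complex.one_re, Complex.one_im]
          linarith
        simp only [Set.indicator_of_mem (show p ∈ {p | (g p).re ≤ 0} from hp), e3]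
        linarith
      · simp only [Set.indicator_of_notMem (show p ∉ {p | (g p).re ≤ 0} from hp)]
        positivity
    rw [← e1] at e2
    exact e2.trans (pow_le_pow_left₀ (norm_nonneg _) hgδ 2)
  have hB : μ.real {p : Circle × Circle | 0 < (p.1 : ℂ).re ∧ 0 < (p.2 : ℂ).re}ᶜ ≤ δ ^ 2 := by
    have e1 := hcheb circleFst (fun p => Circle.norm_coe p.1) (by rw [hΨ1]; exact h1)
    have e2 := hcheb circleSnd (fun p => Circle.norm_coe p.2) (by rw [hΨ2]; exact h2)
    have e3 : {p : Circle × Circle | 0 < (p.1 : ℂ).re ∧ 0 < (p.2 : ℂ).re}ᶜ ⊆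
        {p | (circleFst p).re ≤ 0} ∪ {p | (circleSnd p).re ≤ 0} := by
      intro p hp
      rw [Set.mem_compl_iff, Set.mem_ofPred_eq, not_and_or, not_lt, not_lt] at hp
      exact hp
    have := (measureReal_mono (μ := μ) e3).trans (measureReal_union_le _ _)
    linarith
  -- `|z ^ m - 1| ^ 2 ≤ 4` off the identity, whatever the exponent
  have hfinal : ‖(u ^ m) ζ - ζ‖ ^ 2 ≤ 4 * μ.real {1}ᶜ := by
    have e1 : ‖(u ^ m) ζ - ζ‖ ^ 2 = ∫ x, ‖(circleFst ^ m - 1) x‖ ^ 2 ∂μ := by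
      rw [← hμ, map_sub, map_one, map_pow, hΨ1]
      have : ∀ j : ℕ, ((u : L →L[ℂ] L) ^ j) = ((u ^ j : L ≃ₗᵢ[ℂ] L) : L →L[ℂ] L) := by
        intro j
        induction j with
        | zero => rfl
        | succ j ih => rw [pow_succ, pow_succ, ih]; rfl
      rw [this]
      rfl
    rw [e1, mul_comm, ← smul_eq_mul,
      ← integral_indicator_const (4 : ℝ) (measurableSet_singleton 1).compl]
    refine integral_mono (hint _) ((integrable_const (4 : ℝ)).indicator
      (measurableSet_singleton 1).compl) fun p => ?_
    by_cases hp : p = 1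
    · subst hp
      simp [circleFst]
    · simp only [Set.indicator_of_mem (show p ∈ ({1}ᶜ : Set (Circle × Circle)) from hp)]
      have e2 : ‖(circleFst ^ m - 1) p‖ ≤ 2 := by
        refine (norm_sub_le _ _).trans ?_
        simp [circleFst, Circle.norm_coe]
        norm_num
      nlinarith [norm_nonneg ((circleFst ^ m - 1) p)]
  linarith

end Cones

/-! ### Relative property (T) for the block group -/

section BlockRelativeT

open scoped Pointwise

variable {D Γ L : Type*} [CommGroup D] [Group Γ] {φ : Γ →* MulAut D} [NormedAddCommGroup L]
  [InnerProductSpace ℂ L] {σ : D ⋊[φ] Γ →* (L ≃ₗᵢ[ℂ] L)} {ξ : ℕ → L}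

theorem inr_mul_inl (φ : Γ →* MulAut D) (g : Γ) (d : D) :
    (SemidirectProduct.inr g * SemidirectProduct.inl d : D ⋊[φ] Γ) =
      SemidirectProduct.inl (φ g d) * SemidirectProduct.inr g := by
  rw [SemidirectProduct.inl_aut, map_inv, inv_mul_cancel_right]

/-- If two elements of `Γ` act on `d, e` as the elementary matrices of `SL(2, ℤ)`, then almost
invariant unit vectors are almost invariant uniformly on the powers of `d`. -/
theorem almostFixedOn_zpowers_of_shears [CompleteSpace L] (hξ : ∀ n, ‖ξ n‖ = 1)
    (hfix : ∀ s, AlmostFixedOn σ ξ {s}) {d e : D} {g h : Γ} (hgd : φ g d = d)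
    (hge : φ g e = d * e) (hhd : φ h d = d * e) (hhe : φ h e = e) :
    AlmostFixedOn σ ξ (SemidirectProduct.inl '' (Subgroup.zpowers d : Set D)) := by
  intro ε hε
  -- for `δ ≤ 1` the bound `4 * (3 * δ ^ 2 + 8 * δ)` is at most `44 * δ`
  set δ : ℝ := min 1 (ε ^ 2 / 44) with hδ
  have hδ0 : 0 < δ := by positivity
  have hδ1 : δ ≤ 1 := min_le_left _ _
  have hδ2 : δ ≤ ε ^ 2 / 44 := min_le_right _ _
  filter_upwards [hfix (SemidirectProduct.inl d) δ hδ0, hfix (SemidirectProduct.inl e) δ hδ0,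
    hfix (SemidirectProduct.inr g) δ hδ0, hfix (SemidirectProduct.inr h) δ hδ0]
    with n h1 h2 h3 h4
  have key : ∀ m : ℕ, ‖σ (SemidirectProduct.inl d ^ m) (ξ n) - ξ n‖ ≤ ε := by
    intro m
    have := norm_pow_apply_sub_sq_le (u := σ (SemidirectProduct.inl d))
      (v := σ (SemidirectProduct.inl e)) (S := σ (SemidirectProduct.inr g))
      (T := σ (SemidirectProduct.inr h))
      (by rw [← map_mul, ← map_mul, ← map_mul, ← map_mul, mul_comm])
      (by rw [← map_mul, ← map_mul, inr_mul_inl, hgd])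
      (by rw [← map_mul, ← map_mul, ← map_mul, inr_mul_inl, hge,
        map_mul SemidirectProduct.inl])
      (by rw [← map_mul, ← map_mul, ← map_mul, inr_mul_inl, hhd,
        map_mul SemidirectProduct.inl])
      (by rw [← map_mul, ← map_mul, inr_mul_inl, hhe])
      (hξ n) (h1 _ rfl) (h2 _ rfl) (h3 _ rfl) (h4 _ rfl) m
    rw [map_pow]
    refine abs_le_of_sq_le_sq' ?_ hε.le |>.2
    nlinarith
  rintro _ ⟨_, ⟨m, rfl⟩, rfl⟩
  obtain ⟨j, rfl | rfl⟩ := m.eq_nat_or_neg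
  · simpa using key j
  · have := key j
    rw [← norm_inv_apply_sub] at this
    simpa using this

/-- If an element of `Γ` maps `d` to `d * a`, then uniform almost invariance on the powers of `d`
passes to the powers of `a`, which are products of powers of `d` and of conjugates of these. -/
theorem AlmostFixedOn.zpowers_of_shear (hfix : ∀ s, AlmostFixedOn σ ξ {s}) {d a : D} {g : Γ}
    (hg : φ g d = d * a)
    (hd : AlmostFixedOn σ ξ (SemidirectProduct.inl '' (Subgroup.zpowers d : Set D))) :
    AlmostFixedOn σ ξ (SemidirectProduct.inl '' (Subgroup.zpowers a : Set D)) := by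
  refine ((((hfix (SemidirectProduct.inr g)).mul hd).mul
    (hfix (SemidirectProduct.inr g⁻¹))).mul hd.inv).mono ?_
  rintro _ ⟨_, ⟨m, rfl⟩, rfl⟩
  have : (SemidirectProduct.inl (a ^ m) : D ⋊[φ] Γ) =
      SemidirectProduct.inr g * SemidirectProduct.inl (d ^ m) * SemidirectProduct.inr g⁻¹ *
        (SemidirectProduct.inl (d ^ m))⁻¹ := by
    rw [← SemidirectProduct.inl_aut, map_zpow (φ g), hg, mul_zpow, ← map_inv, ← map_mul]
    congr 1
    rw [mul_comm (d ^ m), mul_inv_cancel_right]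
  simp only [this]
  exact Set.mul_mem_mul (Set.mul_mem_mul (Set.mul_mem_mul rfl ⟨_, ⟨m, rfl⟩, rfl⟩) rfl)
    (Set.inv_mem_inv.2 ⟨_, ⟨m, rfl⟩, rfl⟩)

variable (ι : Type) [Fintype ι] [DecidableEq ι]

/-- The lattice `ℤ^ι`, written multiplicatively. -/
abbrev MulLattice : Type := Multiplicative (ι → ℤ)

/-- The linear action of `SL(ι, ℤ)` on `ℤ^ι`. -/
def latticeAut : SLZ ι →* MulAut (MulLattice ι) where
  toFun g :=
    { toFun := fun d => Multiplicative.ofAdd (g.1.mulVec d.toAdd)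
      invFun := fun d => Multiplicative.ofAdd ((g⁻¹).1.mulVec d.toAdd)
      left_inv := fun d => by
        have : (g⁻¹).1 * g.1 = 1 := congrArg Subtype.val (inv_mul_cancel g)
        change Multiplicative.ofAdd ((g⁻¹ : SLZ ι).1.mulVec (g.1.mulVec d.toAdd)) = d
        rw [Matrix.mulVec_mulVec, this, Matrix.one_mulVec, ofAdd_toAdd]
      right_inv := fun d => by
        have : g.1 * (g⁻¹).1 = 1 := congrArg Subtype.val (mul_inv_cancel g)
        change Multiplicative.ofAdd (g.1.mulVec ((g⁻¹ : SLZ ι).1.mulVec d.toAdd)) = d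
        rw [Matrix.mulVec_mulVec, this, Matrix.one_mulVec, ofAdd_toAdd]
      map_mul' := fun d e => by
        rw [toAdd_mul, Matrix.mulVec_add, ofAdd_add] }
  map_one' := MulEquiv.ext fun d => by
    change Multiplicative.ofAdd ((1 : Matrix ι ι ℤ).mulVec d.toAdd) = d
    rw [Matrix.one_mulVec, ofAdd_toAdd]
  map_mul' g h := MulEquiv.ext fun d => by
    change Multiplicative.ofAdd ((g.1 * h.1).mulVec d.toAdd) =
      Multiplicative.ofAdd (g.1.mulVec (h.1.mulVec d.toAdd))
    rw [Matrix.mulVec_mulVec]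

variable {ι}

theorem latticeAut_apply (g : SLZ ι) (d : MulLattice ι) :
    latticeAut ι g d = Multiplicative.ofAdd (g.1.mulVec d.toAdd) := rfl

/-- The standard basis of the lattice. -/
def latticeBasis (i : ι) : MulLattice ι := Multiplicative.ofAdd (Pi.single i 1)

theorem latticeAut_latticeBasis (g : SLZ ι) (j : ι) :
    latticeAut ι g (latticeBasis j) = Multiplicative.ofAdd fun i => g.1 i j := by
  rw [latticeAut_apply, latticeBasis, toAdd_ofAdd, Matrix.mulVec_single_one]
  rfl

theorem lattice_eq_prod (d : MulLattice ι) : d = ∏ i, latticeBasis i ^ d.toAdd i := by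
  apply Multiplicative.toAdd.injective
  rw [toAdd_prod]
  funext j
  simp [latticeBasis, Finset.sum_apply, Pi.single_apply]

variable {k : ℕ} (n : ℕ) (Λ : Subgroup (SLZ (Fin k)))

/-- The block matrix `(1, B; 0, D)`. -/
def blockUnipotent (B : Matrix (Fin k) (Fin n) ℤ) (D : SLZ (Fin n)) : blockGroup n Λ :=
  ⟨⟨Matrix.fromBlocks 1 B 0 D.1, by
    rw [Matrix.det_fromBlocks_zero₂₁, Matrix.det_one, D.2, one_mul]⟩, 1, Λ.one_mem, B, D, rfl⟩

/-- The action of the block group on the lattice `ℤ^k ⊕ ℤ^n`. -/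
abbrev blockAut : blockGroup n Λ →* MulAut (MulLattice (Fin k ⊕ Fin n)) :=
  (latticeAut (Fin k ⊕ Fin n)).comp (blockGroup n Λ).subtype

theorem blockAut_blockUnipotent_inr (B : Matrix (Fin k) (Fin n) ℤ) (D : SLZ (Fin n)) (j : Fin n) :
    blockAut n Λ (blockUnipotent n Λ B D) (latticeBasis (Sum.inr j)) =
      Multiplicative.ofAdd (Sum.elim (fun a => B a j) fun i => D.1 i j) := by
  refine (latticeAut_latticeBasis _ _).trans (congrArg _ ?_)
  funext i
  cases i <;> rfl

/-- The elementary matrix `1 + E_{i j}`. -/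
def elementarySLZ {i j : Fin n} (hij : i ≠ j) : SLZ (Fin n) :=
  ⟨Matrix.transvection i j 1, Matrix.det_transvection_of_ne i j hij 1⟩

theorem blockAut_elementary_self {i j : Fin n} (hij : i ≠ j) :
    blockAut n Λ (blockUnipotent n Λ 0 (elementarySLZ n hij)) (latticeBasis (Sum.inr i)) =
      latticeBasis (Sum.inr i) := by
  rw [blockAut_blockUnipotent_inr]
  refine congrArg _ (funext fun l => ?_)
  cases l with
  | inl a => simp
  | inr l => simp [elementarySLZ, Matrix.transvection, Matrix.single, Matrix.one_apply,
      Pi.single_apply, hij.symm]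

theorem blockAut_elementary {i j : Fin n} (hij : i ≠ j) :
    blockAut n Λ (blockUnipotent n Λ 0 (elementarySLZ n hij)) (latticeBasis (Sum.inr j)) =
      latticeBasis (Sum.inr i) * latticeBasis (Sum.inr j) := by
  rw [blockAut_blockUnipotent_inr, latticeBasis, latticeBasis, ← ofAdd_add]
  refine congrArg _ (funext fun l => ?_)
  cases l with
  | inl a => simp
  | inr l =>
    simp [elementarySLZ, Matrix.transvection, Matrix.single, Matrix.one_apply, Pi.single_apply,
      eq_comm, add_comm]

theorem blockAut_single (a : Fin k) (j : Fin n) :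
    blockAut n Λ (blockUnipotent n Λ (Matrix.single a j 1) 1) (latticeBasis (Sum.inr j)) =
      latticeBasis (Sum.inr j) * latticeBasis (Sum.inl a) := by
  rw [blockAut_blockUnipotent_inr, latticeBasis, latticeBasis, ← ofAdd_add]
  refine congrArg _ (funext fun l => ?_)
  cases l with
  | inl b => simp [Matrix.single, Pi.single_apply, eq_comm]
  | inr l => simp [Matrix.one_apply, Pi.single_apply]

/-- The pair `ℤ^k ⊕ ℤ^n ⊆ (ℤ^k ⊕ ℤ^n) ⋊ Γ` has relative property (T). Only the unipotent
elements of `Γ` are used: elementary matrices of `SL(n, ℤ)` for the basis vectors of `ℤ^n`, and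
then elements of `M_{k,n}(ℤ)` for those of `ℤ^k`. -/
theorem hasRelativeT_blockAut (hn : 2 ≤ n) : HasRelativeT (blockAut n Λ) := by
  intro L _ _ _ σ ξ hξ hfix
  have hinr : ∀ j : Fin n, AlmostFixedOn σ ξ (SemidirectProduct.inl ''
      (Subgroup.zpowers (latticeBasis (Sum.inr j : Fin k ⊕ Fin n)) : Set _)) := by
    intro j
    obtain ⟨i, hij⟩ : ∃ i : Fin n, j ≠ i := by
      have : Nontrivial (Fin n) := Fin.nontrivial_iff_two_le.2 hn
      exact (exists_ne j).imp fun i h => h.symm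
    exact almostFixedOn_zpowers_of_shears hξ hfix (blockAut_elementary_self n Λ hij)
      (blockAut_elementary n Λ hij)
      ((blockAut_elementary n Λ hij.symm).trans (mul_comm _ _))
      (blockAut_elementary_self n Λ hij.symm)
  have hall : ∀ i : Fin k ⊕ Fin n, AlmostFixedOn σ ξ (SemidirectProduct.inl ''
      (Subgroup.zpowers (latticeBasis i) : Set _)) := by
    rintro (a | j)
    · exact (hinr ⟨0, by omega⟩).zpowers_of_shear hfix (blockAut_single n Λ a ⟨0, by omega⟩)
    · exact hinr j
  refine (AlmostFixedOn.finset_prod Finset.univ fun i _ => hall i).mono ?_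
  rintro _ ⟨d, rfl⟩
  exact ⟨d, ⟨fun i => latticeBasis i ^ d.toAdd i, fun i _ => ⟨_, rfl⟩, lattice_eq_prod d⟩, rfl⟩

end BlockRelativeT

/-! ### Actions on compact groups by automorphisms, through their characters -/

section Characters

/-- A family of characters that exhibits the action of `Γ` on the probability space `(X, μ)` as
dual to the action `φ` of `Γ` on the discrete group `D`. Vanishing of the integrals makes the
characters orthonormal in `L²(X, μ)`. A group structure on `X` is not required. -/
structure CharacterSystem {Γ D : Type} [Group Γ] [CommGroup D] (φ : Γ →* MulAut D) {X : Type}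
    [TopologicalSpace X] [MeasurableSpace X] [MulAction Γ X] (μ : Measure X) where
  char : D →* C(X, Circle)
  integral_char : ∀ d, d ≠ 1 → ∫ x, (char d x : ℂ) ∂μ = 0
  separates : ∀ x y, (∀ d, char d x = char d y) → x = y
  char_smul : ∀ g d x, char (φ g d) x = char d (g⁻¹ • x)

/-- An integrable function whose integrals against all continuous functions vanish is zero. -/
theorem ae_eq_zero_of_forall_integral_continuous_mul {X : Type*} [MetricSpace X] [CompactSpace X]
    [MeasurableSpace X] [BorelSpace X] {μ : Measure X} {w : X → ℂ} (hw : Integrable w μ)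
    (h : ∀ f : C(X, ℂ), ∫ x, f x * w x ∂μ = 0) : w =ᵐ[μ] 0 := by
  have hclosed : ∀ F : Set X, IsClosed F → ∫ x in F, w x ∂μ = 0 := by
    intro F hF
    have hpos : ∀ n : ℕ, (0 : ℝ) < 1 / ((n : ℝ) + 1) := fun n => by positivity
    let f : ℕ → C(X, ℂ) := fun n =>
      ⟨fun x => ((thickenedIndicator (hpos n) F x : ℝ) : ℂ), by fun_prop⟩
    have hlim : Tendsto (fun n => ∫ x, f n x * w x ∂μ) atTop
        (𝓝 (∫ x, F.indicator (fun x => w x) x ∂μ)) := by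
      refine tendsto_integral_of_dominated_convergence (fun x => ‖w x‖)
        (fun n => (f n).continuous.aestronglyMeasurable.mul hw.aestronglyMeasurable) hw.norm
        (fun n => Eventually.of_forall fun x => ?_) (Eventually.of_forall fun x => ?_)
      · rw [norm_mul]
        have : ‖f n x‖ ≤ 1 := by
          simp only [f, ContinuousMap.coe_mk, Complex.norm_real, Real.norm_eq_abs, NNReal.abs_eq]
          exact NNReal.coe_le_one.2 (thickenedIndicator_le_one (hpos n) F x)
        nlinarith [norm_nonneg (w x)]
      · have h1 := (tendsto_pi_nhds.1 (thickenedIndicator_tendsto_indicator_closure hpos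
          tendsto_one_div_add_atTop_nhds_zero_nat F)) x
        rw [hF.closure_eq] at h1
        have h2 : Tendsto (fun n => f n x) atTop
            (𝓝 (((F.indicator (fun _ => (1 : NNReal)) x : NNReal) : ℝ) : ℂ)) :=
          (Complex.continuous_ofReal.tendsto _).comp ((NNReal.continuous_coe.tendsto _).comp h1)
        have h3 := h2.mul_const (w x)
        convert h3 using 2
        by_cases hx : x ∈ F <;> simp [hx]
    simp only [h] at hlim
    rw [← integral_indicator hF.measurableSet]
    exact (tendsto_nhds_unique hlim tendsto_const_nhds)
  have hall : ∀ E : Set X, MeasurableSet E → ∫ x in E, w x ∂μ = 0 := by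
    intro E hE
    induction E, hE using MeasurableSpace.induction_on_inter
      ((BorelSpace.measurable_eq (α := X)).trans borel_eq_generateFrom_isClosed)
      isPiSystem_isClosed with
    | empty => simp
    | basic F hF => exact hclosed F hF
    | compl E hE ih =>
      have h1 := integral_add_compl hE hw
      have h2 := hclosed Set.univ isClosed_univ
      rw [setIntegral_univ] at h2
      rw [ih, h2, zero_add] at h1
      exact h1
    | iUnion E hd hm ih =>
      rw [integral_iUnion hm hd hw.integrableOn]
      simp [ih]
  exact hw.ae_eq_zero_of_forall_setIntegral_eq_zero fun E hE _ => hall E hE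

variable {Γ X D : Type} [Group Γ] [CommGroup D] {φ : Γ →* MulAut D} [MetricSpace X]
  [MeasurableSpace X] [MulAction Γ X] {μ : Measure X}

namespace CharacterSystem

variable (χ : CharacterSystem φ μ)

/-- A character as a complex valued continuous function. -/
def charC (d : D) : C(X, ℂ) := ⟨fun x => (χ.char d x : ℂ), by fun_prop⟩

theorem charC_apply (d : D) (x : X) : χ.charC d x = (χ.char d x : ℂ) := rfl

theorem norm_charC (d : D) (x : X) : ‖χ.charC d x‖ = 1 := Circle.norm_coe _

theorem charC_mul (d e : D) (x : X) : χ.charC (d * e) x = χ.charC d x * χ.charC e x := by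
  simp [charC_apply]

theorem charC_one (x : X) : χ.charC 1 x = 1 := by
  simp [charC_apply]

theorem charC_inv (d : D) (x : X) : χ.charC d⁻¹ x = (starRingEnd ℂ) (χ.charC d x) := by
  rw [charC_apply, map_inv]
  exact Circle.coe_inv_eq_conj _

theorem charC_smul (g : Γ) (d : D) (x : X) : χ.charC (φ g d) x = χ.charC d (g⁻¹ • x) := by
  rw [charC_apply, charC_apply, χ.char_smul]

theorem integral_charC {d : D} (hd : d ≠ 1) : ∫ x, χ.charC d x ∂μ = 0 := χ.integral_char d hd

theorem integral_conj_charC_mul [IsProbabilityMeasure μ] [DecidableEq D] (d e : D) :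
    ∫ x, (starRingEnd ℂ) (χ.charC d x) * χ.charC e x ∂μ = if d = e then 1 else 0 := by
  have : ∀ x, (starRingEnd ℂ) (χ.charC d x) * χ.charC e x = χ.charC (d⁻¹ * e) x := fun x => by
    rw [χ.charC_mul, χ.charC_inv]
  simp only [this]
  split_ifs with h
  · subst h
    simp [χ.charC_one]
  · exact χ.integral_charC fun h' => h (inv_mul_eq_one.1 h')

variable [CompactSpace X]

/-- The star algebra spanned by the characters. -/
def charSubalgebra : StarSubalgebra ℂ C(X, ℂ) where
  toSubalgebra := Algebra.adjoin ℂ (Set.range χ.charC)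
  star_mem' := by
    change Algebra.adjoin ℂ (Set.range χ.charC) ≤ star (Algebra.adjoin ℂ (Set.range χ.charC))
    refine Algebra.adjoin_le ?_
    rintro - ⟨d, rfl⟩
    exact Algebra.subset_adjoin ⟨d⁻¹, ContinuousMap.ext fun x => χ.charC_inv d x⟩

theorem charSubalgebra_dense : (charSubalgebra χ).topologicalClosure = ⊤ := by
  refine ContinuousMap.starSubalgebra_topologicalClosure_eq_top_of_separatesPoints _ ?_
  intro x y hxy
  have : ∃ d, χ.char d x ≠ χ.char d y := by
    by_contra! h
    exact hxy (χ.separates x y h)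
  obtain ⟨d, hd⟩ := this
  exact ⟨χ.charC d, ⟨χ.charC d, Algebra.subset_adjoin ⟨d, rfl⟩, rfl⟩, fun h => hd (Circle.ext h)⟩

theorem charSubalgebra_eq_span : Subalgebra.toSubmodule (charSubalgebra χ).toSubalgebra =
    Submodule.span ℂ (Set.range χ.charC) := by
  refine Algebra.adjoin_eq_span_of_subset _ (Set.Subset.trans ?_ Submodule.subset_span)
  intro f hf
  refine Submonoid.closure_induction (fun _ => id) ⟨1, ContinuousMap.ext χ.charC_one⟩ ?_ hf
  rintro - - - - ⟨d, rfl⟩ ⟨e, rfl⟩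
  exact ⟨d * e, ContinuousMap.ext (χ.charC_mul d e)⟩

/-- Integrable functions are determined by their Fourier coefficients. -/
theorem ae_eq_zero_of_integral_charC_mul [BorelSpace X] {w : X → ℂ} (hw : Integrable w μ)
    (h : ∀ d, ∫ x, χ.charC d x * w x ∂μ = 0) : w =ᵐ[μ] 0 := by
  refine ae_eq_zero_of_forall_integral_continuous_mul hw fun f => ?_
  have hint : ∀ f : C(X, ℂ), Integrable (fun x => f x * w x) μ := fun f =>
    hw.bdd_mul (c := ‖f‖) f.continuous.aestronglyMeasurable
      (Eventually.of_forall fun x => f.norm_coe_le_norm x)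
  let F : C(X, ℂ) →L[ℂ] ℂ := LinearMap.mkContinuous
    { toFun := fun f => ∫ x, f x * w x ∂μ
      map_add' := fun f g => by
        rw [← integral_add (hint f) (hint g)]
        simp only [ContinuousMap.add_apply, add_mul]
      map_smul' := fun c f => by
        rw [RingHom.id_apply, ← integral_smul]
        simp only [ContinuousMap.smul_apply, smul_mul_assoc] } (∫ x, ‖w x‖ ∂μ) (fun f => by
      refine (norm_integral_le_of_norm_le (hw.norm.mul_const ‖f‖)
        (Eventually.of_forall fun x => ?_)).trans_eq ?_
      · rw [norm_mul, mul_comm]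
        exact mul_le_mul_of_nonneg_left (f.norm_coe_le_norm x) (norm_nonneg _)
      · rw [integral_mul_const])
  have hF : ∀ f, F f = ∫ x, f x * w x ∂μ := fun f => rfl
  have hker : (Submodule.span ℂ (Set.range χ.charC)) ≤ LinearMap.ker (F : C(X, ℂ) →ₗ[ℂ] ℂ) := by
    refine Submodule.span_le.2 ?_
    rintro - ⟨d, rfl⟩
    exact h d
  have hcl : IsClosed {f | F f = 0} := isClosed_eq F.continuous continuous_const
  have hle : (charSubalgebra χ : Set C(X, ℂ)) ⊆ {f | F f = 0} := by
    intro f hf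
    have : f ∈ Submodule.span ℂ (Set.range χ.charC) := by
      rw [← charSubalgebra_eq_span]
      exact hf
    exact hker this
  have := closure_minimal hle hcl
  rw [← StarSubalgebra.topologicalClosure_coe, charSubalgebra_dense] at this
  exact this (Set.mem_univ f)

end CharacterSystem

end Characters

/-! ### The Fourier basis of the space of the crossed product -/

section FourierBasis

section Fibers

variable {Γ X : Type} [MeasurableSpace Γ] [Countable Γ] [MeasurableSingletonClass Γ]
  [MeasurableSpace X] (μ : Measure X)

theorem restrict_fiber [SFinite μ] (g : Γ) :
    (μ.prod (Measure.count : Measure Γ)).restrict {p | p.2 = g} = μ.map fun x => (x, g) := by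
  have : {p : X × Γ | p.2 = g} = Set.univ ×ˢ {g} := by
    ext p
    simp
  rw [this, ← Measure.prod_restrict, Measure.restrict_univ, Measure.restrict_singleton,
    Measure.count_singleton, one_smul, Measure.prod_dirac]

theorem ae_prod_count_iff [SFinite μ] {P : X × Γ → Prop} :
    (∀ᵐ p ∂μ.prod (Measure.count : Measure Γ), P p) ↔ ∀ g, ∀ᵐ x ∂μ, P (x, g) := by
  rw [Measure.count, Measure.prod_sum_right, Measure.ae_sum_iff]
  simp only [Measure.prod_dirac, (measurableEmbedding_prod_mk_right _).ae_map_iff]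

theorem setIntegral_fiber [SFinite μ] (f : X × Γ → ℂ) (g : Γ) :
    ∫ p in {p | p.2 = g}, f p ∂μ.prod (Measure.count : Measure Γ) = ∫ x, f (x, g) ∂μ := by
  rw [restrict_fiber, (measurableEmbedding_prod_mk_right g).integral_map]

theorem measurableSet_fiber (g : Γ) : MeasurableSet {p : X × Γ | p.2 = g} :=
  measurable_snd (measurableSet_singleton g)

theorem integrable_fiber [IsFiniteMeasure μ] (F : CrossedSpace Γ X μ) (g : Γ) :
    Integrable (fun x => F (x, g)) μ := by
  have h1 : MemLp F 2 (μ.map fun x => (x, g)) := by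
    rw [← restrict_fiber]
    exact (Lp.memLp F).restrict _
  exact (((measurableEmbedding_prod_mk_right g).memLp_map_measure_iff).1 h1).integrable
    (by norm_num)

end Fibers

variable {Γ X D : Type} [Group Γ] [Countable Γ] [MeasurableSpace Γ] [MeasurableSingletonClass Γ]
  [MetricSpace X] [CompactSpace X] [MeasurableSpace X] [BorelSpace X] [MulAction Γ X]
  {μ : Measure X} [IsProbabilityMeasure μ] [CommGroup D] {φ : Γ →* MulAut D}

namespace CharacterSystem

variable (χ : CharacterSystem φ μ)

theorem aestronglyMeasurable_fiberFun (s : D ⋊[φ] Γ) :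
    AEStronglyMeasurable (Set.indicator {p : X × Γ | p.2 = s.right} fun p => χ.charC s.left p.1)
      (μ.prod Measure.count) :=
  (((χ.charC s.left).continuous.measurable.comp measurable_fst).indicator
    (measurableSet_fiber _)).aestronglyMeasurable

theorem memLp_fiberFun (s : D ⋊[φ] Γ) :
    MemLp (Set.indicator {p : X × Γ | p.2 = s.right} fun p => χ.charC s.left p.1) 2
      (μ.prod Measure.count) := by
  have hfin : (μ.prod (Measure.count : Measure Γ)) {p | p.2 = s.right} ≠ ∞ := by
    rw [← Measure.restrict_apply_univ, restrict_fiber,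
      Measure.map_apply (by fun_prop) MeasurableSet.univ]
    exact measure_ne_top _ _
  refine (memLp_indicator_const 2 (measurableSet_fiber s.right) (1 : ℂ) (Or.inr hfin)).of_le
    (χ.aestronglyMeasurable_fiberFun s) (Eventually.of_forall fun p => ?_)
  by_cases hp : p ∈ {p : X × Γ | p.2 = s.right}
  · simp [Set.indicator_of_mem hp, χ.norm_charC]
  · simp [Set.indicator_of_notMem hp]

/-- The vector `χ_d ⊗ δ_g` of `L²(X) ⊗ ℓ²(Γ)`, for `s = (d, g)`. -/
def fiberVec (s : D ⋊[φ] Γ) : CrossedSpace Γ X μ := (χ.memLp_fiberFun s).toLp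

theorem fiberVec_ae (s : D ⋊[φ] Γ) (g : Γ) :
    ∀ᵐ x ∂μ, χ.fiberVec s (x, g) =
      Set.indicator {p : X × Γ | p.2 = s.right} (fun p => χ.charC s.left p.1) (x, g) :=
  (ae_prod_count_iff μ).1 (χ.memLp_fiberFun s).coeFn_toLp g

theorem inner_fiberVec (s : D ⋊[φ] Γ) (F : CrossedSpace Γ X μ) :
    ⟪χ.fiberVec s, F⟫_ℂ = ∫ x, (starRingEnd ℂ) (χ.charC s.left x) * F (x, s.right) ∂μ := by
  rw [L2.inner_def, ← setIntegral_fiber μ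
    (fun p => (starRingEnd ℂ) (χ.charC s.left p.1) * F p) s.right,
    ← integral_indicator (measurableSet_fiber _)]
  refine integral_congr_ae ?_
  filter_upwards [(χ.memLp_fiberFun s).coeFn_toLp] with p hp
  rw [fiberVec, hp]
  by_cases h : p ∈ {p : X × Γ | p.2 = s.right}
  · rw [Set.indicator_of_mem h, Set.indicator_of_mem h, RCLike.inner_apply, mul_comm]
  · rw [Set.indicator_of_notMem h, Set.indicator_of_notMem h, inner_zero_left]

theorem inner_fiberVec_fiberVec [DecidableEq (D ⋊[φ] Γ)] (s t : D ⋊[φ] Γ) :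
    ⟪χ.fiberVec s, χ.fiberVec t⟫_ℂ = if s = t then 1 else 0 := by
  classical
  rw [inner_fiberVec]
  by_cases h : s.right = t.right
  · have : ∫ x, (starRingEnd ℂ) (χ.charC s.left x) * χ.fiberVec t (x, s.right) ∂μ =
        ∫ x, (starRingEnd ℂ) (χ.charC s.left x) * χ.charC t.left x ∂μ := by
      refine integral_congr_ae ?_
      filter_upwards [χ.fiberVec_ae t s.right] with x hx
      rw [hx, Set.indicator_of_mem (by exact h)]
    rw [this, integral_conj_charC_mul]
    simp only [SemidirectProduct.ext_iff, h, and_true]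
  · have : ∫ x, (starRingEnd ℂ) (χ.charC s.left x) * χ.fiberVec t (x, s.right) ∂μ = 0 := by
      refine integral_eq_zero_of_ae ?_
      filter_upwards [χ.fiberVec_ae t s.right] with x hx
      rw [hx, Set.indicator_of_notMem (by exact h), mul_zero]
      rfl
    rw [this, if_neg fun h' => h (by rw [h'])]

theorem orthonormal_fiberVec : Orthonormal ℂ χ.fiberVec := by
  classical
  rw [orthonormal_iff_ite]
  exact χ.inner_fiberVec_fiberVec

/-- The vectors `χ_d ⊗ δ_g` form a Hilbert basis of `L²(X) ⊗ ℓ²(Γ)`, indexed by the semidirect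
product. -/
def fiberBasis : HilbertBasis (D ⋊[φ] Γ) ℂ (CrossedSpace Γ X μ) :=
  HilbertBasis.mkOfOrthogonalEqBot χ.orthonormal_fiberVec <| by
    rw [Submodule.eq_bot_iff]
    intro F hF
    rw [Submodule.mem_orthogonal] at hF
    have h : ∀ g : Γ, ∀ᵐ x ∂μ, F (x, g) = 0 := by
      intro g
      refine χ.ae_eq_zero_of_integral_charC_mul (integrable_fiber μ F g) fun d => ?_
      have h1 := hF _ (Submodule.subset_span ⟨⟨d⁻¹, g⟩, rfl⟩)
      rw [inner_fiberVec] at h1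
      simpa only [χ.charC_inv, Complex.conj_conj] using h1
    have h0 : F =ᵐ[μ.prod Measure.count] fun _ => 0 := (ae_prod_count_iff μ).2 h
    exact Lp.ext (h0.trans (Lp.coeFn_zero _ _ _).symm)

theorem fiberBasis_apply (s : D ⋊[φ] Γ) : χ.fiberBasis s = χ.fiberVec s := by
  rw [fiberBasis, HilbertBasis.coe_mkOfOrthogonalEqBot]

theorem vacuum_eq : vacuum Γ X μ = χ.fiberVec 1 := by
  refine Lp.ext ?_
  refine indicatorConstLp_coeFn.trans ?_
  refine EventuallyEq.trans ?_ (χ.memLp_fiberFun 1).coeFn_toLp.symm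
  refine Eventually.of_forall fun p => ?_
  by_cases h : p.2 = 1
  · rw [Set.indicator_of_mem (by simpa using h), Set.indicator_of_mem (by simpa using h)]
    exact (χ.charC_one p.1).symm
  · rw [Set.indicator_of_notMem (by simpa using h), Set.indicator_of_notMem (by simpa using h)]

/-- A character as an element of `L^∞(X)`. -/
def charLp (d : D) : Lp ℂ ∞ μ :=
  (memLp_top_of_bound (χ.charC d).continuous.aestronglyMeasurable 1
    (Eventually.of_forall fun x => (χ.norm_charC d x).le)).toLp

theorem charLp_ae (d : D) : χ.charLp d =ᵐ[μ] χ.charC d := MemLp.coeFn_toLp _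

variable [MeasurableConstSMul Γ X] [SMulInvariantMeasure Γ X μ]

/-- The unitary `χ_d u_g` of the crossed product, for `s = (d, g)`. -/
def unitaryOp (s : D ⋊[φ] Γ) : CrossedSpace Γ X μ →L[ℂ] CrossedSpace Γ X μ :=
  multiplicationOp Γ (χ.charLp s.left) * translationOp X μ s.right

/-- The unitaries `χ_d u_g` act on the Fourier basis by left translation, so that the crossed
product acts as the group von Neumann algebra of the semidirect product. -/
theorem unitaryOp_fiberVec (s t : D ⋊[φ] Γ) :
    χ.unitaryOp s (χ.fiberVec t) = χ.fiberVec (s * t) := by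
  refine Lp.ext ?_
  have h1 := multiplicationOp_apply Γ (χ.charLp s.left)
    (translationOp X μ s.right (χ.fiberVec t))
  have h2 := translationOp_apply X μ s.right (χ.fiberVec t)
  have h3 : ∀ᵐ p ∂μ.prod (Measure.count : Measure Γ), χ.charLp s.left p.1 = χ.charC s.left p.1 :=
    (ae_prod_count_iff μ).2 fun _ => χ.charLp_ae s.left
  have h4 := (measurePreserving_diag X μ s.right).quasiMeasurePreserving.ae
    (χ.memLp_fiberFun t).coeFn_toLp
  have h5 := (χ.memLp_fiberFun (s * t)).coeFn_toLp
  filter_upwards [h1, h2, h3, h4, h5] with p h1 h2 h3 h4 h5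
  change multiplicationOp Γ (χ.charLp s.left)
    (translationOp X μ s.right (χ.fiberVec t)) p = χ.fiberVec (s * t) p
  rw [h1, h2, h3]
  simp only [fiberVec]
  rw [h4, h5]
  by_cases h : p.2 = s.right * t.right
  · rw [Set.indicator_of_mem (show p ∈ {p : X × Γ | p.2 = (s * t).right} from h),
      Set.indicator_of_mem (show (s.right⁻¹ • p.1, s.right⁻¹ * p.2) ∈
        {q : X × Γ | q.2 = t.right} from inv_mul_eq_iff_eq_mul.2 h),
      SemidirectProduct.mul_left, χ.charC_mul, χ.charC_smul]
  · rw [Set.indicator_of_notMem (show p ∉ {p : X × Γ | p.2 = (s * t).right} from h),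
      Set.indicator_of_notMem (show (s.right⁻¹ • p.1, s.right⁻¹ * p.2) ∉
        {q : X × Γ | q.2 = t.right} from fun h' => h (inv_mul_eq_iff_eq_mul.1 h')), mul_zero]

end CharacterSystem

end FourierBasis

/-! ### Normal functionals on the base of the crossed product -/

section NormalFunctionals

variable {Γ X : Type} [MeasurableSpace Γ] [Countable Γ] [MeasurableSingletonClass Γ]
  [MeasurableSpace X] {μ : Measure X} [IsProbabilityMeasure μ]

/-- The restriction of a normal functional to `L^∞(X)` is given by a density in `L¹(X)`. -/
theorem IsNormalFunctional.exists_density {M : VonNeumannAlgebra (CrossedSpace Γ X μ)}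
    {ψ : M.toStarSubalgebra → ℂ} (hψ : IsNormalFunctional M ψ) :
    ∃ w : X → ℂ, Integrable w μ ∧ ∀ (x : M.toStarSubalgebra) (a : Lp ℂ ∞ μ),
      (x : CrossedSpace Γ X μ →L[ℂ] CrossedSpace Γ X μ) = multiplicationOp Γ a →
        ψ x = ∫ t, a t * w t ∂μ := by
  obtain ⟨e, f, he, hf, hsum⟩ := hψ
  let ρ : Measure (X × Γ) := μ.prod Measure.count
  -- the density on `X × Γ` is `∑ₙ conj(eₙ) fₙ`, which converges in `L¹`
  let F : ℕ → Lp ℂ 1 ρ := fun n => (ContinuousLinearMap.mul ℂ ℂ).holder 1 (star (e n)) (f n)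
  have hF : Summable F := by
    refine Summable.of_norm_bounded (g := fun n => ‖e n‖ ^ 2 + ‖f n‖ ^ 2) (he.add hf) fun n => ?_
    refine ((ContinuousLinearMap.mul ℂ ℂ).norm_holder_apply_apply_le (star (e n)) (f n)).trans ?_
    have h0 : ‖star (e n)‖ = ‖e n‖ := by
      rw [Lp.norm_def, Lp.norm_def]
      congr 1
      refine eLpNorm_congr_norm_ae ?_
      filter_upwards [Lp.coeFn_star (e n)] with p hp
      rw [hp, Pi.star_apply, norm_star]
    rw [h0]
    have h1 : ‖ContinuousLinearMap.mul ℂ ℂ‖ ≤ 1 := ContinuousLinearMap.opNorm_mul_le ℂ ℂ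
    have h2 : ‖ContinuousLinearMap.mul ℂ ℂ‖ * ‖e n‖ ≤ ‖e n‖ :=
      mul_le_of_le_one_left (norm_nonneg _) h1
    nlinarith [norm_nonneg (e n), norm_nonneg (f n), sq_nonneg (‖e n‖ - ‖f n‖),
      mul_le_mul_of_nonneg_right h2 (norm_nonneg (f n))]
  let W : Lp ℂ 1 ρ := ∑' n, F n
  have hW : Integrable W ρ := L1.integrable_coeFn W
  refine ⟨fun t => ∫ g, W (t, g) ∂Measure.count, hW.integral_prod_left, fun x a hxa => ?_⟩
  let T : Lp ℂ 1 ρ →L[ℝ] ℂ := (L1.integralCLM (E := ℂ) (μ := ρ)) ∘L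
    ((ContinuousLinearMap.mul ℂ ℂ).holderL ρ ∞ 1 1 (pullbackFst Γ a)).restrictScalars ℝ
  have hT : ∀ G : Lp ℂ 1 ρ, T G = ∫ p, a p.1 * G p ∂ρ ∧ Integrable (fun p => a p.1 * G p) ρ := by
    intro G
    let G' : Lp ℂ 1 ρ := (ContinuousLinearMap.mul ℂ ℂ).holder 1 (pullbackFst Γ a) G
    have h1 := (ContinuousLinearMap.mul ℂ ℂ).coeFn_holder (r := 1) (pullbackFst Γ a) G
    have h2 : pullbackFst Γ a =ᵐ[ρ] fun p => a p.1 := MemLp.coeFn_toLp _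
    have h3 : G' =ᵐ[ρ] fun p => a p.1 * G p := by
      filter_upwards [h1, h2] with p h1 h2
      rw [h1, h2]
      rfl
    have h4 : T G = L1.integral G' := by
      rw [L1.integral_eq]
      rfl
    refine ⟨?_, (L1.integrable_coeFn G').congr h3⟩
    rw [h4, L1.integral_eq_integral]
    exact integral_congr_ae h3
  have h1 : HasSum (fun n => T (F n)) (T W) := T.hasSum hF.hasSum
  have h2 : ∀ n, T (F n) = ⟪e n, (x : CrossedSpace Γ X μ →L[ℂ] CrossedSpace Γ X μ) (f n)⟫_ℂ := by
    intro n
    rw [(hT (F n)).1, L2.inner_def]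
    refine integral_congr_ae ?_
    have h3 := (ContinuousLinearMap.mul ℂ ℂ).coeFn_holder (r := 1) (star (e n)) (f n)
    have h4 := Lp.coeFn_star (e n)
    have h5 := multiplicationOp_apply Γ a (f n)
    filter_upwards [h3, h4, h5] with p h3 h4 h5
    rw [hxa, h5, h3, h4, RCLike.inner_apply]
    simp only [ContinuousLinearMap.mul_apply', Pi.star_apply]
    rw [starRingEnd_apply]
    ring
  simp only [h2] at h1
  rw [(hsum x).unique h1, (hT W).1, integral_prod _ (hT W).2]
  simp only [integral_const_mul]

end NormalFunctionals

/-! ### Rigidity from relative property (T) -/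

section RelativeTToRigid

section HilbertBasis

variable {ι E F : Type*} [NormedAddCommGroup E] [InnerProductSpace ℂ E] [NormedAddCommGroup F]
  [InnerProductSpace ℂ F]

theorem HilbertBasis.clm_ext (b : HilbertBasis ι ℂ E) {S T : E →L[ℂ] F}
    (h : ∀ i, S (b i) = T (b i)) : S = T := by
  refine ContinuousLinearMap.ext_on
    (s := Set.range b) ?_ ?_
  · exact Submodule.dense_iff_topologicalClosure_eq_top.2 b.dense_span
  · rintro - ⟨i, rfl⟩
    exact h i

theorem HilbertBasis.ext_inner (b : HilbertBasis ι ℂ E) {x y : E}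
    (h : ∀ i, ⟪b i, x⟫_ℂ = ⟪b i, y⟫_ℂ) : x = y := by
  refine b.repr.injective (lp.ext (funext fun i => ?_))
  rw [b.repr_apply_apply, b.repr_apply_apply, h]

/-- Operators are determined by their matrix elements. -/
theorem HilbertBasis.clm_ext_inner {κ : Type*} (b : HilbertBasis ι ℂ E) (c : HilbertBasis κ ℂ F)
    {S T : E →L[ℂ] F} (h : ∀ i j, ⟪c j, S (b i)⟫_ℂ = ⟪c j, T (b i)⟫_ℂ) : S = T :=
  b.clm_ext fun i => c.ext_inner fun j => h i j

end HilbertBasis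

namespace HilbertBimodule

variable {H : Type} [NormedAddCommGroup H] [InnerProductSpace ℂ H] [CompleteSpace H]
  {M : VonNeumannAlgebra H} {K : Type} [NormedAddCommGroup K] [InnerProductSpace ℂ K]
  [CompleteSpace K] (B : HilbertBimodule M K) {G : Type} [Group G]

theorem left_mem_unitary {u : M.toStarSubalgebra} (hu : u ∈ unitary M.toStarSubalgebra) :
    B.left u ∈ unitary (K →L[ℂ] K) :=
  Unitary.map_mem B.left hu

theorem right_mem_unitary {u : M.toStarSubalgebra} (hu : u ∈ unitary M.toStarSubalgebra) :
    B.right (MulOpposite.op u) ∈ unitary (K →L[ℂ] K) := by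
  refine Unitary.map_mem B.right ?_
  rw [Unitary.mem_iff] at hu ⊢
  exact ⟨congrArg MulOpposite.op hu.2, congrArg MulOpposite.op hu.1⟩

/-- The unitary representation `ξ ↦ u ξ u⁻¹` on a bimodule of a group of unitaries of `M`. -/
def conjugation (u : G →* unitary M.toStarSubalgebra) : G →* (K ≃ₗᵢ[ℂ] K) :=
  (Unitary.linearIsometryEquiv : unitary (K →L[ℂ] K) ≃* (K ≃ₗᵢ[ℂ] K)).toMonoidHom.comp
    { toFun := fun s => ⟨B.left (u s) * B.right (MulOpposite.op (u s⁻¹ : M.toStarSubalgebra)),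
        mul_mem (B.left_mem_unitary (u s).2) (B.right_mem_unitary (u s⁻¹).2)⟩
      map_one' := by
        apply Subtype.ext
        simp
      map_mul' := fun s t => by
        apply Subtype.ext
        have h1 : ((u (s * t) : unitary M.toStarSubalgebra) : M.toStarSubalgebra) =
            (u s : M.toStarSubalgebra) * u t := by rw [map_mul]; rfl
        have h2 : MulOpposite.op ((u (s * t)⁻¹ : unitary M.toStarSubalgebra) : M.toStarSubalgebra) =
            MulOpposite.op (u s⁻¹ : M.toStarSubalgebra) *
              MulOpposite.op (u t⁻¹ : M.toStarSubalgebra) := by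
          rw [mul_inv_rev, map_mul]
          rfl
        change B.left _ * B.right _ = (B.left _ * B.right _) * (B.left _ * B.right _)
        rw [h1, h2, map_mul, map_mul, mul_assoc, mul_assoc]
        congr 1
        rw [← mul_assoc, ← mul_assoc, (B.commute _ _).eq] }

theorem right_conjugation (u : G →* unitary M.toStarSubalgebra) (s : G) (ξ : K) :
    B.right (MulOpposite.op (u s : M.toStarSubalgebra)) (B.conjugation u s ξ) =
      B.left (u s) ξ := by
  have h1 : MulOpposite.op (u s : M.toStarSubalgebra) *
      MulOpposite.op (u s⁻¹ : M.toStarSubalgebra) = 1 := by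
    have : (u s⁻¹ : M.toStarSubalgebra) * u s = 1 := by
      have h := congrArg Subtype.val (map_mul u s⁻¹ s)
      rw [inv_mul_cancel, map_one] at h
      exact h.symm
    rw [← MulOpposite.op_mul, this, MulOpposite.op_one]
  have h2 : B.right (MulOpposite.op (u s : M.toStarSubalgebra)) * (B.left (u s) *
      B.right (MulOpposite.op (u s⁻¹ : M.toStarSubalgebra))) = B.left (u s) := by
    rw [← mul_assoc, ← (B.commute _ _).eq, mul_assoc, ← map_mul, h1, map_one, mul_one]
  exact congrArg (fun T : K →L[ℂ] K => T ξ) h2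

theorem norm_conjugation_sub (u : G →* unitary M.toStarSubalgebra) (s : G) (ξ : K) :
    ‖B.conjugation u s ξ - ξ‖ = ‖B.commutator (u s) ξ‖ := by
  rw [← ContinuousLinearMap.norm_map_of_mem_unitary (B.right_mem_unitary (u s).2), map_sub,
    right_conjugation]
  rfl

theorem norm_eq_one {τ : M.toStarSubalgebra → ℂ} (hτ : τ 1 = 1) {ξ : K} (hξ : B.IsTracial τ ξ) :
    ‖ξ‖ = 1 := by
  have h := (hξ 1).1
  rw [map_one, hτ, one_apply_eq_self, inner_self_eq_norm_sq_to_K] at h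
  have h2 : ‖ξ‖ ^ 2 = 1 := Complex.ofReal_injective (by push_cast; exact h)
  nlinarith [norm_nonneg ξ]

end HilbertBimodule

variable {Γ X D : Type} [Group Γ] [Countable Γ] [MeasurableSpace Γ] [MeasurableSingletonClass Γ]
  [MetricSpace X] [CompactSpace X] [MeasurableSpace X] [BorelSpace X] [MulAction Γ X]
  {μ : Measure X} [IsProbabilityMeasure μ] [CommGroup D] {φ : Γ →* MulAut D}
  [MeasurableConstSMul Γ X] [SMulInvariantMeasure Γ X μ]

theorem multiplicationOp_mem (a : Lp ℂ ∞ μ) : multiplicationOp Γ a ∈ crossedProduct Γ X μ :=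
  subset_vonNeumannGenerated _ (Or.inl ⟨a, rfl⟩)

theorem translationOp_mem (g : Γ) : translationOp X μ g ∈ crossedProduct Γ X μ :=
  subset_vonNeumannGenerated _ (Or.inr ⟨g, rfl⟩)

theorem translationOp_one : translationOp X μ (1 : Γ) = 1 := by
  ext F
  refine (translationOp_apply X μ 1 F).trans (Eventually.of_forall fun p => ?_)
  simp

namespace CharacterSystem

variable (χ : CharacterSystem φ μ)

theorem unitaryOp_mem (s : D ⋊[φ] Γ) : χ.unitaryOp s ∈ crossedProduct Γ X μ :=
  mul_mem (multiplicationOp_mem _) (translationOp_mem _)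

theorem unitaryOp_inl (d : D) :
    χ.unitaryOp (SemidirectProduct.inl d) = multiplicationOp Γ (χ.charLp d) := by
  rw [unitaryOp, SemidirectProduct.right_inl, translationOp_one, mul_one,
    SemidirectProduct.left_inl]

theorem unitaryOp_basis (s t : D ⋊[φ] Γ) :
    χ.unitaryOp s (χ.fiberBasis t) = χ.fiberBasis (s * t) := by
  simp only [fiberBasis_apply, unitaryOp_fiberVec]

theorem unitaryOp_mul (s t : D ⋊[φ] Γ) :
    χ.unitaryOp (s * t) = χ.unitaryOp s * χ.unitaryOp t := by
  refine χ.fiberBasis.clm_ext fun r => ?_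
  rw [mul_apply_eq_comp]
  simp only [unitaryOp_basis, mul_assoc]

theorem unitaryOp_one : χ.unitaryOp 1 = 1 := by
  refine χ.fiberBasis.clm_ext fun r => ?_
  rw [unitaryOp_basis, one_mul, one_apply_eq_self]

theorem star_unitaryOp (s : D ⋊[φ] Γ) : star (χ.unitaryOp s) = χ.unitaryOp s⁻¹ := by
  classical
  refine χ.fiberBasis.clm_ext_inner χ.fiberBasis fun r t => ?_
  rw [ContinuousLinearMap.star_eq_adjoint, ContinuousLinearMap.adjoint_inner_right,
    unitaryOp_basis, unitaryOp_basis]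
  have h := orthonormal_iff_ite.1 χ.fiberBasis.orthonormal
  rw [h, h]
  simp only [eq_inv_mul_iff_mul_eq]

/-- The group of unitaries `χ_d u_g` of the crossed product. -/
def unitaries : D ⋊[φ] Γ →* unitary (crossedProduct Γ X μ).toStarSubalgebra where
  toFun s := ⟨⟨χ.unitaryOp s, χ.unitaryOp_mem s⟩, by
    constructor
    · apply Subtype.ext
      change star (χ.unitaryOp s) * χ.unitaryOp s = 1
      rw [star_unitaryOp, ← unitaryOp_mul, inv_mul_cancel, unitaryOp_one]
    · apply Subtype.ext
      change χ.unitaryOp s * star (χ.unitaryOp s) = 1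
      rw [star_unitaryOp, ← unitaryOp_mul, mul_inv_cancel, unitaryOp_one]⟩
  map_one' := by
    apply Subtype.ext
    apply Subtype.ext
    exact χ.unitaryOp_one
  map_mul' s t := by
    apply Subtype.ext
    apply Subtype.ext
    exact χ.unitaryOp_mul s t

theorem crossedTrace_one (χ : CharacterSystem φ μ) : crossedTrace Γ X μ 1 = 1 := by
  change ⟪vacuum Γ X μ, vacuum Γ X μ⟫_ℂ = 1
  classical
  rw [χ.vacuum_eq, inner_fiberVec_fiberVec, if_pos rfl]

/-- By normality of the two actions on a bimodule, a vector that commutes with all characters is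
central for all of `L^∞(X)`. -/
theorem mem_central_of_forall_char {K : Type} [NormedAddCommGroup K] [InnerProductSpace ℂ K]
    [CompleteSpace K] (B : HilbertBimodule (crossedProduct Γ X μ) K) {η : K}
    (h : ∀ d : D, B.left (χ.unitaries (SemidirectProduct.inl d)) η =
      B.right (MulOpposite.op (χ.unitaries (SemidirectProduct.inl d) :
        (crossedProduct Γ X μ).toStarSubalgebra)) η) :
    η ∈ B.central (crossedBase Γ X μ) := by
  rintro x ⟨a, ha⟩
  refine ext_inner_left ℂ fun ζ => ?_
  obtain ⟨v, hv, hv'⟩ := (B.left_normal η ζ).exists_density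
  obtain ⟨w, hw, hw'⟩ := (B.right_normal η ζ).exists_density
  have hvw : (fun t => v t - w t) =ᵐ[μ] 0 := by
    refine χ.ae_eq_zero_of_integral_charC_mul (hv.sub hw) fun d => ?_
    have hint : ∀ u : X → ℂ, Integrable u μ → Integrable (fun t => χ.charC d t * u t) μ :=
      fun u hu => hu.bdd_mul (c := 1) (χ.charC d).continuous.aestronglyMeasurable
        (Eventually.of_forall fun x => (χ.norm_charC d x).le)
    have h1 := hv' (χ.unitaries (SemidirectProduct.inl d)) (χ.charLp d) (χ.unitaryOp_inl d)
    have h2 := hw' (χ.unitaries (SemidirectProduct.inl d)) (χ.charLp d) (χ.unitaryOp_inl d)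
    rw [h d, h2] at h1
    have h3 : ∀ u : X → ℂ, ∫ t, χ.charLp d t * u t ∂μ = ∫ t, χ.charC d t * u t ∂μ := fun u => by
      refine integral_congr_ae ?_
      filter_upwards [χ.charLp_ae d] with t ht
      rw [ht]
    rw [h3, h3] at h1
    simp only [mul_sub]
    rw [integral_sub (hint v hv) (hint w hw), h1, sub_self]
  have h1 := hv' x a ha.symm
  have h2 := hw' x a ha.symm
  rw [h1, h2]
  refine integral_congr_ae ?_
  filter_upwards [hvw] with t ht
  rw [sub_eq_zero.1 ht]

/-- Conjugation by the unitaries `χ_d u_g` on a bimodule is a unitary representation of `D ⋊ Γ`, for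
which almost central vectors are almost invariant and the invariant vectors of `D` are central for
`L^∞(X)`. Relative property (T) thus moves almost central tracial vectors close to central ones. -/
theorem isRigidAction_of_hasRelativeT (χ : CharacterSystem φ μ) (hT : HasRelativeT φ) :
    IsRigidAction Γ X μ := by
  intro K _ _ _ B ξ hξ hcen
  let σ : D ⋊[φ] Γ →* (K ≃ₗᵢ[ℂ] K) := B.conjugation χ.unitaries
  have hσ := hT K σ ξ (fun n => B.norm_eq_one χ.crossedTrace_one (hξ n)) (fun s => by
    rw [almostFixedOn_singleton_iff]
    simp only [σ, B.norm_conjugation_sub]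
    exact hcen _)
  rw [Metric.tendsto_atTop']
  intro ε hε
  obtain ⟨N, hN⟩ := eventually_atTop.1 (hσ (ε / 2) (half_pos hε))
  refine ⟨N, fun n hn => ?_⟩
  obtain ⟨η, hη, hle⟩ := exists_fixed_of_norm_sub_le (σ.comp SemidirectProduct.inl) (ξ n)
    (fun d => hN n hn.le _ ⟨d, rfl⟩)
  have hmem : η ∈ B.central (crossedBase Γ X μ) := by
    refine χ.mem_central_of_forall_char B fun d => ?_
    have h1 := B.norm_conjugation_sub χ.unitaries (SemidirectProduct.inl d) η
    have h2 : B.conjugation χ.unitaries (SemidirectProduct.inl d) η = η := hη d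
    rw [h2, sub_self, norm_zero] at h1
    exact sub_eq_zero.1 (norm_eq_zero.1 h1.symm)
  have hmin : ‖ξ n - (B.central (crossedBase Γ X μ)).starProjection (ξ n)‖ ≤ ‖ξ n - η‖ := by
    rw [Submodule.starProjection_minimal]
    exact ciInf_le ⟨0, by rintro - ⟨y, rfl⟩; exact norm_nonneg _⟩
      (⟨η, hmem⟩ : B.central (crossedBase Γ X μ))
  rw [Real.dist_0_eq_abs, abs_of_nonneg (norm_nonneg _)]
  linarith

end CharacterSystem

end RelativeTToRigid

/-! ### Hilbert space tensor products with a chosen basis -/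

section TensorProducts

/-- A functional given by an absolutely convergent sum over an arbitrary index set is normal. -/
theorem isNormalFunctional_of_hasSum {H : Type} [NormedAddCommGroup H] [InnerProductSpace ℂ H]
    [CompleteSpace H] (M : VonNeumannAlgebra H) {ψ : M.toStarSubalgebra → ℂ} {ι : Type}
    {e f : ι → H} (he : Summable fun i => ‖e i‖ ^ 2) (hf : Summable fun i => ‖f i‖ ^ 2)
    (h : ∀ x : M.toStarSubalgebra, HasSum (fun i => ⟪e i, (x : H →L[ℂ] H) (f i)⟫_ℂ) (ψ x)) :
    IsNormalFunctional M ψ := by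
  -- only countably many terms are nonzero, and these are enumerated by natural numbers
  have hc := he.countable_support
  let S : Set ι := Function.support fun i => ‖e i‖ ^ 2
  have : Countable S := hc
  let : Encodable S := Encodable.ofCountable S
  have hinj : Function.Injective (Encodable.encode : S → ℕ) := Encodable.encode_injective
  let ext : (ι → H) → ℕ → H := fun v => Function.extend Encodable.encode (fun i : S => v i) 0
  have key : ∀ (v : ι → H), (fun n => ‖ext v n‖ ^ 2) =
      Function.extend Encodable.encode (fun i : S => ‖v i‖ ^ 2) 0 := by
    intro v
    funext n
    by_cases hn : ∃ i : S, Encodable.encode i = n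
    · obtain ⟨i, rfl⟩ := hn
      simp only [ext, hinj.extend_apply]
    · simp only [ext, Function.extend_apply' _ _ _ hn, Pi.zero_apply, norm_zero]
      norm_num
  refine ⟨ext e, ext f, ?_, ?_, fun x => ?_⟩
  · rw [key, summable_extend_zero hinj]
    exact he.subtype S
  · rw [key, summable_extend_zero hinj]
    exact hf.subtype S
  · have h1 : (fun n => ⟪ext e n, (x : H →L[ℂ] H) (ext f n)⟫_ℂ) =
        Function.extend Encodable.encode
          (fun i : S => ⟪e i, (x : H →L[ℂ] H) (f i)⟫_ℂ) 0 := by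
      funext n
      by_cases hn : ∃ i : S, Encodable.encode i = n
      · obtain ⟨i, rfl⟩ := hn
        simp only [ext, hinj.extend_apply]
      · simp only [ext, Function.extend_apply' _ _ _ hn, Pi.zero_apply, inner_zero_left]
    rw [h1, hasSum_extend_zero hinj]
    refine (hasSum_subtype_iff_of_support_subset (s := S)
      (f := fun i => ⟪e i, (x : H →L[ℂ] H) (f i)⟫_ℂ) ?_).2 (h x)
    intro i hi
    change ‖e i‖ ^ 2 ≠ 0
    intro h0
    have h2 : e i = 0 := norm_eq_zero.1 (pow_eq_zero_iff two_ne_zero |>.1 h0)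
    exact hi (by simp only [h2, inner_zero_left])

variable {ι E F : Type} [NormedAddCommGroup E] [InnerProductSpace ℂ E] [NormedAddCommGroup F]
  [InnerProductSpace ℂ F]

theorem lp.summable_norm_sq (x : lp (fun _ : ι => E) 2) : Summable fun i => ‖x i‖ ^ 2 := by
  have := (lp.memℓp x).summable (by norm_num)
  simpa using this

/-- The operator `T ⊗ 1` on `E ⊗ ℓ²(ι)`. -/
def lpMap (ι : Type) (T : E →L[ℂ] F) : lp (fun _ : ι => E) 2 →L[ℂ] lp (fun _ : ι => F) 2 :=
  LinearMap.mkContinuous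
    { toFun := fun x => ⟨fun i => T (x i), by
        refine memℓp_gen ?_
        refine Summable.of_nonneg_of_le (fun i => by positivity) (fun i => ?_)
          ((lp.summable_norm_sq x).mul_left (‖T‖ ^ 2))
        have := T.le_opNorm (x i)
        simp only [ENNReal.toReal_ofNat, Real.rpow_ofNat]
        rw [← mul_pow]
        gcongr⟩
      map_add' := fun x y => by
        ext i
        exact map_add T _ _
      map_smul' := fun c x => by
        ext i
        exact map_smul T _ _ } ‖T‖ (fun x => by
      refine lp.norm_le_of_tsum_le (by norm_num) (by positivity) ?_
      have h1 := lp.norm_rpow_eq_tsum (p := 2) (by norm_num) x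
      simp only [ENNReal.toReal_ofNat, Real.rpow_ofNat] at h1 ⊢
      rw [mul_pow, h1, ← tsum_mul_left]
      have hle : ∀ i, ‖T (x i)‖ ^ 2 ≤ ‖T‖ ^ 2 * ‖x i‖ ^ 2 := fun i => by
        rw [← mul_pow]
        gcongr
        exact T.le_opNorm (x i)
      have hs := (lp.summable_norm_sq x).mul_left (‖T‖ ^ 2)
      exact (Summable.of_nonneg_of_le (fun i => by positivity) hle hs).tsum_le_tsum hle hs)

theorem lpMap_apply (T : E →L[ℂ] F) (x : lp (fun _ : ι => E) 2) (i : ι) :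
    lpMap ι T x i = T (x i) := rfl

/-- The `*`-homomorphism `T ↦ T ⊗ 1`. -/
def lpAmp (ι : Type) (H : Type) [NormedAddCommGroup H] [InnerProductSpace ℂ H] [CompleteSpace H] :
    (H →L[ℂ] H) →⋆ₐ[ℂ] (lp (fun _ : ι => H) 2 →L[ℂ] lp (fun _ : ι => H) 2) where
  toFun := lpMap ι
  map_one' := rfl
  map_mul' S T := rfl
  map_zero' := rfl
  map_add' S T := rfl
  commutes' c := rfl
  map_star' T := by
    refine ContinuousLinearMap.ext fun x => ext_inner_left ℂ fun y => ?_
    rw [ContinuousLinearMap.star_eq_adjoint (lpMap ι T), ContinuousLinearMap.adjoint_inner_right,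
      lp.inner_eq_tsum, lp.inner_eq_tsum]
    refine tsum_congr fun i => ?_
    rw [lpMap_apply, lpMap_apply, ContinuousLinearMap.star_eq_adjoint,
      ContinuousLinearMap.adjoint_inner_right]

theorem lpAmp_apply {H : Type} [NormedAddCommGroup H] [InnerProductSpace ℂ H] [CompleteSpace H]
    (T : H →L[ℂ] H) (x : lp (fun _ : ι => H) 2) (i : ι) : lpAmp ι H T x i = T (x i) := rfl

variable {L H G : Type} [NormedAddCommGroup L] [InnerProductSpace ℂ L]
  [NormedAddCommGroup H] [InnerProductSpace ℂ H]

/-- The elementary tensor `h ⊗ ζ` of `H ⊗ L`, where `L` is identified with `ℓ²(ι)` by the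
basis `b`. -/
def elemTensor (b : HilbertBasis ι ℂ L) (h : H) : L →L[ℂ] lp (fun _ : ι => H) 2 :=
  lpMap ι (ContinuousLinearMap.toSpanSingleton ℂ h) ∘L
    (b.repr.toContinuousLinearEquiv : L →L[ℂ] lp (fun _ : ι => ℂ) 2)

theorem elemTensor_apply (b : HilbertBasis ι ℂ L) (h : H) (ζ : L) (i : ι) :
    elemTensor b h ζ i = ⟪b i, ζ⟫_ℂ • h := by
  rw [← b.repr_apply_apply]
  rfl

theorem inner_elemTensor_left (b : HilbertBasis ι ℂ L) (h : H) (i : ι)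
    (x : lp (fun _ : ι => H) 2) : ⟪elemTensor b h (b i), x⟫_ℂ = ⟪h, x i⟫_ℂ := by
  classical
  rw [lp.inner_eq_tsum, tsum_eq_single i]
  · rw [elemTensor_apply, orthonormal_iff_ite.1 b.orthonormal, if_pos rfl, one_smul]
  · intro j hj
    rw [elemTensor_apply, orthonormal_iff_ite.1 b.orthonormal, if_neg hj, zero_smul,
      inner_zero_left]

theorem inner_elemTensor (b : HilbertBasis ι ℂ L) (h h' : H) (ζ ζ' : L) :
    ⟪elemTensor b h ζ, elemTensor b h' ζ'⟫_ℂ = ⟪h, h'⟫_ℂ * ⟪ζ, ζ'⟫_ℂ := by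
  rw [lp.inner_eq_tsum, ← (b.hasSum_inner_mul_inner ζ ζ').tsum_eq, ← tsum_mul_left]
  refine tsum_congr fun i => ?_
  rw [elemTensor_apply, elemTensor_apply, inner_smul_left, inner_smul_right, inner_conj_symm]
  ring

theorem norm_elemTensor (b : HilbertBasis ι ℂ L) (h : H) (ζ : L) :
    ‖elemTensor b h ζ‖ = ‖h‖ * ‖ζ‖ := by
  have h1 := inner_elemTensor b h h ζ ζ
  rw [inner_self_eq_norm_sq_to_K, inner_self_eq_norm_sq_to_K, inner_self_eq_norm_sq_to_K] at h1
  have h2 : ‖elemTensor b h ζ‖ ^ 2 = (‖h‖ * ‖ζ‖) ^ 2 :=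
    Complex.ofReal_injective (by push_cast; rw [mul_pow]; exact h1)
  exact (pow_left_inj₀ (norm_nonneg _) (by positivity) two_ne_zero).1 h2

/-- The map `h ↦ h ⊗ ζ`. -/
def elemTensorLeft (b : HilbertBasis ι ℂ L) (ζ : L) : H →L[ℂ] lp (fun _ : ι => H) 2 :=
  LinearMap.mkContinuous
    { toFun := fun h => elemTensor b h ζ
      map_add' := fun h h' => by
        ext i
        change elemTensor b (h + h') ζ i = elemTensor b h ζ i + elemTensor b h' ζ i
        simp only [elemTensor_apply, smul_add]
      map_smul' := fun c h => by
        ext i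
        change elemTensor b (c • h) ζ i = c • elemTensor b h ζ i
        simp only [elemTensor_apply, smul_comm c] } ‖ζ‖ fun h => by
    rw [mul_comm]
    exact (norm_elemTensor b h ζ).le

theorem elemTensorLeft_apply (b : HilbertBasis ι ℂ L) (ζ : L) (h : H) :
    elemTensorLeft b ζ h = elemTensor b h ζ := rfl

theorem lpAmp_elemTensor [CompleteSpace H] (b : HilbertBasis ι ℂ L) (T : H →L[ℂ] H) (h : H)
    (ζ : L) : lpAmp ι H T (elemTensor b h ζ) = elemTensor b (T h) ζ := by
  ext i
  rw [lpAmp_apply, elemTensor_apply, elemTensor_apply, map_smul]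

variable [CompleteSpace L] [CompleteSpace H]

/-- The Hilbert basis `e_s ⊗ c_{s,i}` of `H ⊗ L`, for a Hilbert basis `e` of `H` and Hilbert bases
`c_s` of `L`. -/
def tensorBasis (b : HilbertBasis ι ℂ L) (e : HilbertBasis G ℂ H) (c : G → HilbertBasis ι ℂ L) :
    HilbertBasis (G × ι) ℂ (lp (fun _ : ι => H) 2) :=
  HilbertBasis.mkOfOrthogonalEqBot (v := fun p => elemTensor b (e p.1) (c p.1 p.2))
    (by
      classical
      rw [orthonormal_iff_ite]
      rintro ⟨s, i⟩ ⟨t, j⟩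
      rw [inner_elemTensor, orthonormal_iff_ite.1 e.orthonormal]
      by_cases hst : s = t
      · subst hst
        rw [if_pos rfl, one_mul, orthonormal_iff_ite.1 (c s).orthonormal]
        simp
      · rw [if_neg hst, zero_mul, if_neg]
        simp [hst])
    (by
      rw [Submodule.eq_bot_iff]
      intro x hx
      rw [Submodule.mem_orthogonal'] at hx
      have h1 : ∀ s, (innerSL ℂ x) ∘L elemTensor b (e s) = 0 := fun s =>
        (c s).clm_ext fun i => hx _ (Submodule.subset_span ⟨(s, i), rfl⟩)
      ext i
      refine e.ext_inner fun s => ?_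
      have h2 : ⟪x, elemTensor b (e s) (b i)⟫_ℂ = 0 :=
        congrArg (fun T : L →L[ℂ] ℂ => T (b i)) (h1 s)
      rw [← inner_elemTensor_left b, ← inner_conj_symm, h2, map_zero]
      exact inner_zero_right _ |>.symm)

theorem tensorBasis_apply (b : HilbertBasis ι ℂ L) (e : HilbertBasis G ℂ H)
    (c : G → HilbertBasis ι ℂ L) (p : G × ι) :
    tensorBasis b e c p = elemTensor b (e p.1) (c p.1 p.2) := by
  rw [tensorBasis, HilbertBasis.coe_mkOfOrthogonalEqBot]

theorem HilbertBasis.trans_symm_apply {κ : Type} (c : HilbertBasis κ ℂ E)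
    (c' : HilbertBasis κ ℂ F) (i : κ) : (c.repr.trans c'.repr.symm) (c i) = c' i := by
  classical
  rw [LinearIsometryEquiv.trans_apply, HilbertBasis.repr_self, HilbertBasis.repr_symm_single]

/-- The unitary `e_s ⊗ ζ ↦ e_s ⊗ σ_s ζ`, for a Hilbert basis `e` of `H` and unitaries `σ_s`
of `L`. -/
def tensorTwist (b : HilbertBasis ι ℂ L) (e : HilbertBasis G ℂ H) (σ : G → (L ≃ₗᵢ[ℂ] L)) :
    lp (fun _ : ι => H) 2 ≃ₗᵢ[ℂ] lp (fun _ : ι => H) 2 :=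
  (tensorBasis b e fun _ => b).repr.trans
    (tensorBasis b e fun s => HilbertBasis.ofRepr ((σ s).symm.trans b.repr)).repr.symm

theorem tensorTwist_elemTensor (b : HilbertBasis ι ℂ L) (e : HilbertBasis G ℂ H)
    (σ : G → (L ≃ₗᵢ[ℂ] L)) (s : G) (ζ : L) :
    tensorTwist b e σ (elemTensor b (e s) ζ) = elemTensor b (e s) (σ s ζ) := by
  classical
  have h : ((tensorTwist b e σ).toContinuousLinearEquiv : _ →L[ℂ] _) ∘L elemTensor b (e s) =
      elemTensor b (e s) ∘L ((σ s).toContinuousLinearEquiv : L →L[ℂ] L) := by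
    refine b.clm_ext fun i => ?_
    change tensorTwist b e σ (elemTensor b (e s) (b i)) = elemTensor b (e s) (σ s (b i))
    have h1 := tensorBasis_apply b e (fun _ => b) (s, i)
    have h2 := tensorBasis_apply b e
      (fun s => HilbertBasis.ofRepr ((σ s).symm.trans b.repr)) (s, i)
    have h3 : (HilbertBasis.ofRepr ((σ s).symm.trans b.repr)) i = σ s (b i) := by
      rw [← HilbertBasis.repr_symm_single, ← HilbertBasis.repr_symm_single]
      rfl
    rw [h3] at h2
    rw [← h1, ← h2]
    exact HilbertBasis.trans_symm_apply _ _ _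
  exact congrArg (fun T : L →L[ℂ] lp (fun _ : ι => H) 2 => T ζ) h

end TensorProducts

/-! ### The bimodule of a unitary representation -/

section RepresentationBimodule

variable {ι G L H : Type} [NormedAddCommGroup L] [InnerProductSpace ℂ L] [CompleteSpace L]
  [NormedAddCommGroup H] [InnerProductSpace ℂ H] [CompleteSpace H]

/-- A permutation of a Hilbert basis. -/
def HilbertBasis.permute (e : HilbertBasis G ℂ H) (π : Equiv.Perm G) : HilbertBasis G ℂ H :=
  HilbertBasis.mk (v := fun s => e (π s)) (e.orthonormal.comp _ π.injective) (by
    have h : Set.range (fun s => e (π s)) = Set.range e := π.surjective.range_comp e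
    rw [h, e.dense_span])

theorem HilbertBasis.permute_apply (e : HilbertBasis G ℂ H) (π : Equiv.Perm G) (s : G) :
    e.permute π s = e (π s) := by
  rw [permute, HilbertBasis.coe_mk]

/-- The operator `T` commutes with right translations of the basis `e`, expressed by its matrix
elements. -/
def HilbertBasis.RightInvariant [Group G] (e : HilbertBasis G ℂ H) (T : H →L[ℂ] H) : Prop :=
  ∀ s t u, ⟪e (s * u), T (e (t * u))⟫_ℂ = ⟪e s, T (e t)⟫_ℂ

theorem HilbertBasis.RightInvariant.star [Group G] {e : HilbertBasis G ℂ H} {T : H →L[ℂ] H}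
    (hT : e.RightInvariant T) : e.RightInvariant (star T) := by
  intro s t u
  rw [ContinuousLinearMap.star_eq_adjoint, ContinuousLinearMap.adjoint_inner_right,
    ContinuousLinearMap.adjoint_inner_right, ← inner_conj_symm, hT, inner_conj_symm]

/-- Right invariance passes to the generated von Neumann algebra, since the right translations lie
in the commutant. -/
theorem rightInvariant_of_mem_vonNeumannGenerated [Group G] (e : HilbertBasis G ℂ H)
    {S : Set (H →L[ℂ] H)} (hS : ∀ T ∈ S, e.RightInvariant T) {x : H →L[ℂ] H}
    (hx : x ∈ vonNeumannGenerated S) : e.RightInvariant x := by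
  intro s t u
  let ρ : H ≃ₗᵢ[ℂ] H := e.repr.trans (e.permute (Equiv.mulRight u⁻¹)).repr.symm
  have hρ : ∀ r, ρ (e r) = e (r * u⁻¹) := fun r => by
    rw [HilbertBasis.trans_symm_apply, HilbertBasis.permute_apply]
    rfl
  let R : H →L[ℂ] H := (ρ.toContinuousLinearEquiv : H →L[ℂ] H)
  have hR : ∀ v, R v = ρ v := fun v => rfl
  have hcomm : ∀ T, e.RightInvariant T → T * R = R * T := by
    intro T hT
    refine e.clm_ext_inner e fun p q => ?_
    rw [mul_apply_eq_comp, mul_apply_eq_comp, hR, hR, hρ]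
    have h1 := ρ.inner_map_map (e (q * u)) (T (e p))
    rw [hρ, mul_inv_cancel_right] at h1
    rw [h1, ← hT q (p * u⁻¹) u, inv_mul_cancel_right]
  have hmem : R ∈ StarSubalgebra.centralizer ℂ S := by
    rw [StarSubalgebra.mem_centralizer_iff]
    exact fun T hT => ⟨hcomm T (hS T hT), hcomm _ (hS T hT).star⟩
  have hx' : x ∈ StarSubalgebra.centralizer ℂ
    (StarSubalgebra.centralizer ℂ S : Set (H →L[ℂ] H)) := hx
  rw [StarSubalgebra.mem_centralizer_iff] at hx'
  have h2 : R * x = x * R := (hx' R hmem).1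
  have h3 := congrArg (fun T : H →L[ℂ] H => ⟪e s, T (e (t * u))⟫_ℂ) h2
  simp only [mul_apply_eq_comp, hR, hρ, mul_inv_cancel_right] at h3
  rw [← h3]
  have h4 := ρ.inner_map_map (e (s * u)) (x (e (t * u)))
  rw [hρ, mul_inv_cancel_right] at h4
  exact h4.symm

section ModularConjugation

variable [Group G] (e : HilbertBasis G ℂ H)

/-- The modular conjugation, the antiunitary with `e_s ↦ e_{s⁻¹}`. -/
def modConj : H ≃ₗᵢ⋆[ℂ] H :=
  (e.repr.trans (starₗᵢ ℂ : lp (fun _ : G => ℂ) 2 ≃ₗᵢ⋆[ℂ] lp (fun _ : G => ℂ) 2)).trans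
    (e.permute (Equiv.inv G)).repr.symm

theorem modConj_basis (s : G) : modConj e (e s) = e s⁻¹ := by
  classical
  change (e.permute (Equiv.inv G)).repr.symm (star (e.repr (e s))) = _
  have : star (lp.single 2 s (1 : ℂ) : lp (fun _ : G => ℂ) 2) = lp.single 2 s (1 : ℂ) := by
    ext i
    rw [lp.star_apply]
    by_cases h : i = s
    · subst h
      rw [lp.single_apply_self, star_one]
    · rw [lp.single_apply_ne _ _ _ h, star_zero]
  rw [HilbertBasis.repr_self, this, HilbertBasis.repr_symm_single, HilbertBasis.permute_apply]
  rfl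

theorem inner_modConj_modConj (x y : H) : ⟪modConj e x, modConj e y⟫_ℂ = ⟪y, x⟫_ℂ := by
  change ⟪(e.permute (Equiv.inv G)).repr.symm (star (e.repr x)),
    (e.permute (Equiv.inv G)).repr.symm (star (e.repr y))⟫_ℂ = _
  rw [LinearIsometryEquiv.inner_map_map, ← e.repr.inner_map_map y x, lp.inner_eq_tsum,
    lp.inner_eq_tsum]
  refine tsum_congr fun i => ?_
  rw [lp.star_apply, lp.star_apply, RCLike.inner_apply, RCLike.inner_apply]
  simp [mul_comm]

/-- The modular conjugation as a continuous conjugate linear map. -/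
def modConjCLM : H →L⋆[ℂ] H := ((modConj e).toContinuousLinearEquiv : H →L⋆[ℂ] H)

theorem modConj_modConj (x : H) : modConj e (modConj e x) = x := by
  have h : (modConjCLM e).comp (modConjCLM e) = ContinuousLinearMap.id ℂ H := by
    refine e.clm_ext fun s => ?_
    change modConj e (modConj e (e s)) = e s
    rw [modConj_basis, modConj_basis, inv_inv]
  exact congrArg (fun T : H →L[ℂ] H => T x) h

theorem inner_modConj_right (x y : H) : ⟪x, modConj e y⟫_ℂ = ⟪y, modConj e x⟫_ℂ := by
  have h := inner_modConj_modConj e (modConj e x) y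
  rw [modConj_modConj] at h
  exact h

/-- The right action `T ↦ J T* J` of a `*`-algebra of operators, with `J` the modular
conjugation. -/
def modConjOpposite (A : StarSubalgebra ℂ (H →L[ℂ] H)) : Aᵐᵒᵖ →⋆ₐ[ℂ] (H →L[ℂ] H) where
  toFun T := (modConjCLM e).comp ((star (T.unop : H →L[ℂ] H)).comp (modConjCLM e))
  map_one' := by
    refine ContinuousLinearMap.ext fun x => ?_
    change modConj e ((star (1 : H →L[ℂ] H)) (modConj e x)) = x
    rw [star_one, one_apply_eq_self, modConj_modConj]
  map_mul' S T := by
    refine ContinuousLinearMap.ext fun x => ?_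
    change modConj e ((star ((T.unop : H →L[ℂ] H) * (S.unop : H →L[ℂ] H))) (modConj e x)) =
      modConj e ((star (S.unop : H →L[ℂ] H))
        (modConj e (modConj e ((star (T.unop : H →L[ℂ] H)) (modConj e x)))))
    rw [modConj_modConj, star_mul, mul_apply_eq_comp]
  map_zero' := by
    refine ContinuousLinearMap.ext fun x => ?_
    change modConj e ((star (0 : H →L[ℂ] H)) (modConj e x)) = 0
    rw [star_zero, zero_apply, map_zero]
  map_add' S T := by
    refine ContinuousLinearMap.ext fun x => ?_
    change modConj e ((star ((S.unop : H →L[ℂ] H) + (T.unop : H →L[ℂ] H))) (modConj e x)) =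
      modConj e ((star (S.unop : H →L[ℂ] H)) (modConj e x)) +
        modConj e ((star (T.unop : H →L[ℂ] H)) (modConj e x))
    rw [star_add, add_apply, map_add]
  commutes' c := by
    refine ContinuousLinearMap.ext fun x => ?_
    change modConj e ((star (algebraMap ℂ (H →L[ℂ] H) c)) (modConj e x)) = c • x
    rw [← algebraMap_star_comm, Algebra.algebraMap_eq_smul_one, smul_apply,
      one_apply_eq_self, LinearIsometryEquiv.map_smulₛₗ, modConj_modConj]
    congr 1
    exact Complex.conj_conj c
  map_star' T := by
    refine ContinuousLinearMap.ext fun x => ext_inner_left ℂ fun y => ?_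
    rw [ContinuousLinearMap.star_eq_adjoint
      ((modConjCLM e).comp ((star (T.unop : H →L[ℂ] H)).comp (modConjCLM e))),
      ContinuousLinearMap.adjoint_inner_right]
    change ⟪y, modConj e ((star (star (T.unop : H →L[ℂ] H))) (modConj e x))⟫_ℂ =
      ⟪modConj e ((star (T.unop : H →L[ℂ] H)) (modConj e y)), x⟫_ℂ
    rw [star_star, ← inner_conj_symm (modConj e ((star (T.unop : H →L[ℂ] H)) (modConj e y))),
      inner_modConj_right e x, ContinuousLinearMap.star_eq_adjoint,
      ContinuousLinearMap.adjoint_inner_left, inner_conj_symm, inner_modConj_right e y]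

theorem modConjOpposite_apply (A : StarSubalgebra ℂ (H →L[ℂ] H)) (T : A) (x : H) :
    modConjOpposite e A (MulOpposite.op T) x = modConj e ((star (T : H →L[ℂ] H)) (modConj e x)) :=
  rfl

theorem inner_modConjOpposite (A : StarSubalgebra ℂ (H →L[ℂ] H)) (T : A) (x y : H) :
    ⟪x, modConjOpposite e A (MulOpposite.op T) y⟫_ℂ =
      ⟪modConj e y, (T : H →L[ℂ] H) (modConj e x)⟫_ℂ := by
  rw [modConjOpposite_apply, inner_modConj_right, ContinuousLinearMap.star_eq_adjoint,
    ContinuousLinearMap.adjoint_inner_left]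

/-- The right action agrees with the left action on the vector `e_1`. -/
theorem modConjOpposite_basis_one (A : StarSubalgebra ℂ (H →L[ℂ] H)) (T : A)
    (hT : e.RightInvariant (T : H →L[ℂ] H)) :
    modConjOpposite e A (MulOpposite.op T) (e 1) = (T : H →L[ℂ] H) (e 1) := by
  refine e.ext_inner fun s => ?_
  rw [inner_modConjOpposite, modConj_basis, modConj_basis, inv_one, ← hT 1 s⁻¹ s, one_mul,
    inv_mul_cancel]

end ModularConjugation

end RepresentationBimodule

/-! ### Relative property (T) from rigidity -/

section RigidToRelativeT

section Bimodule

variable {ι G L H : Type} [NormedAddCommGroup L] [InnerProductSpace ℂ L] [CompleteSpace L]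
  [NormedAddCommGroup H] [InnerProductSpace ℂ H] [CompleteSpace H] [Group G]
  (e : HilbertBasis G ℂ H) (b : HilbertBasis ι ℂ L) (σ : G →* (L ≃ₗᵢ[ℂ] L))

/-- The right action on `H ⊗ L` in the bimodule of the representation `σ`. -/
def twistedRight (A : StarSubalgebra ℂ (H →L[ℂ] H)) :
    Aᵐᵒᵖ →⋆ₐ[ℂ] (lp (fun _ : ι => H) 2 →L[ℂ] lp (fun _ : ι => H) 2) :=
  (tensorTwist b e σ).symm.conjStarAlgEquiv.toStarAlgHom.comp
    ((lpAmp ι H).comp (modConjOpposite e A))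

theorem twistedRight_apply (A : StarSubalgebra ℂ (H →L[ℂ] H)) (T : Aᵐᵒᵖ)
    (x : lp (fun _ : ι => H) 2) : twistedRight e b σ A T x =
      (tensorTwist b e σ).symm (lpAmp ι H (modConjOpposite e A T) (tensorTwist b e σ x)) := rfl

theorem inner_twistedRight (A : StarSubalgebra ℂ (H →L[ℂ] H)) (T : Aᵐᵒᵖ)
    (x y : lp (fun _ : ι => H) 2) : ⟪x, twistedRight e b σ A T y⟫_ℂ =
      ⟪tensorTwist b e σ x, lpAmp ι H (modConjOpposite e A T) (tensorTwist b e σ y)⟫_ℂ := by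
  rw [twistedRight_apply, ← (tensorTwist b e σ).inner_map_map,
    LinearIsometryEquiv.apply_symm_apply]

theorem inner_twistedRight_elemTensor (A : StarSubalgebra ℂ (H →L[ℂ] H)) (T : A) (s t : G)
    (ζ ζ' : L) : ⟪elemTensor b (e s) ζ, twistedRight e b σ A (MulOpposite.op T)
      (elemTensor b (e t) ζ')⟫_ℂ =
      ⟪e t⁻¹, (T : H →L[ℂ] H) (e s⁻¹)⟫_ℂ * ⟪σ s ζ, σ t ζ'⟫_ℂ := by
  rw [inner_twistedRight, tensorTwist_elemTensor, tensorTwist_elemTensor, lpAmp_elemTensor,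
    inner_elemTensor, inner_modConjOpposite, modConj_basis, modConj_basis]

/-- The left and the right action commute: both products have the same matrix elements, as sums
over `G` that correspond to each other under `r ↦ t r⁻¹ s`. -/
theorem commute_lpAmp_twistedRight (A : StarSubalgebra ℂ (H →L[ℂ] H))
    (hA : ∀ T ∈ A, e.RightInvariant T) (S : A) (T : Aᵐᵒᵖ) :
    Commute (lpAmp ι H (S : H →L[ℂ] H)) (twistedRight e b σ A T) := by
  refine (tensorBasis b e fun _ => b).clm_ext_inner (tensorBasis b e fun _ => b) ?_
  rintro ⟨t, j⟩ ⟨s, i⟩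
  rw [tensorBasis_apply, tensorBasis_apply]
  change ⟪elemTensor b (e s) (b i), lpAmp ι H (S : H →L[ℂ] H) (twistedRight e b σ A T
    (elemTensor b (e t) (b j)))⟫_ℂ = ⟪elemTensor b (e s) (b i), twistedRight e b σ A T
      (lpAmp ι H (S : H →L[ℂ] H) (elemTensor b (e t) (b j)))⟫_ℂ
  have hST : ∀ p q u, ⟪e (p * u), (S : H →L[ℂ] H) (e (q * u))⟫_ℂ =
    ⟪e p, (S : H →L[ℂ] H) (e q)⟫_ℂ := hA S S.2
  have hTT : ∀ p q u, ⟪e (p * u), (T.unop : H →L[ℂ] H) (e (q * u))⟫_ℂ =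
    ⟪e p, (T.unop : H →L[ℂ] H) (e q)⟫_ℂ := hA _ T.unop.2
  -- expand `S* e_s` in the basis `e` for the first product, and `S e_t` for the second one
  have h1 : HasSum (fun r => ⟪e s, (S : H →L[ℂ] H) (e r)⟫_ℂ *
      (⟪e t⁻¹, (T.unop : H →L[ℂ] H) (e r⁻¹)⟫_ℂ * ⟪σ r (b i), σ t (b j)⟫_ℂ))
      ⟪elemTensor b (e s) (b i), lpAmp ι H (S : H →L[ℂ] H) (twistedRight e b σ A T
        (elemTensor b (e t) (b j)))⟫_ℂ := by
    have h2 : ⟪elemTensor b (e s) (b i), lpAmp ι H (S : H →L[ℂ] H) (twistedRight e b σ A T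
        (elemTensor b (e t) (b j)))⟫_ℂ = ⟪elemTensorLeft b (b i) (star (S : H →L[ℂ] H) (e s)),
          twistedRight e b σ A T (elemTensor b (e t) (b j))⟫_ℂ := by
      rw [elemTensorLeft_apply, ← lpAmp_elemTensor, map_star,
        ContinuousLinearMap.star_eq_adjoint, ContinuousLinearMap.adjoint_inner_left]
    rw [h2]
    have h3 := (elemTensorLeft (ι := ι) b (b i)).hasSum
      (e.hasSum_repr (star (S : H →L[ℂ] H) (e s)))
    have h4 := (innerSL ℂ (twistedRight e b σ A T (elemTensor b (e t) (b j)))).hasSum h3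
    have h5 := Complex.hasSum_conj'.2 h4
    convert h5 using 1
    · funext r
      rw [innerSL_apply_apply, inner_conj_symm, map_smul, inner_smul_left, elemTensorLeft_apply,
        ← inner_twistedRight_elemTensor, e.repr_apply_apply, inner_conj_symm,
        ContinuousLinearMap.star_eq_adjoint, ContinuousLinearMap.adjoint_inner_left]
      rfl
    · rw [innerSL_apply_apply, inner_conj_symm]
  have h2 : HasSum (fun r => ⟪e r, (S : H →L[ℂ] H) (e t)⟫_ℂ *
      (⟪e r⁻¹, (T.unop : H →L[ℂ] H) (e s⁻¹)⟫_ℂ * ⟪σ s (b i), σ r (b j)⟫_ℂ))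
      ⟪elemTensor b (e s) (b i), twistedRight e b σ A T
        (lpAmp ι H (S : H →L[ℂ] H) (elemTensor b (e t) (b j)))⟫_ℂ := by
    rw [lpAmp_elemTensor, ← elemTensorLeft_apply]
    have h3 := (elemTensorLeft (ι := ι) b (b j)).hasSum (e.hasSum_repr ((S : H →L[ℂ] H) (e t)))
    have h4 := ((innerSL ℂ (elemTensor b (e s) (b i))) ∘L (twistedRight e b σ A T)).hasSum h3
    have h5 : ∀ r, ⟪elemTensor b (e s) (b i), twistedRight e b σ A T
        (elemTensor b (e r) (b j))⟫_ℂ =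
          ⟪e r⁻¹, (T.unop : H →L[ℂ] H) (e s⁻¹)⟫_ℂ * ⟪σ s (b i), σ r (b j)⟫_ℂ := fun r =>
      inner_twistedRight_elemTensor e b σ A T.unop s r (b i) (b j)
    simp only [ContinuousLinearMap.comp_apply, innerSL_apply_apply, map_smul, smul_eq_mul,
      elemTensorLeft_apply, e.repr_apply_apply, h5] at h4
    exact h4
  let π : Equiv.Perm G := (Equiv.inv G).trans ((Equiv.mulRight s).trans (Equiv.mulLeft t))
  have hπ : ∀ r, π r = t * (r⁻¹ * s) := fun r => rfl
  refine (π.hasSum_iff.2 h1).unique ?_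
  convert h2 using 1
  funext r
  simp only [Function.comp_apply, hπ]
  have e1 : ⟪e s, (S : H →L[ℂ] H) (e (t * (r⁻¹ * s)))⟫_ℂ = ⟪e r, (S : H →L[ℂ] H) (e t)⟫_ℂ := by
    rw [← hST r t (r⁻¹ * s), mul_inv_cancel_left]
  have e2 : ⟪e t⁻¹, (T.unop : H →L[ℂ] H) (e (t * (r⁻¹ * s))⁻¹)⟫_ℂ =
      ⟪e r⁻¹, (T.unop : H →L[ℂ] H) (e s⁻¹)⟫_ℂ := by
    rw [← hTT r⁻¹ s⁻¹ (r * t⁻¹)]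
    congr 3 <;> group
  have e3 : ⟪σ (t * (r⁻¹ * s)) (b i), σ t (b j)⟫_ℂ = ⟪σ s (b i), σ r (b j)⟫_ℂ := by
    have h3 : σ (t * (r⁻¹ * s)) (b i) = σ (t * r⁻¹) (σ s (b i)) := by
      rw [← mul_assoc, map_mul]
      rfl
    have h4 : σ t (b j) = σ (t * r⁻¹) (σ r (b j)) := by
      rw [← inv_mul_cancel_right t r, map_mul, inv_mul_cancel_right]
      rfl
    rw [h3, h4, LinearIsometryEquiv.inner_map_map]
  rw [e1, e2, e3]

/-- The bimodule `H ⊗ L` of a unitary representation `σ` of `G` on `L`, over a von Neumann algebra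
of right invariant operators: `x (h ⊗ ζ) = x h ⊗ ζ`, while the right action is that of `H`,
conjugated by `e_s ⊗ ζ ↦ e_s ⊗ σ(s) ζ`. -/
def representationBimodule (M : VonNeumannAlgebra H)
    (hM : ∀ T ∈ M, e.RightInvariant T) : HilbertBimodule M (lp (fun _ : ι => H) 2) where
  left := (lpAmp ι H).comp M.toStarSubalgebra.subtype
  right := twistedRight e b σ M.toStarSubalgebra
  commute S T := commute_lpAmp_twistedRight e b σ M.toStarSubalgebra hM S T
  left_normal ξ η := isNormalFunctional_of_hasSum M (lp.summable_norm_sq η)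
    (lp.summable_norm_sq ξ) fun x => lp.hasSum_inner (𝕜 := ℂ) η (lpAmp ι H (x : H →L[ℂ] H) ξ)
  right_normal ξ η := by
    have hn : ∀ ζ : lp (fun _ : ι => H) 2, Summable fun i => ‖modConj e (ζ i)‖ ^ 2 := fun ζ => by
      simpa only [LinearIsometryEquiv.norm_map] using lp.summable_norm_sq ζ
    refine isNormalFunctional_of_hasSum M (hn (tensorTwist b e σ ξ)) (hn (tensorTwist b e σ η))
      fun x => ?_
    rw [inner_twistedRight]
    have h := lp.hasSum_inner (𝕜 := ℂ) (tensorTwist b e σ η)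
      (lpAmp ι H (modConjOpposite e M.toStarSubalgebra (MulOpposite.op x)) (tensorTwist b e σ ξ))
    simpa only [lpAmp_apply, inner_modConjOpposite] using h

end Bimodule

end RigidToRelativeT

/-! ### Relative property (T) from rigidity, for actions with enough characters -/

section RigidIff

/-- Operators of norm at most two that converge to zero on a Hilbert basis converge to zero
strongly. -/
theorem tendsto_of_tendsto_basis {G H K : Type} [NormedAddCommGroup H] [InnerProductSpace ℂ H]
    [NormedAddCommGroup K] [InnerProductSpace ℂ K] (e : HilbertBasis G ℂ H)
    (T : ℕ → H →L[ℂ] K) (hT : ∀ n h, ‖T n h‖ ≤ 2 * ‖h‖)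
    (he : ∀ s, Tendsto (fun n => ‖T n (e s)‖) atTop (𝓝 0)) (h : H) :
    Tendsto (fun n => ‖T n h‖) atTop (𝓝 0) := by
  let S : Submodule ℂ H :=
    { carrier := {h | Tendsto (fun n => ‖T n h‖) atTop (𝓝 0)}
      zero_mem' := by simp
      add_mem' := fun {x y} hx hy => by
        refine squeeze_zero (fun n => norm_nonneg _) (fun n => ?_)
          (by simpa using Tendsto.add hx hy)
        rw [map_add]
        exact norm_add_le _ _
      smul_mem' := fun c x hx => by
        have : Tendsto (fun n => ‖c‖ * ‖T n x‖) atTop (𝓝 0) := by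
          simpa using Tendsto.const_mul ‖c‖ hx
        simpa only [Set.mem_ofPred_eq, map_smul, norm_smul] using this }
  have hle : Submodule.span ℂ (Set.range e) ≤ S := by
    refine Submodule.span_le.2 ?_
    rintro - ⟨s, rfl⟩
    exact he s
  have hdense : h ∈ closure (S : Set H) := by
    have h1 : h ∈ closure (Submodule.span ℂ (Set.range e) : Set H) := by
      rw [← Submodule.topologicalClosure_coe, e.dense_span]
      trivial
    exact closure_mono hle h1
  rw [Metric.tendsto_atTop']
  intro ε hε
  obtain ⟨g, hg, hgh⟩ := Metric.mem_closure_iff.1 hdense (ε / 4) (by positivity)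
  obtain ⟨N, hN⟩ := Metric.tendsto_atTop'.1 (show Tendsto (fun n => ‖T n g‖) atTop (𝓝 0) from hg)
    (ε / 2) (by positivity)
  refine ⟨N, fun n hn => ?_⟩
  have h1 := hN n hn
  rw [Real.dist_0_eq_abs, abs_of_nonneg (norm_nonneg _)] at h1 ⊢
  have h2 := hT n (h - g)
  rw [dist_eq_norm] at hgh
  have h3 : ‖T n h‖ ≤ ‖T n (h - g)‖ + ‖T n g‖ := by
    have := norm_add_le (T n (h - g)) (T n g)
    rwa [← map_add, sub_add_cancel] at this
  linarith

variable {Γ X D : Type} [Group Γ] [Countable Γ] [MeasurableSpace Γ] [MeasurableSingletonClass Γ]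
  [MetricSpace X] [CompactSpace X] [MeasurableSpace X] [BorelSpace X] [MulAction Γ X]
  {μ : Measure X} [IsProbabilityMeasure μ] [CommGroup D] {φ : Γ →* MulAut D}
  [MeasurableConstSMul Γ X] [SMulInvariantMeasure Γ X μ]

namespace CharacterSystem

variable (χ : CharacterSystem φ μ)

theorem rightInvariant_multiplicationOp (a : Lp ℂ ∞ μ) :
    (χ.fiberBasis (Γ := Γ)).RightInvariant (multiplicationOp Γ a) := by
  intro s t u
  simp only [fiberBasis_apply, inner_fiberVec]
  have key : ∀ s t : D ⋊[φ] Γ, ∫ x, (starRingEnd ℂ) (χ.charC s.left x) *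
      multiplicationOp Γ a (χ.fiberVec t) (x, s.right) ∂μ =
        ∫ x, (starRingEnd ℂ) (χ.charC s.left x) * (a x *
          Set.indicator {p : X × Γ | p.2 = t.right} (fun p => χ.charC t.left p.1)
          (x, s.right)) ∂μ := by
    intro s t
    refine integral_congr_ae ?_
    filter_upwards [(ae_prod_count_iff μ).1 (multiplicationOp_apply Γ a (χ.fiberVec t)) s.right,
      χ.fiberVec_ae t s.right] with x h1 h2
    rw [h1, h2]
  rw [key, key]
  refine integral_congr_ae (Eventually.of_forall fun x => ?_)
  by_cases h : s.right = t.right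
  · have h' : (s * u).right = (t * u).right := by
      rw [SemidirectProduct.mul_right, SemidirectProduct.mul_right, h]
    have h1 : (starRingEnd ℂ) (χ.charC (φ t.right u.left) x) *
        χ.charC (φ t.right u.left) x = 1 := by
      rw [← χ.charC_inv, ← χ.charC_mul, inv_mul_cancel, χ.charC_one]
    simp only
    rw [Set.indicator_of_mem (show (x, (s * u).right) ∈ {p : X × Γ | p.2 = (t * u).right} from h'),
      Set.indicator_of_mem (show (x, s.right) ∈ {p : X × Γ | p.2 = t.right} from h),
      SemidirectProduct.mul_left, SemidirectProduct.mul_left, χ.charC_mul, χ.charC_mul, h, map_mul]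
    linear_combination ((starRingEnd ℂ) (χ.charC s.left x) * a x * χ.charC t.left x) * h1
  · have h' : (s * u).right ≠ (t * u).right := by
      rw [SemidirectProduct.mul_right, SemidirectProduct.mul_right]
      exact fun h0 => h (mul_right_cancel h0)
    simp only
    rw [Set.indicator_of_notMem
        (show (x, (s * u).right) ∉ {p : X × Γ | p.2 = (t * u).right} from h'),
      Set.indicator_of_notMem (show (x, s.right) ∉ {p : X × Γ | p.2 = t.right} from h)]
    simp only [mul_zero]

theorem unitaryOp_inr (g : Γ) : χ.unitaryOp (SemidirectProduct.inr g) = translationOp X μ g := by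
  have h : multiplicationOp Γ (χ.charLp 1) = 1 := by
    have h1 := χ.unitaryOp_inl 1
    rwa [map_one, χ.unitaryOp_one, eq_comm] at h1
  rw [unitaryOp, SemidirectProduct.left_inr, h, one_mul, SemidirectProduct.right_inr]

theorem rightInvariant_unitaryOp (r : D ⋊[φ] Γ) :
    (χ.fiberBasis (Γ := Γ)).RightInvariant (χ.unitaryOp r) := by
  classical
  intro s t u
  rw [unitaryOp_basis, unitaryOp_basis]
  have h := orthonormal_iff_ite.1 (χ.fiberBasis (Γ := Γ)).orthonormal
  rw [h, h, ← mul_assoc]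
  simp only [mul_left_inj]

theorem rightInvariant_of_mem_crossedProduct
    {T : CrossedSpace Γ X μ →L[ℂ] CrossedSpace Γ X μ} (hT : T ∈ crossedProduct Γ X μ) :
    (χ.fiberBasis (Γ := Γ)).RightInvariant T := by
  refine rightInvariant_of_mem_vonNeumannGenerated χ.fiberBasis ?_ hT
  rintro - (⟨a, rfl⟩ | ⟨g, rfl⟩)
  · exact χ.rightInvariant_multiplicationOp a
  · rw [← χ.unitaryOp_inr]
    exact χ.rightInvariant_unitaryOp _

/-- For a representation `σ` with almost invariant unit vectors `ξₙ`, the vectors `e_1 ⊗ ξₙ` of its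
bimodule are tracial and almost central. By rigidity they are close to central vectors for
`L^∞(X)`, so that their commutators with the characters `χ_d` are small uniformly in `d`. The norms
of these commutators are `‖σ(d) ξₙ - ξₙ‖`. -/
theorem hasRelativeT_of_isRigidAction (χ : CharacterSystem φ μ) (hR : IsRigidAction Γ X μ) :
    HasRelativeT φ := by
  intro L _ _ _ σ ξ hξ hfix
  obtain ⟨ι, b, -⟩ := exists_hilbertBasis ℂ L
  let e := χ.fiberBasis (Γ := Γ)
  let B := representationBimodule e b σ (crossedProduct Γ X μ)
    fun T hT => χ.rightInvariant_of_mem_crossedProduct hT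
  let W := tensorTwist b e σ
  have hvac : vacuum Γ X μ = e 1 := by
    rw [χ.vacuum_eq]
    exact (χ.fiberBasis_apply 1).symm
  -- the vectors `e_1 ⊗ ξₙ`, which the twist `W` fixes
  let κ : ℕ → lp (fun _ : ι => CrossedSpace Γ X μ) 2 := fun n => elemTensor b (e 1) (ξ n)
  have hW : ∀ s ζ, W (elemTensor b (e s) ζ) = elemTensor b (e s) (σ s ζ) :=
    tensorTwist_elemTensor b e σ
  have hWκ : ∀ n, W (κ n) = κ n := fun n => by
    change W (elemTensor b (e 1) (ξ n)) = _
    have h1 : σ 1 (ξ n) = ξ n := by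
      rw [map_one σ]
      rfl
    rw [hW, h1]
  have hleft : ∀ (x : (crossedProduct Γ X μ).toStarSubalgebra) n, B.left x (κ n) =
      elemTensor b ((x : CrossedSpace Γ X μ →L[ℂ] CrossedSpace Γ X μ) (e 1)) (ξ n) :=
    fun x n => lpAmp_elemTensor b _ _ _
  have hright : ∀ (x : (crossedProduct Γ X μ).toStarSubalgebra) n,
      B.right (MulOpposite.op x) (κ n) = W.symm
        (elemTensor b ((x : CrossedSpace Γ X μ →L[ℂ] CrossedSpace Γ X μ) (e 1)) (ξ n)) := by
    intro x n
    change W.symm (lpAmp ι (CrossedSpace Γ X μ) (modConjOpposite e _ (MulOpposite.op x))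
      (W (κ n))) = _
    rw [hWκ, lpAmp_elemTensor,
      modConjOpposite_basis_one e _ x (χ.rightInvariant_of_mem_crossedProduct x.2)]
  have hcomm : ∀ (x : (crossedProduct Γ X μ).toStarSubalgebra) n, ‖B.commutator x (κ n)‖ =
      ‖W (elemTensor b ((x : CrossedSpace Γ X μ →L[ℂ] CrossedSpace Γ X μ) (e 1)) (ξ n)) -
        elemTensor b ((x : CrossedSpace Γ X μ →L[ℂ] CrossedSpace Γ X μ) (e 1)) (ξ n)‖ := by
    intro x n
    change ‖B.left x (κ n) - B.right (MulOpposite.op x) (κ n)‖ = _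
    rw [hleft, hright, ← W.norm_map, map_sub, LinearIsometryEquiv.apply_symm_apply]
  have htr : ∀ n, B.IsTracial (crossedTrace Γ X μ) (κ n) := by
    intro n x
    have h1 : ⟪ξ n, ξ n⟫_ℂ = 1 := by
      rw [inner_self_eq_norm_sq_to_K, hξ n]
      simp
    constructor
    · rw [hleft, inner_elemTensor, h1, mul_one, crossedTrace, hvac]
    · rw [hright, ← W.inner_map_map, LinearIsometryEquiv.apply_symm_apply, hWκ, inner_elemTensor,
        h1, mul_one, crossedTrace, hvac]
  have hcen : B.IsAlmostCentral κ := by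
    intro x
    simp only [hcomm]
    -- by density it is enough to take for `x e_1` the vectors of the basis
    let T : ℕ → CrossedSpace Γ X μ →L[ℂ] lp (fun _ : ι => CrossedSpace Γ X μ) 2 := fun n =>
      (W.toContinuousLinearEquiv : _ →L[ℂ] _) ∘L elemTensorLeft b (ξ n) - elemTensorLeft b (ξ n)
    have hTe : ∀ n h, T n h = W (elemTensor b h (ξ n)) - elemTensor b h (ξ n) := fun n h => rfl
    have := tendsto_of_tendsto_basis e T (fun n h => by
      rw [hTe]
      refine (norm_sub_le _ _).trans ?_
      rw [W.norm_map, norm_elemTensor, hξ n, mul_one, two_mul]) (fun s => by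
      simp only [hTe, hW, ← map_sub, norm_elemTensor, e.orthonormal.1 s, one_mul]
      exact almostFixedOn_singleton_iff.1 (hfix s))
    exact this _
  have hlim := hR _ B κ htr hcen
  intro ε hε
  rw [Metric.tendsto_atTop'] at hlim
  obtain ⟨N, hN⟩ := hlim (ε / 2) (half_pos hε)
  filter_upwards [eventually_gt_atTop N] with n hn
  have h1 := hN n hn
  rw [Real.dist_0_eq_abs, abs_of_nonneg (norm_nonneg _)] at h1
  rintro - ⟨d, rfl⟩
  let P := (B.central (crossedBase Γ X μ)).starProjection (κ n)
  have hP : P ∈ B.central (crossedBase Γ X μ) := Submodule.starProjection_apply_mem _ _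
  let u := χ.unitaries (SemidirectProduct.inl d : D ⋊[φ] Γ)
  have hu : (u : (crossedProduct Γ X μ).toStarSubalgebra) ∈ crossedBase Γ X μ :=
    ⟨χ.charLp d, (χ.unitaryOp_inl d).symm⟩
  have h2 : ‖B.commutator u (κ n)‖ = ‖σ (SemidirectProduct.inl d) (ξ n) - ξ n‖ := by
    rw [hcomm]
    have h3 : ((u : (crossedProduct Γ X μ).toStarSubalgebra) :
        CrossedSpace Γ X μ →L[ℂ] CrossedSpace Γ X μ) (e 1) = e (SemidirectProduct.inl d) := by
      change χ.unitaryOp _ (χ.fiberBasis 1) = _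
      rw [unitaryOp_basis, mul_one]
    rw [h3, hW, ← map_sub, norm_elemTensor, e.orthonormal.1, one_mul]
  have h3 : B.commutator u (κ n) = B.left u (κ n - P) - B.right (MulOpposite.op ↑u) (κ n - P) := by
    change B.left u (κ n) - B.right (MulOpposite.op ↑u) (κ n) = _
    rw [map_sub, map_sub, hP u hu]
    abel
  rw [← h2, h3]
  refine (norm_sub_le _ _).trans ?_
  rw [ContinuousLinearMap.norm_map_of_mem_unitary (B.left_mem_unitary u.2),
    ContinuousLinearMap.norm_map_of_mem_unitary (B.right_mem_unitary u.2)]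
  linarith

end CharacterSystem

end RigidIff

/-! ### Freeness and ergodicity in terms of characters -/

section FreeErgodic

variable {Γ X D : Type} [Group Γ] [MetricSpace X] [CompactSpace X] [MeasurableSpace X]
  [BorelSpace X] [MulAction Γ X] {μ : Measure X} [IsProbabilityMeasure μ] [CommGroup D]
  {φ : Γ →* MulAut D}

namespace CharacterSystem

variable (χ : CharacterSystem φ μ)

/-- Bessel's inequality for the Fourier coefficients of a set: a value taken by infinitely many of
them is zero. -/
theorem eq_zero_of_setIntegral_charC_eq {E : Set X} (hE : MeasurableSet E) {S : Set D}
    (hS : S.Infinite) {c : ℂ} (hc : ∀ d ∈ S, ∫ x in E, χ.charC d x ∂μ = c) : c = 0 := by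
  classical
  have hmem : ∀ d, MemLp (χ.charC d) 2 μ := fun d =>
    MemLp.of_bound (χ.charC d).continuous.aestronglyMeasurable 1
      (Eventually.of_forall fun x => (χ.norm_charC d x).le)
  let v : D → Lp ℂ 2 μ := fun d => (hmem d).toLp
  have hv : Orthonormal ℂ v := by
    rw [orthonormal_iff_ite]
    intro d d'
    rw [← χ.integral_conj_charC_mul d d', L2.inner_def]
    refine integral_congr_ae ?_
    filter_upwards [(hmem d).coeFn_toLp, (hmem d').coeFn_toLp] with x h1 h2
    simp only [v]
    rw [h1, h2, RCLike.inner_apply, mul_comm]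
  let f : Lp ℂ 2 μ := indicatorConstLp 2 hE (measure_ne_top μ E) (1 : ℂ)
  have hf : ∀ d ∈ S, ‖⟪v d, f⟫_ℂ‖ ^ 2 = ‖c‖ ^ 2 := by
    intro d hd
    have h1 : ⟪f, v d⟫_ℂ = ∫ x in E, χ.charC d x ∂μ := by
      rw [L2.inner_indicatorConstLp_one]
      refine setIntegral_congr_ae hE ?_
      filter_upwards [(hmem d).coeFn_toLp] with x hx _
      exact hx
    rw [norm_inner_symm, h1, hc d hd]
  have hlim := (hv.inner_products_summable f).tendsto_cofinite_zero
  by_contra hne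
  have hpos : 0 < ‖c‖ ^ 2 := by positivity
  have h1 := hlim.eventually_lt_const hpos
  rw [Filter.eventually_cofinite] at h1
  refine hS (h1.subset fun d hd => ?_)
  rw [Set.mem_ofPred_eq, hf d hd]
  exact lt_irrefl _

/-- The kernel of a character of infinite order is a null set. -/
theorem measure_char_eq_one {d : D} (hd : ¬ IsOfFinOrder d) : μ {x | χ.char d x = 1} = 0 := by
  have hE : MeasurableSet {x | χ.char d x = 1} :=
    (isClosed_eq (χ.char d).continuous continuous_const).measurableSet
  have h := χ.eq_zero_of_setIntegral_charC_eq hE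
    (S := Set.range fun m : ℕ => d ^ m)
    (Set.infinite_range_of_injective (injective_pow_iff_not_isOfFinOrder.2 hd))
    (c := (μ.real {x | χ.char d x = 1} : ℂ)) (by
      rintro - ⟨m, rfl⟩
      have : ∫ x in {x | χ.char d x = 1}, χ.charC (d ^ m) x ∂μ =
          ∫ x in {x | χ.char d x = 1}, (1 : ℂ) ∂μ := by
        refine setIntegral_congr_fun hE fun x hx => ?_
        have hx' : χ.char d x = 1 := hx
        simp [charC_apply, hx']
      rw [this, setIntegral_const]
      simp)
  rw [Complex.ofReal_eq_zero] at h
  exact (measureReal_eq_zero_iff).1 h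

/-- Points fixed by `g` lie in the kernels of the characters `φ(g) d · d⁻¹`. -/
theorem isEssentiallyFree (χ : CharacterSystem φ μ)
    (h : ∀ g : Γ, g ≠ 1 → ∃ d, ¬ IsOfFinOrder (φ g d * d⁻¹)) :
    IsEssentiallyFree Γ X μ := by
  intro g hg
  obtain ⟨d, hd⟩ := h g hg
  refine measure_mono_null (fun x hx => ?_) (χ.measure_char_eq_one hd)
  have hx' : g⁻¹ • x = x := by
    rw [inv_smul_eq_iff]
    exact (show g • x = x from hx).symm
  change χ.char (φ g d * d⁻¹) x = 1
  rw [map_mul, ContinuousMap.mul_apply, χ.char_smul, hx', ← ContinuousMap.mul_apply, ← map_mul,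
    mul_inv_cancel, map_one]
  rfl

/-- The action is ergodic if all nontrivial orbits in the dual group are infinite, since the
Fourier coefficients of an invariant set are constant along orbits. -/
theorem ergodicSMul (χ : CharacterSystem φ μ) [MeasurableConstSMul Γ X]
    [SMulInvariantMeasure Γ X μ]
    (h : ∀ d : D, d ≠ 1 → (Set.range fun g => φ g d).Infinite) : ErgodicSMul Γ X μ := by
  refine ⟨fun {E} hE hinv => ?_⟩
  have hconst : ∀ d g, ∫ x in E, χ.charC (φ g d) x ∂μ = ∫ x in E, χ.charC d x ∂μ := by
    intro d g
    simp only [χ.charC_smul]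
    rw [← (measurePreserving_smul g⁻¹ μ).setIntegral_preimage_emb
      (MeasurableEquiv.smul g⁻¹).measurableEmbedding (χ.charC d) E]
    exact setIntegral_congr_set (hinv g⁻¹).symm
  have hzero : ∀ d, d ≠ 1 → ∫ x in E, χ.charC d x ∂μ = 0 := fun d hd =>
    χ.eq_zero_of_setIntegral_charC_eq hE (h d hd) (by
      rintro - ⟨g, rfl⟩
      exact hconst d g)
  let m : ℂ := (μ.real E : ℂ)
  have hint1 : Integrable (E.indicator fun _ => (1 : ℂ)) μ :=
    (integrable_const 1).indicator hE
  have hint : Integrable (fun x => E.indicator (fun _ => (1 : ℂ)) x - m) μ :=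
    hint1.sub (integrable_const _)
  -- the indicator function of `E` has the Fourier coefficients of the constant `μ(E)`
  have hw := χ.ae_eq_zero_of_integral_charC_mul hint (fun d => by
    have h1 : ∀ x, χ.charC d x * (E.indicator (fun _ => (1 : ℂ)) x - m) =
        E.indicator (χ.charC d) x - χ.charC d x * m := fun x => by
      by_cases hx : x ∈ E
      · rw [Set.indicator_of_mem hx, Set.indicator_of_mem hx]
        ring
      · rw [Set.indicator_of_notMem hx, Set.indicator_of_notMem hx]
        ring
    have hi : Integrable (χ.charC d) μ :=
      (integrable_const (1 : ℂ)).mono (χ.charC d).continuous.aestronglyMeasurable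
        (Eventually.of_forall fun x => by rw [χ.norm_charC, norm_one])
    simp only [h1]
    rw [integral_sub (hi.indicator hE) (hi.mul_const m), integral_indicator hE,
      integral_mul_const]
    by_cases hd : d = 1
    · subst hd
      simp [χ.charC_one, m]
    · rw [hzero d hd, χ.integral_charC hd, zero_mul, sub_zero])
  rw [Filter.eventuallyConst_set]
  by_cases hm : m = 0
  · right
    filter_upwards [hw] with x hx hxE
    rw [Set.indicator_of_mem hxE, hm] at hx
    simp at hx
  · left
    filter_upwards [hw] with x hx
    by_contra hxE
    rw [Set.indicator_of_notMem hxE] at hx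
    simp at hx
    exact hm hx

end CharacterSystem

theorem IsEssentiallyFree.prod {Γ X Y : Type} [Group Γ] [MulAction Γ X] [MulAction Γ Y]
    [MeasurableSpace X] [MeasurableSpace Y] {μ : Measure X} {ν : Measure Y} [SFinite ν]
    (h : IsEssentiallyFree Γ Y ν) : IsEssentiallyFree Γ (X × Y) (μ.prod ν) := by
  intro g hg
  refine measure_mono_null (t := Set.univ ×ˢ {y | g • y = y}) (fun p hp => ?_) ?_
  · exact ⟨trivial, congrArg Prod.snd (show g • p = p from hp)⟩
  · rw [Measure.prod_prod, h g hg, mul_zero]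

end FreeErgodic

/-! ### Characters of tori -/

section TorusCharacters

variable {ι : Type} [Fintype ι] [DecidableEq ι]

theorem Torus.pairing_add (θ : Torus ι) (x y : ι → ℤ) :
    Torus.pairing θ (x + y) = Torus.pairing θ x + Torus.pairing θ y := by
  simp only [Torus.pairing, Pi.add_apply, add_smul, Finset.sum_add_distrib]

theorem Torus.add_pairing (θ θ' : Torus ι) (x : ι → ℤ) :
    Torus.pairing (θ + θ') x = Torus.pairing θ x + Torus.pairing θ' x := by
  simp only [Torus.pairing, Pi.add_apply, smul_add, Finset.sum_add_distrib]

theorem Torus.pairing_single (θ : Torus ι) (j : ι) : Torus.pairing θ (Pi.single j 1) = θ j := by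
  rw [Torus.pairing, Finset.sum_eq_single j]
  · simp
  · intro i _ hi
    simp [Pi.single_eq_of_ne hi]
  · simp

theorem Torus.continuous_pairing (x : ι → ℤ) : Continuous fun θ : Torus ι => Torus.pairing θ x :=
  continuous_finsetSum _ fun i _ => (continuous_apply i).zsmul _

/-- The characters of the torus `𝕋^ι`, indexed by `ℤ^ι`. -/
def torusChar (ι : Type) [Fintype ι] [DecidableEq ι] : MulLattice ι →* C(Torus ι, Circle) where
  toFun d := ⟨fun θ => AddCircle.toCircle (Torus.pairing θ d.toAdd),
    AddCircle.continuous_toCircle.comp (Torus.continuous_pairing _)⟩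
  map_one' := by
    ext θ
    simp [Torus.pairing]
  map_mul' d d' := by
    refine ContinuousMap.ext fun θ => ?_
    change AddCircle.toCircle (Torus.pairing θ (d.toAdd + d'.toAdd)) = _
    rw [Torus.pairing_add, AddCircle.toCircle_add]
    rfl

theorem torusChar_apply (d : MulLattice ι) (θ : Torus ι) :
    torusChar ι d θ = AddCircle.toCircle (Torus.pairing θ d.toAdd) := rfl

theorem integral_torusChar {d : MulLattice ι} (hd : d ≠ 1) :
    ∫ θ : Torus ι, (torusChar ι d θ : ℂ) = 0 := by
  obtain ⟨j, hj⟩ : ∃ j, d.toAdd j ≠ 0 := by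
    by_contra! h
    exact hd (Multiplicative.toAdd.injective (funext h))
  -- translation by a point at which the character takes the value `-1`
  let θ₀ : Torus ι := Pi.single j ((1 / (2 * d.toAdd j : ℝ) : ℝ) : UnitAddCircle)
  have h0 : Torus.pairing θ₀ d.toAdd = ((1 / 2 : ℝ) : UnitAddCircle) := by
    rw [Torus.pairing, Finset.sum_eq_single j]
    · simp only [θ₀, Pi.single_eq_same]
      rw [← AddCircle.coe_zsmul, zsmul_eq_mul]
      congr 1
      have : (d.toAdd j : ℝ) ≠ 0 := by exact_mod_cast hj
      field_simp
    · intro i _ hi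
      simp [θ₀, Pi.single_eq_of_ne hi]
    · simp
  have h1 : (torusChar ι d θ₀ : ℂ) ≠ 1 := by
    intro h
    have h2 : torusChar ι d θ₀ = 1 := Circle.ext (by simpa using h)
    rw [torusChar_apply, h0, ← AddCircle.toCircle_zero] at h2
    have h3 := AddCircle.injective_toCircle one_ne_zero h2
    rw [AddCircle.coe_eq_zero_iff] at h3
    obtain ⟨n, hn⟩ := h3
    rw [zsmul_eq_mul, mul_one] at hn
    have h4 : (2 * n : ℤ) = 1 := by
      have : (2 * n : ℝ) = 1 := by rw [hn]; norm_num
      exact_mod_cast this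
    omega
  have h2 : ∫ θ : Torus ι, (torusChar ι d θ : ℂ) =
      (∫ θ : Torus ι, (torusChar ι d θ : ℂ)) * torusChar ι d θ₀ := by
    rw [← integral_mul_const, ← integral_add_right_eq_self (μ := (volume : Measure (Torus ι)))
      (fun θ => (torusChar ι d θ : ℂ)) θ₀]
    refine integral_congr_ae (Eventually.of_forall fun θ => ?_)
    simp only [torusChar_apply, Torus.add_pairing, AddCircle.toCircle_add, Circle.coe_mul]
  have h3 : (∫ θ : Torus ι, (torusChar ι d θ : ℂ)) * (torusChar ι d θ₀ - 1) = 0 := by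
    rw [mul_sub, ← h2, mul_one, sub_self]
  exact (mul_eq_zero.1 h3).resolve_right (sub_ne_zero.2 h1)

/-- The characters of the torus, for a group that acts through a homomorphism to `SL(ι, ℤ)`. -/
def torusSystem {Γ : Type} [Group Γ] [MulAction Γ (Torus ι)] (f : Γ →* SLZ ι)
    (hf : ∀ g (θ : Torus ι), g • θ = f g • θ) :
    CharacterSystem ((latticeAut ι).comp f) (volume : Measure (Torus ι)) where
  char := torusChar ι
  integral_char d hd := integral_torusChar hd
  separates θ θ' h := by
    funext j
    have h1 := h (latticeBasis j)
    rw [torusChar_apply, torusChar_apply] at h1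
    have h2 := AddCircle.injective_toCircle one_ne_zero h1
    simpa only [latticeBasis, toAdd_ofAdd, Torus.pairing_single] using h2
  char_smul g d θ := by
    rw [hf, torusChar_apply, torusChar_apply, Torus.pairing_smul, MonoidHom.comp_apply,
      latticeAut_apply, toAdd_ofAdd, map_inv, inv_inv]

/-- The characters of a product. -/
def CharacterSystem.prod {Γ X Y D E : Type} [Group Γ] [CommGroup D] [CommGroup E]
    {φ : Γ →* MulAut D} {ψ : Γ →* MulAut E} [TopologicalSpace X] [MeasurableSpace X]
    [TopologicalSpace Y] [MeasurableSpace Y] [MulAction Γ X] [MulAction Γ Y] {μ : Measure X}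
    {ν : Measure Y} [IsProbabilityMeasure μ] [IsProbabilityMeasure ν]
    (χ : CharacterSystem φ μ) (ω : CharacterSystem ψ ν) :
    CharacterSystem (MulAut.prodDiag φ ψ) (μ.prod ν) where
  char :=
    { toFun := fun d => ⟨fun p => χ.char d.1 p.1 * ω.char d.2 p.2, by fun_prop⟩
      map_one' := by
        ext p
        simp
      map_mul' := fun d e => by
        refine ContinuousMap.ext fun p => ?_
        change χ.char (d.1 * e.1) p.1 * ω.char (d.2 * e.2) p.2 = χ.char d.1 p.1 * ω.char d.2 p.2 *
          (χ.char e.1 p.1 * ω.char e.2 p.2)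
        rw [map_mul, map_mul, ContinuousMap.mul_apply, ContinuousMap.mul_apply]
        exact mul_mul_mul_comm _ _ _ _ }
  integral_char d hd := by
    have h1 : ∫ p, ((χ.char d.1 p.1 * ω.char d.2 p.2 : Circle) : ℂ) ∂μ.prod ν =
        (∫ x, (χ.char d.1 x : ℂ) ∂μ) * ∫ y, (ω.char d.2 y : ℂ) ∂ν := by
      rw [← integral_prod_mul]
      rfl
    refine h1.trans ?_
    by_cases h : d.1 = 1
    · rw [ω.integral_char d.2 fun h' => hd (Prod.ext h h'), mul_zero]
    · rw [χ.integral_char d.1 h, zero_mul]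
  separates p q h := by
    refine Prod.ext (χ.separates _ _ fun d => ?_) (ω.separates _ _ fun d => ?_)
    · have h1 : χ.char d p.1 * ω.char 1 p.2 = χ.char d q.1 * ω.char 1 q.2 := h (d, 1)
      simpa using h1
    · have h1 : χ.char 1 p.1 * ω.char d p.2 = χ.char 1 q.1 * ω.char d q.2 := h (1, d)
      simpa using h1
  char_smul g d p := by
    change χ.char (φ g d.1) p.1 * ω.char (ψ g d.2) p.2 =
      χ.char d.1 (g⁻¹ • p.1) * ω.char d.2 (g⁻¹ • p.2)
    rw [χ.char_smul, ω.char_smul]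

theorem not_isOfFinOrder_mulLattice {d : MulLattice ι} (hd : d ≠ 1) : ¬ IsOfFinOrder d := by
  rw [isOfFinOrder_iff_pow_eq_one]
  rintro ⟨m, hm, h⟩
  obtain ⟨j, hj⟩ : ∃ j, d.toAdd j ≠ 0 := by
    by_contra! h
    exact hd (Multiplicative.toAdd.injective (funext h))
  have h1 : (m • d.toAdd) j = 0 := congrFun (congrArg Multiplicative.toAdd h) j
  rw [Pi.smul_apply, smul_eq_zero] at h1
  exact h1.elim hm.ne' hj

end TorusCharacters

/-! ### The actions of the block group -/

section BlockActions

variable {k : ℕ} (n : ℕ) (Λ : Subgroup (SLZ (Fin k)))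

/-- The dual description of the action of `Γ` on the dual of `H`. -/
def blockSystem : CharacterSystem (blockAut n Λ) (volume : Measure (Torus (Fin k ⊕ Fin n))) :=
  torusSystem (blockGroup n Λ).subtype fun _ _ => rfl

/-- The dual description of the action of `Λ` on `𝕋^k`. -/
def baseSystem : CharacterSystem ((latticeAut (Fin k)).comp Λ.subtype)
    (volume : Measure (Torus (Fin k))) :=
  torusSystem Λ.subtype fun _ _ => rfl

/-- The dual description of the action of `Γ` on `𝕋^k`. -/
def quotientSystem : CharacterSystem ((latticeAut (Fin k)).comp
    (Λ.subtype.comp (blockProjection n Λ))) (volume : Measure (Torus (Fin k))) :=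
  torusSystem (Λ.subtype.comp (blockProjection n Λ)) fun _ _ => rfl

/-- The block diagonal matrix `(A, 0; 0, 1)`. -/
def blockDiagonal (A : Λ) : blockGroup n Λ :=
  ⟨⟨Matrix.fromBlocks A.1.1 0 0 1, by
    rw [Matrix.det_fromBlocks_zero₂₁, Matrix.det_one, A.1.2, one_mul]⟩, A.1, A.2, 0, 1, rfl⟩

theorem blockProjection_blockDiagonal (A : Λ) : blockProjection n Λ (blockDiagonal n Λ A) = A := by
  apply Subtype.ext
  apply Subtype.ext
  exact Matrix.toBlocks_fromBlocks₁₁ _ _ _ _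

theorem blockProjection_blockUnipotent (B : Matrix (Fin k) (Fin n) ℤ) (D : SLZ (Fin n)) :
    blockProjection n Λ (blockUnipotent n Λ B D) = 1 := by
  apply Subtype.ext
  apply Subtype.ext
  exact Matrix.toBlocks_fromBlocks₁₁ _ _ _ _

theorem blockAut_apply (g : blockGroup n Λ) (d : MulLattice (Fin k ⊕ Fin n)) :
    blockAut n Λ g d = Multiplicative.ofAdd (g.1.1.mulVec d.toAdd) := rfl

variable {n Λ}

theorem infinite_range_base (hΛ : ∀ x : Fin k → ℤ, x ≠ 0 → {y | ∃ A ∈ Λ, y = A.1.mulVec x}.Infinite)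
    {d : MulLattice (Fin k)} (hd : d ≠ 1) : (Set.range fun g : blockGroup n Λ =>
      ((latticeAut (Fin k)).comp (Λ.subtype.comp (blockProjection n Λ))) g d).Infinite := by
  refine Set.Infinite.of_image Multiplicative.toAdd
    ((hΛ d.toAdd fun h => hd (Multiplicative.toAdd.injective h)).mono ?_)
  rintro - ⟨A, hA, rfl⟩
  refine ⟨_, ⟨blockDiagonal n Λ ⟨A, hA⟩, rfl⟩, ?_⟩
  simp only [MonoidHom.comp_apply, blockProjection_blockDiagonal]
  rfl

theorem infinite_range_block (hn : 2 ≤ n)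
    (hΛ : ∀ x : Fin k → ℤ, x ≠ 0 → {y | ∃ A ∈ Λ, y = A.1.mulVec x}.Infinite)
    {d : MulLattice (Fin k ⊕ Fin n)} (hd : d ≠ 1) :
    (Set.range fun g => blockAut n Λ g d).Infinite := by
  -- a vector of `ℤ^n` is moved by transvections, and any other one by the copy of `Λ` in `Γ`
  by_cases ha : d.toAdd ∘ Sum.inl = 0
  · obtain ⟨j, hj⟩ : ∃ j : Fin n, d.toAdd (Sum.inr j) ≠ 0 := by
      by_contra! h
      refine hd (Multiplicative.toAdd.injective (funext fun i => ?_))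
      cases i with
      | inl i => exact congrFun ha i
      | inr i => exact h i
    have : Nontrivial (Fin n) := Fin.nontrivial_iff_two_le.2 hn
    obtain ⟨i, hij⟩ := exists_ne j
    let D : ℤ → SLZ (Fin n) := fun m =>
      ⟨Matrix.transvection i j m, Matrix.det_transvection_of_ne i j hij m⟩
    have hinj : Function.Injective fun m : ℤ => blockAut n Λ (blockUnipotent n Λ 0 (D m)) d := by
      have hval : ∀ m, (blockAut n Λ (blockUnipotent n Λ 0 (D m)) d).toAdd (Sum.inr i) =
          d.toAdd (Sum.inr i) + m * d.toAdd (Sum.inr j) := by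
        intro m
        rw [blockAut_apply, toAdd_ofAdd]
        change ((Matrix.fromBlocks 1 0 0 (Matrix.transvection i j m)).mulVec d.toAdd) _ = _
        rw [Matrix.fromBlocks_mulVec]
        simp [Matrix.transvection, Matrix.add_mulVec, Matrix.single_mulVec]
      intro m m' h
      have h1 := congrFun (congrArg Multiplicative.toAdd h) (Sum.inr i)
      simp only at h1
      rw [hval, hval] at h1
      exact mul_right_cancel₀ hj (add_left_cancel h1)
    refine (Set.infinite_range_of_injective hinj).mono ?_
    rintro - ⟨m, rfl⟩
    exact ⟨_, rfl⟩
  · refine Set.Infinite.of_image (fun d => (Multiplicative.toAdd d) ∘ Sum.inl)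
      ((hΛ _ ha).mono ?_)
    rintro - ⟨A, hA, rfl⟩
    refine ⟨_, ⟨blockDiagonal n Λ ⟨A, hA⟩, rfl⟩, ?_⟩
    simp only [blockAut_apply, toAdd_ofAdd]
    change ((Matrix.fromBlocks A.1 0 0 1).mulVec d.toAdd) ∘ Sum.inl = _
    rw [Matrix.fromBlocks_mulVec]
    simp

theorem infinite_range_prodDiag {Γ D E : Type} [Group Γ] [CommGroup D] [CommGroup E]
    {φ : Γ →* MulAut D} {ψ : Γ →* MulAut E}
    (hφ : ∀ d : D, d ≠ 1 → (Set.range fun g => φ g d).Infinite)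
    (hψ : ∀ d : E, d ≠ 1 → (Set.range fun g => ψ g d).Infinite) (d : D × E) (hd : d ≠ 1) :
    (Set.range fun g => MulAut.prodDiag φ ψ g d).Infinite := by
  by_cases h : d.1 = 1
  · refine Set.Infinite.of_image Prod.snd ((hψ d.2 fun h' => hd (Prod.ext h h')).mono ?_)
    rintro - ⟨g, rfl⟩
    exact ⟨_, ⟨g, rfl⟩, rfl⟩
  · refine Set.Infinite.of_image Prod.fst ((hφ d.1 h).mono ?_)
    rintro - ⟨g, rfl⟩
    exact ⟨_, ⟨g, rfl⟩, rfl⟩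

variable (n Λ)

theorem isEssentiallyFree_block :
    IsEssentiallyFree (blockGroup n Λ) (Torus (Fin k ⊕ Fin n)) volume := by
  refine (blockSystem n Λ).isEssentiallyFree fun g hg => ?_
  by_contra! h
  refine hg (Subtype.ext (Subtype.ext (Matrix.ext fun i j => ?_)))
  have h1 : blockAut n Λ g (latticeBasis j) * (latticeBasis j)⁻¹ = 1 := by
    by_contra h2
    exact not_isOfFinOrder_mulLattice h2 (h _)
  rw [mul_inv_eq_one] at h1
  have h2 := congrFun (congrArg Multiplicative.toAdd
    ((latticeAut_latticeBasis g.1 j).symm.trans h1)) i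
  refine h2.trans ?_
  change (Pi.single j 1 : Fin k ⊕ Fin n → ℤ) i = (1 : Matrix _ _ ℤ) i j
  rw [Matrix.one_apply, Pi.single_apply]

/-- The elementary matrices of `SL(n, ℤ)` act trivially on `𝕋^k`. -/
theorem not_isEssentiallyFree_quotient (hn : 2 ≤ n) :
    ¬ IsEssentiallyFree (blockGroup n Λ) (Torus (Fin k)) volume := by
  intro h
  have : Nontrivial (Fin n) := Fin.nontrivial_iff_two_le.2 hn
  obtain ⟨i, j, hij⟩ := exists_pair_ne (Fin n)
  let g := blockUnipotent n Λ 0 (elementarySLZ n hij)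
  have hg : g ≠ 1 := by
    intro h1
    have h2 := blockAut_elementary n Λ hij
    have h3 : blockUnipotent n Λ 0 (elementarySLZ n hij) = 1 := h1
    rw [h3, map_one, MulAut.one_apply, eq_comm, mul_eq_right] at h2
    have h4 := congrFun (congrArg Multiplicative.toAdd h2) (Sum.inr i)
    simp [latticeBasis] at h4
  have h1 := h g hg
  have h2 : {θ : Torus (Fin k) | g • θ = θ} = Set.univ := by
    refine Set.eq_univ_of_forall fun θ => ?_
    change blockProjection n Λ g • θ = θ
    rw [blockProjection_blockUnipotent, one_smul]
  rw [h2, measure_univ] at h1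
  exact one_ne_zero h1

/-- A surjective continuous homomorphism of compact groups preserves the Haar probability
measures. -/
theorem measurePreserving_restrictTorus (k n : ℕ) :
    MeasurePreserving (restrictTorus k n) volume volume := by
  let f : Torus (Fin k ⊕ Fin n) →+ Torus (Fin k) :=
    { toFun := restrictTorus k n
      map_zero' := rfl
      map_add' := fun _ _ => rfl }
  refine AddMonoidHom.measurePreserving (f := f) (continuous_pi fun i => continuous_apply _)
    (fun θ => ⟨Sum.elim θ 0, rfl⟩) (by simp)

theorem restrictTorus_smul (g : blockGroup n Λ) (θ : Torus (Fin k ⊕ Fin n)) :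
    restrictTorus k n (g • θ) = g • restrictTorus k n θ := by
  funext i
  have h1 : (g • restrictTorus k n θ) i =
      ∑ l, ((blockProjection n Λ g)⁻¹).1.1 l i • θ (Sum.inl l) := rfl
  have h2 : restrictTorus k n (g • θ) i = ∑ l, (g⁻¹).1.1 l (Sum.inl i) • θ l := rfl
  obtain ⟨A, -, B, D, h⟩ := (g⁻¹).2
  rw [h1, h2, ← map_inv, Fintype.sum_sum_type]
  have h3 : ∀ l, (g⁻¹).1.1 (Sum.inr l) (Sum.inl i) = 0 := fun l => by
    rw [h]
    rfl
  simp only [h3, zero_smul, Finset.sum_const_zero, add_zero]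
  rfl

theorem isQuotientMap_restrictTorus : IsQuotientMapOfActions (blockGroup n Λ) (restrictTorus k n)
    (volume : Measure (Torus (Fin k ⊕ Fin n))) volume :=
  ⟨measurePreserving_restrictTorus k n,
    fun g => Eventually.of_forall fun θ => restrictTorus_smul n Λ g θ⟩

theorem isQuotientMap_prodMap_restrictTorus : IsQuotientMapOfActions (blockGroup n Λ)
    (Prod.map (restrictTorus k n) (id : Torus (Fin k ⊕ Fin n) → Torus (Fin k ⊕ Fin n)))
    (volume.prod volume) (volume.prod volume) :=
  ⟨(measurePreserving_restrictTorus k n).prod (MeasurePreserving.id _),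
    fun g => Eventually.of_forall fun θ => Prod.ext (restrictTorus_smul n Λ g θ.1) rfl⟩

variable {n Λ}

/-- Whether the pair `ℤ^k ⊆ ℤ^k ⋊ Γ` has relative property (T) depends only on the image `Λ` of `Γ`
in `SL(k, ℤ)`. -/
theorem isRigidAction_base_of_quotient
    (h : HasRelativeT ((latticeAut (Fin k)).comp (Λ.subtype.comp (blockProjection n Λ)))) :
    IsRigidAction Λ (Torus (Fin k)) volume :=
  (baseSystem Λ).isRigidAction_of_hasRelativeT
    (h.of_surjective (MonoidHom.id _) (blockProjection n Λ) (fun _ => rfl) Function.surjective_id)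

instance (ι κ : Type) [Fintype ι] [Fintype κ] : BorelSpace (Torus ι × Torus κ) :=
  Prod.borelSpace

/-- The non-rigid quotients are detected by the dual groups: relative property (T) of
`ℤ^k × (ℤ^k ⊕ ℤ^n)` would pass to its quotient `ℤ^k`. Freeness of a diagonal action follows from
that of its second factor. -/
theorem blockGroup_actions (hn : 2 ≤ n)
    (hΛ : ∀ x : Fin k → ℤ, x ≠ 0 → {y | ∃ A ∈ Λ, y = A.1.mulVec x}.Infinite)
    (hR : ¬ IsRigidAction Λ (Torus (Fin k)) volume) :
    (IsRigidAction (blockGroup n Λ) (Torus (Fin k ⊕ Fin n)) volume ∧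
      IsQuotientMapOfActions (blockGroup n Λ) (restrictTorus k n) volume volume ∧
      ¬ IsRigidAction (blockGroup n Λ) (Torus (Fin k)) volume ∧
      ¬ IsEssentiallyFree (blockGroup n Λ) (Torus (Fin k)) volume) ∧
    (IsEssentiallyFree (blockGroup n Λ) (Torus (Fin k ⊕ Fin n) × Torus (Fin k ⊕ Fin n))
        (volume.prod volume) ∧
      ErgodicSMul (blockGroup n Λ) (Torus (Fin k ⊕ Fin n) × Torus (Fin k ⊕ Fin n))
        (volume.prod volume) ∧
      IsRigidAction (blockGroup n Λ) (Torus (Fin k ⊕ Fin n) × Torus (Fin k ⊕ Fin n))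
        (volume.prod volume)) ∧
    (IsQuotientMapOfActions (blockGroup n Λ)
        (Prod.map (restrictTorus k n) (id : Torus (Fin k ⊕ Fin n) → Torus (Fin k ⊕ Fin n)))
        (volume.prod volume) (volume.prod volume) ∧
      IsEssentiallyFree (blockGroup n Λ) (Torus (Fin k) × Torus (Fin k ⊕ Fin n))
        (volume.prod volume) ∧
      ErgodicSMul (blockGroup n Λ) (Torus (Fin k) × Torus (Fin k ⊕ Fin n))
        (volume.prod volume) ∧
      ¬ IsRigidAction (blockGroup n Λ) (Torus (Fin k) × Torus (Fin k ⊕ Fin n))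
        (volume.prod volume)) := by
  have hT := hasRelativeT_blockAut n Λ hn
  have hfree := isEssentiallyFree_block n Λ
  refine ⟨⟨(blockSystem n Λ).isRigidAction_of_hasRelativeT hT, isQuotientMap_restrictTorus n Λ,
    fun h => ?_, not_isEssentiallyFree_quotient n Λ hn⟩, ⟨hfree.prod, ?_, ?_⟩,
    isQuotientMap_prodMap_restrictTorus n Λ, hfree.prod, ?_, fun h => ?_⟩
  · exact hR (isRigidAction_base_of_quotient
      ((quotientSystem n Λ).hasRelativeT_of_isRigidAction h))
  · exact ((blockSystem n Λ).prod (blockSystem n Λ)).ergodicSMul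
      (infinite_range_prodDiag (fun _ => infinite_range_block hn hΛ)
        fun _ => infinite_range_block hn hΛ)
  · exact ((blockSystem n Λ).prod (blockSystem n Λ)).isRigidAction_of_hasRelativeT (hT.prodDiag hT)
  · exact ((quotientSystem n Λ).prod (blockSystem n Λ)).ergodicSMul
      (infinite_range_prodDiag (fun _ => infinite_range_base hΛ)
        fun _ => infinite_range_block hn hΛ)
  · exact hR (isRigidAction_base_of_quotient
      ((((quotientSystem n Λ).prod (blockSystem n Λ)).hasRelativeT_of_isRigidAction h).of_surjective
        (MonoidHom.fst _ _) (MonoidHom.id _) (fun _ => rfl) Prod.fst_surjective))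

end BlockActions

/-! ### Almost invariant finitely supported probability vectors on amenable groups -/

section Reiter

/-- By the Hahn–Banach theorem in `ℓ¹`, an amenable group carries finitely supported
probability vectors that are almost invariant under any given finite set. -/
theorem IsAmenableGroup.exists_almost_invariant {G : Type} [Group G] (hG : IsAmenableGroup G)
    (F : Finset G) {ε : ℝ} (hε : 0 < ε) : ∃ c : G →₀ ℝ, (∀ x, 0 ≤ c x) ∧ HasSum c 1 ∧
      ∀ a ∈ F, Summable (fun x => |c (a⁻¹ * x) - c x|) ∧ ∑' x, |c (a⁻¹ * x) - c x| ≤ ε := by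
  classical
  obtain ⟨m, hm1, hmpos, hminv⟩ := hG
  let δ : G → lp (fun _ : G => ℝ) 1 := fun x => lp.single 1 x (1 : ℝ)
  have hδ : ∀ x, ‖δ x‖ = 1 := fun x => by
    rw [lp.norm_single (by norm_num), norm_one]
  let p : G → F → lp (fun _ : G => ℝ) 1 := fun x a => δ (a * x) - δ x
  let T : (G →₀ ℝ) →ₗ[ℝ] (F → lp (fun _ : G => ℝ) 1) := Finsupp.linearCombination ℝ p
  have hT : ∀ c a x, T c a x = c ((a : G)⁻¹ * x) - c x := by
    intro c a x
    induction c using Finsupp.induction_linear with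
    | zero => simp
    | add c c' hc hc' =>
      rw [map_add, Pi.add_apply, lp.coeFn_add, Pi.add_apply, hc, hc', Finsupp.add_apply,
        Finsupp.add_apply]
      ring
    | single z r =>
      have h1 : T (Finsupp.single z r) = r • p z := Finsupp.linearCombination_single ℝ r z
      rw [h1, Pi.smul_apply, lp.coeFn_smul, Pi.smul_apply, lp.coeFn_sub, Pi.sub_apply,
        lp.single_apply, lp.single_apply, Finsupp.single_apply, Finsupp.single_apply]
      simp only [Pi.single_apply, smul_eq_mul, eq_inv_mul_iff_mul_eq, eq_comm (a := x)]
      split_ifs <;> simp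
  let K : Set (G →₀ ℝ) := {c | (∀ x, 0 ≤ c x) ∧ HasSum c 1}
  have hK : Convex ℝ K := by
    rintro c ⟨hc0, hc1⟩ c' ⟨hc0', hc1'⟩ s t hs ht hst
    refine ⟨fun x => ?_, ?_⟩
    · have h1 := hc0 x
      have h2 := hc0' x
      simp only [Finsupp.add_apply, Finsupp.smul_apply, smul_eq_mul]
      positivity
    · have h1 := (hc1.mul_left s).add (hc1'.mul_left t)
      rw [mul_one, mul_one, hst] at h1
      exact h1
  -- a functional separating `0` from the vectors `T c` gives bounded functions whose mean, being
  -- the mean of a sum of differences `h (a * ·) - h`, would be both zero and positive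
  have hmem : (0 : F → lp (fun _ : G => ℝ) 1) ∈ closure (T '' K) := by
    by_contra hnot
    obtain ⟨f, u, hu, hfu⟩ := geometric_hahn_banach_point_closed (hK.linear_image T).closure
      isClosed_closure hnot
    rw [map_zero] at hu
    let h : F → G → ℝ := fun a x => f (Pi.single a (δ x))
    have hbound : ∀ a x, ‖h a x‖ ≤ ‖f ∘L ContinuousLinearMap.single ℝ _ a‖ := fun a x => by
      have := (f ∘L ContinuousLinearMap.single ℝ (fun _ : F => lp (fun _ : G => ℝ) 1) a).le_opNorm
        (δ x)
      rw [hδ, mul_one] at this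
      exact this
    let h₁ : F → lp (fun _ : G => ℝ) ∞ := fun a => ⟨h a, memℓp_infty
      ⟨_, by rintro - ⟨x, rfl⟩; exact hbound a x⟩⟩
    let h₂ : F → lp (fun _ : G => ℝ) ∞ := fun a => ⟨fun x => h a (a * x), memℓp_infty
      ⟨_, by rintro - ⟨x, rfl⟩; exact hbound a (a * x)⟩⟩
    let one : lp (fun _ : G => ℝ) ∞ := ⟨fun _ => 1, memℓp_infty
      ⟨1, by rintro - ⟨x, rfl⟩; simp⟩⟩
    let H : lp (fun _ : G => ℝ) ∞ := ∑ a, (h₂ a - h₁ a)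
    have hmH : m H = 0 := by
      rw [map_sum]
      refine Finset.sum_eq_zero fun a _ => ?_
      rw [map_sub, hminv a (h₁ a) (h₂ a) fun x => rfl, sub_self]
    have hH : ∀ x, H x = f (p x) := by
      intro x
      rw [← Finset.univ_sum_single (p x), map_sum, lp.coeFn_sum, Finset.sum_apply]
      refine Finset.sum_congr rfl fun a _ => ?_
      have : (Pi.single a (p x a) : F → lp (fun _ : G => ℝ) 1) =
          Pi.single a (δ (a * x)) - Pi.single a (δ x) := Pi.single_sub a _ _
      rw [this, map_sub]
      rfl
    have hpos := hmpos (H - u • one) fun x => by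
      have h1 : (H - u • one) x = H x - u * 1 := rfl
      have h2 : p x ∈ closure (T '' K) := subset_closure ⟨Finsupp.single x 1, ⟨fun z => by
          rw [Finsupp.single_apply]
          split_ifs <;> norm_num, by
          have h3 := hasSum_single (f := Finsupp.single x (1 : ℝ)) x
            fun z hz => Finsupp.single_eq_of_ne hz
          rwa [Finsupp.single_eq_same] at h3⟩, by
        exact (Finsupp.linearCombination_single ℝ 1 x).trans (one_smul ℝ _)⟩
      have h3 := hfu _ h2
      rw [h1, hH, mul_one]
      linarith
    rw [map_sub, map_smul, hmH, hm1 one fun _ => rfl, smul_eq_mul] at hpos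
    linarith
  obtain ⟨-, ⟨c, ⟨hc0, hc1⟩, rfl⟩, hc⟩ := Metric.mem_closure_iff.1 hmem ε hε
  refine ⟨c, hc0, hc1, fun a ha => ?_⟩
  have h1 : ‖T c ⟨a, ha⟩‖ ≤ ε := by
    rw [dist_zero_left] at hc
    exact (norm_le_pi_norm (T c) ⟨a, ha⟩).trans hc.le
  have h2 := lp.hasSum_norm (p := 1) (by norm_num) (T c ⟨a, ha⟩)
  simp only [hT, ENNReal.toReal_one, Real.rpow_one, Real.norm_eq_abs] at h2
  exact ⟨h2.summable, h2.tsum_eq.trans_le h1⟩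

end Reiter

/-! ### Amenable groups and the failure of relative property (T) -/

section Amenable

section MonomialRepresentation

variable {I G : Type} [Group G]

theorem lp.norm_sq_eq_tsum (f : lp (fun _ : I => ℂ) 2) : ‖f‖ ^ 2 = ∑' i, ‖f i‖ ^ 2 := by
  have h := lp.norm_rpow_eq_tsum (p := 2) (by norm_num) f
  simpa only [ENNReal.toReal_ofNat, Real.rpow_ofNat] using h

/-- The operator `f ↦ (i ↦ u i * f (π⁻¹ i))` on `ℓ²(I)`. -/
def monomialMap (π : Equiv.Perm I) (u : I → Circle) :
    lp (fun _ : I => ℂ) 2 →ₗ[ℂ] lp (fun _ : I => ℂ) 2 where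
  toFun f := ⟨fun i => (u i : ℂ) * f (π⁻¹ i), by
    refine memℓp_gen ?_
    simp only [ENNReal.toReal_ofNat, Real.rpow_ofNat, norm_mul, Circle.norm_coe, one_mul]
    exact (π⁻¹).summable_iff.2 (lp.summable_norm_sq f)⟩
  map_add' f g := by
    ext i
    exact mul_add _ _ _
  map_smul' c f := by
    ext i
    exact mul_left_comm _ _ _

theorem monomialMap_apply (π : Equiv.Perm I) (u : I → Circle) (f : lp (fun _ : I => ℂ) 2) (i : I) :
    monomialMap π u f i = (u i : ℂ) * f (π⁻¹ i) := rfl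

theorem norm_monomialMap (π : Equiv.Perm I) (u : I → Circle) (f : lp (fun _ : I => ℂ) 2) :
    ‖monomialMap π u f‖ = ‖f‖ := by
  refine (pow_left_inj₀ (norm_nonneg _) (norm_nonneg _) two_ne_zero).1 ?_
  rw [lp.norm_sq_eq_tsum, lp.norm_sq_eq_tsum]
  simp only [monomialMap_apply, norm_mul, Circle.norm_coe, one_mul]
  exact (π⁻¹).tsum_eq fun i => ‖f i‖ ^ 2

/-- The monomial unitary representation on `ℓ²(I)` of a group that acts on `I`, for a circle valued
cocycle `u`. -/
def monomialRep (π : G →* Equiv.Perm I) (u : G → I → Circle)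
    (hu : ∀ s t i, u (s * t) i = u s i * u t ((π s)⁻¹ i)) :
    G →* (lp (fun _ : I => ℂ) 2 ≃ₗᵢ[ℂ] lp (fun _ : I => ℂ) 2) :=
  have h1 : ∀ i, u 1 i = 1 := fun i => by
    have h := hu 1 1 i
    rw [map_one, inv_one, mul_one, Equiv.Perm.one_apply] at h
    exact left_eq_mul.1 h
  have hone : ∀ f, monomialMap (π 1) (u 1) f = f := fun f => by
    ext i
    rw [monomialMap_apply, h1, map_one, inv_one, Equiv.Perm.one_apply, Circle.coe_one, one_mul]
  have hmul : ∀ s t f, monomialMap (π (s * t)) (u (s * t)) f =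
      monomialMap (π s) (u s) (monomialMap (π t) (u t) f) := fun s t f => by
    ext i
    rw [monomialMap_apply, monomialMap_apply, monomialMap_apply, hu, Circle.coe_mul, map_mul,
      mul_inv_rev, Equiv.Perm.mul_apply, mul_assoc]
  { toFun := fun s =>
      { toLinearEquiv := LinearEquiv.ofLinearMap (monomialMap (π s) (u s))
          (monomialMap (π s⁻¹) (u s⁻¹))
          (LinearMap.ext fun f => by
            rw [LinearMap.comp_apply, ← hmul, mul_inv_cancel, hone]
            rfl)
          (LinearMap.ext fun f => by
            rw [LinearMap.comp_apply, ← hmul, inv_mul_cancel, hone]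
            rfl)
        norm_map' := norm_monomialMap _ _ }
    map_one' := LinearIsometryEquiv.ext hone
    map_mul' := fun s t => LinearIsometryEquiv.ext (hmul s t) }

end MonomialRepresentation

theorem exists_finset_exhaustion (A : Type) [Countable A] [Nonempty A] :
    ∃ F : ℕ → Finset A, ∀ a, ∀ᶠ n in atTop, a ∈ F n := by
  classical
  obtain ⟨f, hf⟩ := exists_surjective_nat A
  refine ⟨fun n => (Finset.range n).image f, fun a => ?_⟩
  obtain ⟨m, rfl⟩ := hf a
  filter_upwards [eventually_gt_atTop m] with n hn
  exact Finset.mem_image_of_mem f (Finset.mem_range.2 hn)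

theorem sq_sqrt_sub_sqrt_le {a b : ℝ} (ha : 0 ≤ a) (hb : 0 ≤ b) :
    (√a - √b) ^ 2 ≤ |a - b| := by
  have h : a - b = (√a - √b) * (√a + √b) := by
    nlinarith [Real.sq_sqrt ha, Real.sq_sqrt hb]
  rw [h, abs_mul, abs_of_nonneg (by positivity : 0 ≤ √a + √b), ← sq_abs, sq]
  refine mul_le_mul_of_nonneg_left ?_ (abs_nonneg _)
  rw [abs_le]
  constructor <;> linarith [Real.sqrt_nonneg a, Real.sqrt_nonneg b]

/-- The vector in `ℓ²(ℕ × G)` given by the square root of a probability vector on the slice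
`{n} × G`. -/
def sliceVector {G : Type} (c : G →₀ ℝ) (n : ℕ) : lp (fun _ : ℕ × G => ℂ) 2 :=
  ⟨fun i => if i.1 = n then ((√(c i.2) : ℝ) : ℂ) else 0, by
    classical
    refine memℓp_gen (summable_of_hasFiniteSupport ?_)
    refine (c.support.image fun x => (n, x)).finite_toSet.subset fun i hi => ?_
    by_cases h : i.1 = n
    · subst h
      refine Finset.mem_coe.2 (Finset.mem_image.2 ⟨i.2, ?_, rfl⟩)
      rw [Finsupp.mem_support_iff]
      intro h0
      simp [h0] at hi
    · simp [h] at hi⟩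

theorem sliceVector_apply {G : Type} (c : G →₀ ℝ) (n : ℕ) (i : ℕ × G) :
    sliceVector c n i = if i.1 = n then ((√(c i.2) : ℝ) : ℂ) else 0 := rfl

theorem norm_sq_of_slice {G : Type} (w : lp (fun _ : ℕ × G => ℂ) 2) (n : ℕ)
    (hw : ∀ i, i.1 ≠ n → w i = 0) : ‖w‖ ^ 2 = ∑' x, ‖w (n, x)‖ ^ 2 := by
  rw [lp.norm_sq_eq_tsum]
  refine ((Prod.mk_right_injective n).tsum_eq (f := fun i => ‖w i‖ ^ 2) fun i hi => ?_).symm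
  by_cases h : i.1 = n
  · exact ⟨i.2, Prod.ext h.symm rfl⟩
  · simp [hw i h] at hi

theorem norm_sliceVector {G : Type} {c : G →₀ ℝ} (hc : ∀ x, 0 ≤ c x) (h1 : HasSum c 1) (n : ℕ) :
    ‖sliceVector c n‖ = 1 := by
  have h := norm_sq_of_slice (sliceVector c n) n fun i hi => by rw [sliceVector_apply, if_neg hi]
  have h2 : ∀ x, ‖sliceVector c n (n, x)‖ ^ 2 = c x := fun x => by
    rw [sliceVector_apply, if_pos rfl, Complex.norm_real, Real.norm_eq_abs, sq_abs,
      Real.sq_sqrt (hc x)]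
  simp only [h2] at h
  rw [h1.tsum_eq] at h
  nlinarith [norm_nonneg (sliceVector c n)]

variable {Γ X D : Type} [Group Γ] [MetricSpace X] [MeasurableSpace X] [MulAction Γ X]
  {μ : Measure X} [CommGroup D] {φ : Γ →* MulAut D}

/-- For an amenable group `Γ`, translates of almost invariant vectors of `ℓ²(Γ)` by nontrivial
points that converge to the unit give almost invariant vectors for `D ⋊ Γ` in a representation
without nonzero `D`-invariant vectors. -/
theorem not_hasRelativeT_of_isAmenableGroup [Countable Γ] [Countable D]
    (χ : CharacterSystem φ μ) (hΓ : IsAmenableGroup Γ) (x₀ : X) (hx₀ : ∀ d, χ.char d x₀ = 1)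
    [(𝓝[≠] x₀).NeBot] : ¬ HasRelativeT φ := by
  classical
  intro hT
  obtain ⟨F, hF⟩ := exists_finset_exhaustion Γ
  obtain ⟨E, hE⟩ := exists_finset_exhaustion D
  have hpos : ∀ n : ℕ, (0 : ℝ) < 1 / ((n : ℝ) + 1) := fun n => by positivity
  -- probability vectors that are almost invariant under larger and larger finite sets
  choose c hc0 hc1 hcF using fun n => hΓ.exists_almost_invariant (F n) (hpos n)
  -- points so close to `x₀` that the relevant characters are almost trivial there; the translates
  -- by the support of `c n` have to be controlled as well
  have hy : ∀ n, ∃ y, y ≠ x₀ ∧ ∀ a ∈ (c n).support, ∀ d ∈ E n,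
      ‖χ.charC (φ a⁻¹ d) y - 1‖ ≤ 1 / ((n : ℝ) + 1) := by
    intro n
    have h1 : ∀ᶠ y in 𝓝 x₀, ∀ a ∈ (c n).support, ∀ d ∈ E n,
        ‖χ.charC (φ a⁻¹ d) y - 1‖ ≤ 1 / ((n : ℝ) + 1) := by
      rw [Filter.eventually_all_finset]
      intro a _
      rw [Filter.eventually_all_finset]
      intro d _
      have h2 : Tendsto (fun y => ‖χ.charC (φ a⁻¹ d) y - 1‖) (𝓝 x₀) (𝓝 0) := by
        have h3 : Continuous fun y => ‖χ.charC (φ a⁻¹ d) y - 1‖ := by fun_prop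
        have h4 := h3.tendsto x₀
        rwa [χ.charC_apply, hx₀, Circle.coe_one, sub_self, norm_zero] at h4
      exact (h2.eventually_lt_const (hpos n)).mono fun _ h => h.le
    have h2 := (h1.filter_mono nhdsWithin_le_nhds).and
      (self_mem_nhdsWithin : {x₀}ᶜ ∈ 𝓝[≠] x₀)
    obtain ⟨y, hy1, hy2⟩ := h2.exists
    exact ⟨y, hy2, hy1⟩
  choose y hy0 hy1 using hy
  let π : D ⋊[φ] Γ →* Equiv.Perm (ℕ × Γ) :=
    { toFun := fun s => (Equiv.refl ℕ).prodCongr (Equiv.mulLeft s.right)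
      map_one' := Equiv.ext fun i => Prod.ext rfl (one_mul i.2)
      map_mul' := fun s t => Equiv.ext fun i => Prod.ext rfl (mul_assoc s.right t.right i.2) }
  have hπ : ∀ s i, (π s)⁻¹ i = (i.1, s.right⁻¹ * i.2) := fun s i => rfl
  let u : D ⋊[φ] Γ → ℕ × Γ → Circle := fun s i => χ.char (φ i.2⁻¹ s.left) (y i.1)
  have hu : ∀ s t i, u (s * t) i = u s i * u t ((π s)⁻¹ i) := by
    intro s t i
    simp only [u, hπ]
    rw [SemidirectProduct.mul_left, map_mul (φ i.2⁻¹), map_mul χ.char, ContinuousMap.mul_apply,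
      mul_inv_rev, inv_inv, map_mul φ, MulAut.mul_apply]
  let σ := monomialRep π u hu
  let ξ : ℕ → lp (fun _ : ℕ × Γ => ℂ) 2 := fun n => sliceVector (c n) n
  have hsmall : ∀ s, (∀ᶠ n in atTop, ‖σ s (ξ n) - ξ n‖ ^ 2 ≤ 1 / ((n : ℝ) + 1)) →
      AlmostFixedOn σ ξ {s} := by
    intro s hs ε hε
    have h1 := (tendsto_one_div_add_atTop_nhds_zero_nat (𝕜 := ℝ)).eventually_lt_const
      (pow_pos hε 2)
    filter_upwards [hs, h1] with n h2 h3
    rintro g rfl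
    exact (pow_le_pow_iff_left₀ (norm_nonneg _) hε.le two_ne_zero).1 (h2.trans h3.le)
  have hval : ∀ s n i, (σ s (ξ n) - ξ n : lp (fun _ : ℕ × Γ => ℂ) 2) i =
      (u s i : ℂ) * ξ n (i.1, s.right⁻¹ * i.2) - ξ n i := fun s n i => rfl
  have hslice : ∀ s n, ‖σ s (ξ n) - ξ n‖ ^ 2 = ∑' x, ‖(u s (n, x) : ℂ) *
      (√(c n (s.right⁻¹ * x)) : ℝ) - (√(c n x) : ℝ)‖ ^ 2 := by
    intro s n
    rw [norm_sq_of_slice _ n fun i hi => ?_]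
    · refine tsum_congr fun x => ?_
      rw [hval, sliceVector_apply, sliceVector_apply, if_pos rfl, if_pos rfl]
    · rw [hval, sliceVector_apply, sliceVector_apply, if_neg hi, if_neg hi, mul_zero, sub_zero]
  have hinl : ∀ d, AlmostFixedOn σ ξ {SemidirectProduct.inl d} := by
    intro d
    refine hsmall _ ?_
    filter_upwards [hE d] with n hn
    rw [hslice]
    have hle1 : 1 / ((n : ℝ) + 1) ≤ 1 := by
      rw [div_le_one (by positivity)]
      have := Nat.cast_nonneg (α := ℝ) n
      linarith
    have hle : ∀ x, ‖(u (SemidirectProduct.inl d) (n, x) : ℂ) *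
        (√(c n ((SemidirectProduct.inl d : D ⋊[φ] Γ).right⁻¹ * x)) : ℝ) - (√(c n x) : ℝ)‖ ^ 2 ≤
          1 / ((n : ℝ) + 1) * c n x := by
      intro x
      rw [SemidirectProduct.right_inl, inv_one, one_mul]
      have h1 : (u (SemidirectProduct.inl d) (n, x) : ℂ) * (√(c n x) : ℝ) - (√(c n x) : ℝ) =
          (χ.charC (φ x⁻¹ d) (y n) - 1) * (√(c n x) : ℝ) := by
        rw [sub_mul, one_mul]
        rfl
      rw [h1, norm_mul, mul_pow, Complex.norm_real, Real.norm_eq_abs, sq_abs,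
        Real.sq_sqrt (hc0 n x)]
      by_cases hx : x ∈ (c n).support
      · refine mul_le_mul_of_nonneg_right ?_ (hc0 n x)
        have h2 := hy1 n x hx d hn
        nlinarith [norm_nonneg (χ.charC (φ x⁻¹ d) (y n) - 1)]
      · rw [Finsupp.notMem_support_iff.1 hx, mul_zero, mul_zero]
    have hs := (hc1 n).mul_left (1 / ((n : ℝ) + 1))
    refine ((Summable.of_nonneg_of_le (fun x => by positivity) hle hs.summable).tsum_le_tsum hle
      hs.summable).trans ?_
    rw [hs.tsum_eq, mul_one]
  have hinr : ∀ a, AlmostFixedOn σ ξ {SemidirectProduct.inr a} := by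
    intro a
    refine hsmall _ ?_
    filter_upwards [hF a] with n hn
    rw [hslice]
    have hle : ∀ x, ‖(u (SemidirectProduct.inr a) (n, x) : ℂ) *
        (√(c n ((SemidirectProduct.inr a : D ⋊[φ] Γ).right⁻¹ * x)) : ℝ) - (√(c n x) : ℝ)‖ ^ 2 ≤
          |c n (a⁻¹ * x) - c n x| := by
      intro x
      have h1 : u (SemidirectProduct.inr a) (n, x) = 1 := by
        simp only [u]
        rw [SemidirectProduct.left_inr, map_one, map_one]
        rfl
      rw [h1, Circle.coe_one, one_mul, SemidirectProduct.right_inr, ← Complex.ofReal_sub,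
        Complex.norm_real, Real.norm_eq_abs, sq_abs]
      exact sq_sqrt_sub_sqrt_le (hc0 n _) (hc0 n _)
    obtain ⟨hs, hs'⟩ := hcF n a hn
    exact ((Summable.of_nonneg_of_le (fun x => by positivity) hle hs).tsum_le_tsum hle hs).trans hs'
  have hfix : ∀ s, AlmostFixedOn σ ξ {s} := by
    intro s
    have h1 := (hinl s.left).mul (hinr s.right)
    refine h1.mono ?_
    rintro g rfl
    exact ⟨_, rfl, _, rfl, SemidirectProduct.inl_left_mul_inr_right g⟩
  have hunif := hT _ σ ξ (fun n => norm_sliceVector (hc0 n) (hc1 n) n) hfix (1 / 2) (by norm_num)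
  obtain ⟨n, hn⟩ := hunif.exists
  obtain ⟨η, hη, hle⟩ := exists_fixed_of_norm_sub_le (σ.comp SemidirectProduct.inl) (ξ n)
    (fun d => hn _ ⟨d, rfl⟩)
  -- a nonzero coordinate of an invariant vector would make all characters trivial at some `y n`
  have hη0 : η = 0 := by
    ext i
    by_contra hi
    have h1 : ∀ d, χ.char (φ i.2⁻¹ d) (y i.1) = 1 := by
      intro d
      have h2 : (u (SemidirectProduct.inl d) i : ℂ) *
          η (i.1, (SemidirectProduct.inl d : D ⋊[φ] Γ).right⁻¹ * i.2) = η i :=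
        congrArg (fun f : lp (fun _ : ℕ × Γ => ℂ) 2 => f i) (hη d)
      rw [SemidirectProduct.right_inl, inv_one, one_mul] at h2
      exact Circle.ext (mul_right_cancel₀ hi (h2.trans (one_mul _).symm))
    refine hy0 i.1 (χ.separates _ _ fun d => ?_)
    rw [hx₀]
    have h2 := h1 (φ i.2 d)
    rwa [← MulAut.mul_apply, ← map_mul, inv_mul_cancel, map_one, MulAut.one_apply] at h2
  have h1 : ‖ξ n‖ = 1 := norm_sliceVector (hc0 n) (hc1 n) n
  rw [hη0, sub_zero, h1] at hle
  norm_num at hle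

/-- The unit of the torus is not isolated. -/
instance torus_neBot {k : ℕ} [NeZero k] : (𝓝[≠] (0 : Torus (Fin k))).NeBot := by
  let f : ℝ → Torus (Fin k) := fun t _ => (t : UnitAddCircle)
  have hf : Tendsto f (𝓝[>] 0) (𝓝[≠] 0) := by
    refine tendsto_nhdsWithin_iff.2 ⟨?_, ?_⟩
    · have h1 : Continuous f := continuous_pi fun _ => AddCircle.continuous_mk' 1
      have h2 := h1.tendsto 0
      have h3 : f 0 = 0 := funext fun _ => rfl
      rw [h3] at h2
      exact h2.mono_left nhdsWithin_le_nhds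
    · filter_upwards [Ioo_mem_nhdsGT (zero_lt_one (α := ℝ))] with t ht h0
      have h1 : ((t : ℝ) : UnitAddCircle) = 0 := congrFun h0 (0 : Fin k)
      rw [AddCircle.coe_eq_zero_iff] at h1
      obtain ⟨m, hm⟩ := h1
      rw [zsmul_eq_mul, mul_one] at hm
      rw [← hm] at ht
      have h2 : (0 : ℤ) < m := by exact_mod_cast ht.1
      have h3 : m < (1 : ℤ) := by exact_mod_cast ht.2
      omega
  exact hf.neBot

/-- All characters are trivial at the unit of the torus, which is not isolated for `k ≥ 1`. -/
theorem not_isRigidAction_of_isAmenableGroup {k : ℕ} (hk : 1 ≤ k) (Λ : Subgroup (SLZ (Fin k)))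
    (hΛ : IsAmenableGroup Λ) : ¬ IsRigidAction Λ (Torus (Fin k)) volume := by
  intro hR
  have : NeZero k := ⟨by omega⟩
  have : Countable (MulLattice (Fin k)) := inferInstanceAs (Countable (Fin k → ℤ))
  refine not_hasRelativeT_of_isAmenableGroup (baseSystem Λ) hΛ 0 (fun d => ?_)
    ((baseSystem Λ).hasRelativeT_of_isRigidAction hR)
  change AddCircle.toCircle (Torus.pairing 0 d.toAdd) = 1
  simp [Torus.pairing]

end Amenable

/-! ### A hyperbolic cyclic group of matrices -/

section Hyperbolic

/-- Cyclic groups are amenable: an ultrafilter limit of averages over the powers of a generator is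
an invariant mean. -/
theorem isAmenableGroup_of_generator {G : Type} [Group G] (a : G)
    (ha : ∀ g : G, g ∈ Subgroup.zpowers a) : IsAmenableGroup G := by
  let avg : lp (fun _ : G => ℝ) ∞ → ℕ → ℝ := fun f N =>
    (∑ i ∈ Finset.range N, f (a ^ i)) / N
  have hlim : ∀ f, ∃ l, Tendsto (avg f) (hyperfilter ℕ : Filter ℕ) (𝓝 l) := by
    intro f
    have hb : ∀ N, avg f N ∈ Set.Icc (-‖f‖) ‖f‖ := by
      intro N
      rw [Set.mem_Icc, ← abs_le, abs_div, Nat.abs_cast]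
      refine div_le_of_le_mul₀ (Nat.cast_nonneg _) (norm_nonneg _) ?_
      refine (Finset.abs_sum_le_sum_abs _ _).trans ?_
      refine (Finset.sum_le_sum fun i _ =>
        lp.norm_apply_le_norm ENNReal.top_ne_zero f (a ^ i)).trans ?_
      rw [Finset.sum_const, Finset.card_range, nsmul_eq_mul, mul_comm]
    obtain ⟨l, -, hl⟩ := isCompact_Icc.ultrafilter_le_nhds ((hyperfilter ℕ).map (avg f))
      (le_principal_iff.2 (show ∀ᶠ N in (hyperfilter ℕ : Filter ℕ), avg f N ∈ Set.Icc (-‖f‖) ‖f‖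
        from Eventually.of_forall hb))
    exact ⟨l, hl⟩
  choose m hm using hlim
  have huniq : ∀ f l, Tendsto (avg f) (hyperfilter ℕ : Filter ℕ) (𝓝 l) → m f = l := fun f l hl =>
    tendsto_nhds_unique (hm f) hl
  have hgen : ∀ f f' : lp (fun _ : G => ℝ) ∞, (∀ x, f' x = f (a * x)) → m f' = m f := by
    intro f f' hff'
    refine huniq f' _ ?_
    have hdiff : Tendsto (fun N => avg f' N - avg f N) atTop (𝓝 0) := by
      have h1 : ∀ N : ℕ, avg f' N - avg f N = (f (a ^ N) - f 1) / N := by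
        intro N
        have h2 := Finset.sum_range_sub (fun i => f (a ^ i)) N
        simp only [avg, hff', ← pow_succ']
        rw [← sub_div, ← Finset.sum_sub_distrib, h2, pow_zero]
      have h3 := tendsto_const_div_atTop_nhds_zero_nat (2 * ‖f‖)
      refine squeeze_zero_norm (fun N => ?_) h3
      rw [h1, Real.norm_eq_abs, abs_div, Nat.abs_cast]
      refine div_le_div_of_nonneg_right ?_ (Nat.cast_nonneg _)
      refine (abs_sub _ _).trans ?_
      rw [two_mul]
      exact add_le_add (lp.norm_apply_le_norm ENNReal.top_ne_zero f _)
        (lp.norm_apply_le_norm ENNReal.top_ne_zero f _)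
    have h4 := (hdiff.mono_left Nat.hyperfilter_le_atTop).add (hm f)
    simpa using h4
  refine ⟨
    { toFun := m
      map_add' := fun f f' => huniq _ _ (((hm f).add (hm f')).congr fun N => ?_)
      map_smul' := fun c f => huniq _ _ (((hm f).const_mul c).congr fun N => ?_) },
    fun f hf => huniq _ _ ?_, fun f hf => ?_, fun g => ?_⟩
  · simp only [avg, lp.coeFn_add, Pi.add_apply, Finset.sum_add_distrib, add_div]
  · simp only [avg, lp.coeFn_smul, Pi.smul_apply, smul_eq_mul, ← Finset.mul_sum, mul_div_assoc]
  · refine (tendsto_const_nhds (x := (1 : ℝ))).congr' ?_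
    refine Nat.hyperfilter_le_atTop ?_
    filter_upwards [eventually_gt_atTop 0] with N hN
    have : (N : ℝ) ≠ 0 := by positivity
    simp [avg, hf, this]
  · refine ge_of_tendsto (hm f) (Eventually.of_forall fun N => ?_)
    exact div_nonneg (Finset.sum_nonneg fun i _ => hf _) (Nat.cast_nonneg _)
  · -- the elements under which the mean is invariant form a subgroup
    have translate : ∀ (g : G) (f : lp (fun _ : G => ℝ) ∞),
        ∃ f' : lp (fun _ : G => ℝ) ∞, ∀ x, f' x = f (g * x) := fun g f =>
      ⟨⟨fun x => f (g * x), memℓp_infty ⟨‖f‖, by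
        rintro - ⟨x, rfl⟩
        exact lp.norm_apply_le_norm ENNReal.top_ne_zero f _⟩⟩, fun _ => rfl⟩
    let S : Subgroup G :=
      { carrier := {g | ∀ f f' : lp (fun _ : G => ℝ) ∞, (∀ x, f' x = f (g * x)) → m f' = m f}
        one_mem' := fun f f' h => congrArg m (lp.ext (funext fun x => by rw [h, one_mul]))
        mul_mem' := fun {g h} hg hh f f' hf => by
          obtain ⟨f₁, hf₁⟩ := translate g f
          rw [← hg f f₁ hf₁]
          exact hh f₁ f' fun x => by rw [hf, hf₁, mul_assoc]
        inv_mem' := fun {g} hg f f' hf => (hg f' f fun x => by rw [hf, inv_mul_cancel_left]).symm }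
    have hS : Subgroup.zpowers a ≤ S := by
      rw [Subgroup.zpowers_le]
      exact hgen
    exact hS (ha g)

/-- The hyperbolic matrix `(2, 1; 1, 1)`. -/
def catMatrix : SLZ (Fin 2) := ⟨!![2, 1; 1, 1], by simp [Matrix.det_fin_two]⟩

theorem isAmenableGroup_zpowers_catMatrix : IsAmenableGroup (Subgroup.zpowers catMatrix) :=
  isAmenableGroup_of_generator ⟨catMatrix, Subgroup.mem_zpowers catMatrix⟩ (by
    rintro ⟨g, hg⟩
    obtain ⟨i, rfl⟩ := Subgroup.mem_zpowers_iff.1 hg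
    exact ⟨i, Subtype.ext rfl⟩)

theorem catMatrix_pow_entries (m : ℕ) : 2 ≤ (catMatrix ^ (m + 1)).1 0 0 ∧
    1 ≤ (catMatrix ^ (m + 1)).1 0 1 ∧ 1 ≤ (catMatrix ^ (m + 1)).1 1 0 ∧
      1 ≤ (catMatrix ^ (m + 1)).1 1 1 := by
  induction m with
  | zero =>
    rw [zero_add, pow_one]
    simp [catMatrix]
  | succ m ih =>
    have h : (catMatrix ^ (m + 1 + 1)).1 = (catMatrix ^ (m + 1)).1 * !![2, 1; 1, 1] := by
      rw [pow_succ]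
      rfl
    rw [h]
    simp only [Matrix.mul_apply, Fin.sum_univ_two, Matrix.of_apply, Matrix.cons_val',
      Matrix.cons_val_zero, Matrix.cons_val_one, Matrix.cons_val_fin_one]
    omega

/-- No nontrivial power of the matrix fixes a nonzero vector, since its trace exceeds `2`. -/
theorem eq_zero_of_catMatrix_pow_mulVec {m : ℕ} {x : Fin 2 → ℤ}
    (hx : (catMatrix ^ (m + 1)).1.mulVec x = x) : x = 0 := by
  obtain ⟨h1, -, -, h4⟩ := catMatrix_pow_entries m
  have hdet := (catMatrix ^ (m + 1)).2
  rw [Matrix.det_fin_two] at hdet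
  have e0 := congrFun hx 0
  have e1 := congrFun hx 1
  simp only [Matrix.mulVec, dotProduct, Fin.sum_univ_two] at e0 e1
  set M := (catMatrix ^ (m + 1)).1
  have hne : 2 - M 0 0 - M 1 1 ≠ 0 := by omega
  have h0 : (2 - M 0 0 - M 1 1) * x 0 = 0 := by
    linear_combination (M 1 1 - 1) * e0 - M 0 1 * e1 - x 0 * hdet
  have h1' : (2 - M 0 0 - M 1 1) * x 1 = 0 := by
    linear_combination (M 0 0 - 1) * e1 - M 1 0 * e0 - x 1 * hdet
  funext i
  fin_cases i
  · exact (mul_eq_zero.1 h0).resolve_left hne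
  · exact (mul_eq_zero.1 h1').resolve_left hne

theorem infinite_orbit_catMatrix (x : Fin 2 → ℤ) (hx : x ≠ 0) :
    {y | ∃ A ∈ Subgroup.zpowers catMatrix, y = A.1.mulVec x}.Infinite := by
  have hlt : ∀ i j : ℕ, i < j → (catMatrix ^ i).1.mulVec x ≠ (catMatrix ^ j).1.mulVec x := by
    intro i j hij h
    obtain ⟨m, rfl⟩ := Nat.exists_eq_add_of_lt hij
    refine hx (eq_zero_of_catMatrix_pow_mulVec (m := m) ?_)
    have h1 := congrArg (((catMatrix ^ i)⁻¹).1.mulVec) h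
    rw [Matrix.mulVec_mulVec, Matrix.mulVec_mulVec] at h1
    have h2 : ((catMatrix ^ i)⁻¹).1 * (catMatrix ^ i).1 = 1 :=
      congrArg Subtype.val (inv_mul_cancel (catMatrix ^ i))
    have h3 : ((catMatrix ^ i)⁻¹).1 * (catMatrix ^ (i + m + 1)).1 = (catMatrix ^ (m + 1)).1 := by
      have : (catMatrix ^ i)⁻¹ * catMatrix ^ (i + m + 1) = catMatrix ^ (m + 1) := by
        rw [add_assoc, pow_add, inv_mul_cancel_left]
      exact congrArg Subtype.val this
    rw [h2, h3, Matrix.one_mulVec] at h1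
    exact h1.symm
  have hinj : Function.Injective fun i : ℕ => (catMatrix ^ i).1.mulVec x := by
    intro i j h
    rcases lt_trichotomy i j with hij | hij | hij
    · exact absurd h (hlt i j hij)
    · exact hij
    · exact absurd h.symm (hlt j i hij)
  refine (Set.infinite_range_of_injective hinj).mono ?_
  rintro - ⟨i, rfl⟩
  exact ⟨catMatrix ^ i, Subgroup.npow_mem_zpowers catMatrix i, rfl⟩

end Hyperbolic

end

theorem mainTheorem2 :
    -- the construction, for an arbitrary subgroup `Λ` as in the statement
    (∀ (k n : ℕ), 2 ≤ n → ∀ Λ : Subgroup (SLZ (Fin k)),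
      (∀ x : Fin k → ℤ, x ≠ 0 → {y | ∃ A ∈ Λ, y = A.1.mulVec x}.Infinite) →
      ¬ IsRigidAction Λ (Torus (Fin k)) volume →
        -- the rigid action of `Γ` on the dual of `H` has a non-rigid, non-free quotient
        (IsRigidAction (blockGroup n Λ) (Torus (Fin k ⊕ Fin n)) volume ∧
          IsQuotientMapOfActions (blockGroup n Λ) (restrictTorus k n) volume volume ∧
          ¬ IsRigidAction (blockGroup n Λ) (Torus (Fin k)) volume ∧
          ¬ IsEssentiallyFree (blockGroup n Λ) (Torus (Fin k)) volume) ∧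
        -- the diagonal action on two copies of the dual of `H` is free, ergodic and rigid
        (IsEssentiallyFree (blockGroup n Λ) (Torus (Fin k ⊕ Fin n) × Torus (Fin k ⊕ Fin n))
            (volume.prod volume) ∧
          ErgodicSMul (blockGroup n Λ) (Torus (Fin k ⊕ Fin n) × Torus (Fin k ⊕ Fin n))
            (volume.prod volume) ∧
          IsRigidAction (blockGroup n Λ) (Torus (Fin k ⊕ Fin n) × Torus (Fin k ⊕ Fin n))
            (volume.prod volume)) ∧
        -- and it has a free, ergodic, non-rigid quotient
        (IsQuotientMapOfActions (blockGroup n Λ)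
            (Prod.map (restrictTorus k n) (id : Torus (Fin k ⊕ Fin n) → Torus (Fin k ⊕ Fin n)))
            (volume.prod volume) (volume.prod volume) ∧
          IsEssentiallyFree (blockGroup n Λ) (Torus (Fin k) × Torus (Fin k ⊕ Fin n))
            (volume.prod volume) ∧
          ErgodicSMul (blockGroup n Λ) (Torus (Fin k) × Torus (Fin k ⊕ Fin n))
            (volume.prod volume) ∧
          ¬ IsRigidAction (blockGroup n Λ) (Torus (Fin k) × Torus (Fin k ⊕ Fin n))
            (volume.prod volume))) ∧
    -- amenable groups give examples
    (∀ (k : ℕ), 1 ≤ k → ∀ Λ : Subgroup (SLZ (Fin k)), IsAmenableGroup Λ →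
      ¬ IsRigidAction Λ (Torus (Fin k)) volume) ∧
    -- quotients of rigid actions need not be rigid, even for free ergodic actions
    ¬ (∀ (G X Y : Type) [Group G] [Countable G] [MeasurableSpace G] [MeasurableSingletonClass G]
        [MulAction G X] [MeasurableSpace X] [StandardBorelSpace X] [MeasurableConstSMul G X]
        [MulAction G Y] [MeasurableSpace Y] [StandardBorelSpace Y] [MeasurableConstSMul G Y]
        (μ : Measure X) [IsProbabilityMeasure μ] [ErgodicSMul G X μ]
        (ν : Measure Y) [IsProbabilityMeasure ν] [ErgodicSMul G Y ν] (p : X → Y),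
        IsEssentiallyFree G X μ → IsEssentiallyFree G Y ν →
        IsQuotientMapOfActions G p μ ν → IsRigidAction G X μ → IsRigidAction G Y ν) := by
  refine ⟨fun k n hn Λ hΛ hR => blockGroup_actions hn hΛ hR,
    fun k hk Λ hΛ => not_isRigidAction_of_isAmenableGroup hk Λ hΛ, fun h => ?_⟩
  have hR : ¬ IsRigidAction (Subgroup.zpowers catMatrix) (Torus (Fin 2)) volume :=
    not_isRigidAction_of_isAmenableGroup (by norm_num) _ isAmenableGroup_zpowers_catMatrix
  obtain ⟨-, ⟨hfreeX, hergX, hrigidX⟩, hquot, hfreeY, hergY, hrigidY⟩ :=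
    blockGroup_actions (n := 2) le_rfl infinite_orbit_catMatrix hR
  exact hrigidY (h _ _ _ _ _ _ hfreeX hfreeY hquot hrigidX)
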